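/- **Setting.** Let $r\ge 1$ and $s\ge 0$ be integers, and let $\mu=(\mu_1,\dots,\mu_m)$, $\nu=(\nu_1,\dots,\nu_n)$ be non-empty partitions (tuples of positive integers, in any order) with $|\mu|=|\nu|$. Put $\zeta(z)=e^{z/2}-e^{-z/2}$. **Hurwitz numbers.** For partitions $\alpha,\beta$ (possibly empty) of the same number $d$ and $k\ge 0$, the disconnected double Hurwitz number with $k$ completed $(r+1)$-cycles is $$h^{k}_{\alpha,\beta}=\frac{1}{\prod_i\alpha_i\prod_j\beta_j}\sum_{\lambda\vdash d}\chi^\lambda_\alpha\Big(\frac{p_{r+1}(\lambda)}{(r+1)!}\Big)^{k}\chi^\lambda_\beta ,\qquad p_{k}(\lambda)=\sum_{i\ge1}\Big(\big(\lambda_i-i+\tfrac12\big)^{k}-\big(-i+\tfrac12\big)^{k}\Big),$$ where $\chi^\lambda$ is the irreducible character of $S_d$ attached to $\lambda$; put $h^k_{\alpha,\beta}=0$ if $|\alpha|\ne|\beta|$. The connected number $h^{s,\circ}_{\mu,\nu}$ is obtained from these by inclusion-exclusion: $$h^{s,\circ}_{\mu,\nu}=\sum_{\pi}(-1)^{|\pi|-1}(|\pi|-1)!\prod_{B\in\pi}h^{|B_3|}_{\mu_{B_1},\nu_{B_2}},$$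 where $\pi$ runs over the set partitions of $[m]\sqcup[n]\sqcup[s]$, the block $B$ is written as $B_1\sqcup B_2\sqcup B_3$, and $\mu_{B_1}$, $\nu_{B_2}$ here denote the sub-tuples of the parts $\mu_i$, $i\in B_1$, and $\nu_j$, $j\in B_2$. **Commutation patterns.** For $I\subset[m]$, $J\subset[n]$, $K\subset[s]$ put $\mu_I=\sum_{i\in I}\mu_i$, $\nu_J=\sum_{j\in J}\nu_j$, $z_K=\sum_{k\in K}z_k$ (here these are numbers and linear forms). Consider words in symbols $\mathcal E(I,J,K)$; the integer $\mu_I-\nu_J$ is the energy of the symbol. Start from the word $$\prod_{i=1}^m\mathcal E(\{i\},\emptyset,\emptyset)\prod_{k=1}^s\mathcal E(\emptyset,\emptyset,\{k\})\prod_{j=1}^n\mathcal E(\emptyset,\{j\},\emptyset).$$ As long as the word has a symbol of negative energy, let $b=\mathcal E(M,N,R)$ be the leftmost one. If $b$ is the first symbol of the word, the run is discarded. Otherwise let $a=\mathcal E(I,J,K)$ be its left neighbour, and either replace $ab$ by $ba$ (passing), or replace $ab$ by $\mathcal E(I\cup M,J\cup N,K\cup R)$ (commutator), recording the six-tuple $(I,J,K,M,N,R)$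 and the factor $$\zeta\begin{pmatrix}I&J&K\\M&N&R\end{pmatrix}=\zeta\big((\mu_I-\nu_J)z_R-(\mu_M-\nu_N)z_K\big).$$ If $K=R=\emptyset$ and the two energies are $e$ and $-e$, this factor, formally $\zeta(0)$, is read as $\zeta(et)$ with a formal variable $t$. A run is complete when all symbols of the word have energy $0$. A commutation pattern $P$ is the sequence of six-tuples $(P^l_I,P^l_J,P^l_K,P^l_M,P^l_N,P^l_R)$, $l\in L(P)$, recorded in a complete run in which no factor is the zero series and at whose end no symbol $\mathcal E(\emptyset,\emptyset,\{k\})$ is left. Let $T(P)$ be the set of symbols of the final word. The pattern is connected if $|T(P)|=1$; the set of connected patterns is denoted by $CP^{s,\circ}_{\mu,\nu}$. **Theorem.** The set $CP^{s,\circ}_{\mu,\nu}$ is finite, the sum over $P\in CP^{s,\circ}_{\mu,\nu}$ below is divisible by $\zeta(z_{[s]})\neq 0$ in the ring of formal power series over $\mathbb Q$, and $$h^{s,\circ}_{\mu,\nu}=\frac{1}{\prod_{i=1}^{m}\mu_i\prod_{j=1}^{n}\nu_j}\,[z_1^{r+1}\cdots z_s^{r+1}]\;\frac{1}{\zeta(z_{[s]})}\sum_{P\in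 CP^{s,\circ}_{\mu,\nu}}\ \prod_{l\in L(P)}\zeta\begin{pmatrix}P^l_I&P^l_J&P^l_K\\P^l_M&P^l_N&P^l_R\end{pmatrix}.$$ Here the power series are in $z_1,\dots,z_s$ and $t$; if $s=0$, then $z_{[s]}=0$ is replaced by $t$; and $t$ is set to $0$ in the quotient. -/

import Mathlib

open Equiv Finset

namespace CompletedCycles

noncomputable section

/-! ### Irreducible characters of symmetric groups

For a Young diagram `Y` with `d` cells the symmetric group `S_d` is realised as the group of
permutations of the cells of `Y`. The irreducible representation attached to `Y` is the left ideal
of the group algebra generated by the Young symmetrizer. -/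

/-- The cells of a Young diagram, as a type. -/
abbrev Cell (Y : YoungDiagram) : Type := {c : ℕ × ℕ // c ∈ Y.cells}

/-- The Young symmetrizer `(∑_p p) * (∑_q sgn(q) q)`, where `p` runs over the permutations of the
cells that preserve every row and `q` over those that preserve every column. -/
def youngSymmetrizer (Y : YoungDiagram) : MonoidAlgebra ℚ (Perm (Cell Y)) :=
  (∑ p : Perm (Cell Y) with ∀ c, (p c).1.1 = c.1.1, MonoidAlgebra.single p (1 : ℚ)) *
  (∑ q : Perm (Cell Y) with ∀ c, (q c).1.2 = c.1.2,
    MonoidAlgebra.single q ((Perm.sign q : ℤ) : ℚ))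

/-- The irreducible representation space attached to `Y`: the left ideal of the group algebra that
is generated by the Young symmetrizer. -/
abbrev IrrepSpace (Y : YoungDiagram) : Type :=
  ↥(Submodule.span (MonoidAlgebra ℚ (Perm (Cell Y))) {youngSymmetrizer Y})

/-- The irreducible representation attached to `Y`: the symmetric group acts on the left ideal by
left multiplication. -/
def irrep (Y : YoungDiagram) : Perm (Cell Y) →* Module.End ℚ (IrrepSpace Y) :=
  ((Algebra.lsmul ℚ ℚ (IrrepSpace Y) :
      MonoidAlgebra ℚ (Perm (Cell Y)) →ₐ[ℚ] Module.End ℚ (IrrepSpace Y)) :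
    MonoidAlgebra ℚ (Perm (Cell Y)) →* Module.End ℚ (IrrepSpace Y)).comp
    (MonoidAlgebra.of ℚ (Perm (Cell Y)))

open Classical in
/-- The value of the irreducible character attached to `Y` on the conjugacy class of
permutations whose cycle lengths (fixed points included) form the multiset `a`. Such permutations
exist if and only if the members of `a` are positive and add up to the number of cells of `Y`. -/
def irrChar (Y : YoungDiagram) (a : Multiset ℕ) : ℚ :=
  if h : ∃ σ : Perm (Cell Y), σ.partition.parts = a
  then LinearMap.trace ℚ (IrrepSpace Y) (irrep Y h.choose)
  else 0

/-! ### Hurwitz numbers with completed cycles -/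

/-- The Young diagram of a partition. -/
def diagram {d : ℕ} (p : Nat.Partition d) : YoungDiagram :=
  YoungDiagram.ofRowLens (p.parts.sort (· ≥ ·)) (p.parts.pairwise_sort (· ≥ ·)).sortedGE

/-- The shifted symmetric power sum
`p_k = ∑_{i ≥ 1} ((Y_i - i + 1/2)^k - (-i + 1/2)^k)`; the rows are numbered from `0` here, and the
terms beyond the last nonempty row vanish. -/
def shiftedPowerSum (k : ℕ) (Y : YoungDiagram) : ℚ :=
  ∑ i ∈ range (Y.colLen 0),
    (((Y.rowLen i : ℚ) - ((i : ℚ) + 1) + 1 / 2) ^ k - (-((i : ℚ) + 1) + 1 / 2) ^ k)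

/-- The (possibly disconnected) double Hurwitz number with `s` completed `(r + 1)`-cycles and
ramification profiles `a`, `b`, by the character formula. It is `0` if `a` and `b` are not
partitions of the same number. -/
def hurwitz (r s : ℕ) (a b : Multiset ℕ) : ℚ :=
  if a.sum = b.sum then
    1 / ((a.prod : ℚ) * (b.prod : ℚ)) *
      ∑ p : Nat.Partition a.sum,
        irrChar (diagram p) a *
          (shiftedPowerSum (r + 1) (diagram p) / (Nat.factorial (r + 1) : ℚ)) ^ s *
          irrChar (diagram p) b
  else 0

variable {m n s : ℕ}

/-- The disconnected Hurwitz number of a set `B` of labels: the parts of `μ`, the parts of `ν` and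
the completed cycles whose labels lie in `B`. -/
def hurwitzOn (r : ℕ) (μ : Fin m → ℕ) (ν : Fin n → ℕ) (B : Finset (Fin m ⊕ Fin n ⊕ Fin s)) : ℚ :=
  hurwitz r (#{k : Fin s | Sum.inr (Sum.inr k) ∈ B})
    (({i : Fin m | Sum.inl i ∈ B} : Finset (Fin m)).val.map μ)
    (({j : Fin n | Sum.inr (Sum.inl j) ∈ B} : Finset (Fin n)).val.map ν)

/-- The connected double Hurwitz number with `s` completed `(r + 1)`-cycles. A covering whose
preimages of `0` and `∞` and whose branch points are labelled splits the labels among its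
components, so that the disconnected number of any set of labels is the sum over the set
partitions of it of the products of the connected numbers of the blocks. This is the
inclusion-exclusion (Möbius inversion over set partitions) that results. -/
def connectedHurwitz (r s : ℕ) (μ : Fin m → ℕ) (ν : Fin n → ℕ) : ℚ :=
  ∑ π : Finpartition (univ : Finset (Fin m ⊕ Fin n ⊕ Fin s)),
    (-1 : ℚ) ^ (#π.parts - 1) * (Nat.factorial (#π.parts - 1) : ℚ) *
      ∏ B ∈ π.parts, hurwitzOn r μ ν B

/-! ### The commutation algorithm -/

/-- The index `(I, J, K)` of an operator `𝓔(I, J, K) = 𝓔_{μ_I - ν_J}(z_K)`. -/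
structure Op (m n s : ℕ) where
  I : Finset (Fin m)
  J : Finset (Fin n)
  K : Finset (Fin s)

/-- The energy `μ_I - ν_J` of `𝓔(I, J, K)`. -/
def Op.energy (μ : Fin m → ℕ) (ν : Fin n → ℕ) (a : Op m n s) : ℤ :=
  ∑ i ∈ a.I, (μ i : ℤ) - ∑ j ∈ a.J, (ν j : ℤ)

/-- The operator that the commutator of `𝓔(I, J, K)` and `𝓔(M, N, R)` produces:
`𝓔(I ∪ M, J ∪ N, K ∪ R)`. -/
def Op.merge (a b : Op m n s) : Op m n s := ⟨a.I ∪ b.I, a.J ∪ b.J, a.K ∪ b.K⟩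

/-- The product of operators that the algorithm starts from:
`∏_i 𝓔({i}, ∅, ∅) ∏_k 𝓔(∅, ∅, {k}) ∏_j 𝓔(∅, {j}, ∅)`. -/
def startOps (m n s : ℕ) : List (Op m n s) :=
  List.ofFn (fun i : Fin m => ⟨{i}, ∅, ∅⟩) ++
    (List.ofFn (fun k : Fin s => ⟨∅, ∅, {k}⟩) ++ List.ofFn (fun j : Fin n => ⟨∅, {j}, ∅⟩))

/-- `Run μ ν w P w'`: with suitable choices, the algorithm leads from the product of operators `w`
to the product `w'` of operators of energy zero, and the commutators that are taken on the way are
those of the pairs in `P`, in this order. In each step the leftmost operator `b` of negative energy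
is commuted with its left neighbour `a`, and one goes on either with the passing term or with the
commutator term. If `b` has no left neighbour, the vacuum expectation is zero and there is
no run. -/
inductive Run (μ : Fin m → ℕ) (ν : Fin n → ℕ) :
    List (Op m n s) → List (Op m n s × Op m n s) → List (Op m n s) → Prop
  | done (w : List (Op m n s)) (hw : ∀ a ∈ w, a.energy μ ν = 0) : Run μ ν w [] w
  | pass (u v : List (Op m n s)) (a b : Op m n s) (P : List (Op m n s × Op m n s))
      (w' : List (Op m n s)) (hu : ∀ c ∈ u, 0 ≤ c.energy μ ν) (ha : 0 ≤ a.energy μ ν)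
      (hb : b.energy μ ν < 0) (h : Run μ ν (u ++ b :: a :: v) P w') :
      Run μ ν (u ++ a :: b :: v) P w'
  | commutator (u v : List (Op m n s)) (a b : Op m n s) (P : List (Op m n s × Op m n s))
      (w' : List (Op m n s)) (hu : ∀ c ∈ u, 0 ≤ c.energy μ ν) (ha : 0 ≤ a.energy μ ν)
      (hb : b.energy μ ν < 0) (h : Run μ ν (u ++ a.merge b :: v) P w') :
      Run μ ν (u ++ a :: b :: v) ((a, b) :: P) w'

/-! ### The `ζ`-factors

They are formal power series in `z_1, …, z_s` (the variables `some k`) and the formal variable `t`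
(the variable `none`) that is used to interpret `ζ(0) 𝓔_0(0)`. -/

/-- Formal power series in `t` and `z_1, …, z_s`. -/
abbrev Series (s : ℕ) : Type := MvPowerSeries (Option (Fin s)) ℚ

/-- The formal variable `t`. -/
def tVar (s : ℕ) : Series s := MvPowerSeries.X none

/-- `z_K = ∑_{k ∈ K} z_k`. -/
def zSum (K : Finset (Fin s)) : Series s := ∑ k ∈ K, MvPowerSeries.X (some k)

/-- `ζ(ℓ) = exp(ℓ / 2) - exp(-ℓ / 2)` for a series `ℓ` with constant term zero. -/
def zeta (l : Series s) : Series s :=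
  (PowerSeries.exp ℚ).subst ((1 / 2 : ℚ) • l) - (PowerSeries.exp ℚ).subst ((-1 / 2 : ℚ) • l)

/-- The factor that the commutator of `a = (I, J, K)` and `b = (M, N, R)` produces:
`ζ((μ_I - ν_J) z_R - (μ_M - ν_N) z_K)`. In the case of `[𝓔_e(0), 𝓔_{-e}(0)]`, where this is `ζ(0)`,
the zero in the argument is replaced by `e t`. -/
def zetaFactor (μ : Fin m → ℕ) (ν : Fin n → ℕ) (a b : Op m n s) : Series s :=
  if a.K = ∅ ∧ b.K = ∅ ∧ a.energy μ ν + b.energy μ ν = 0 then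
    zeta ((a.energy μ ν : ℚ) • tVar s)
  else
    zeta ((a.energy μ ν : ℚ) • zSum b.K - (b.energy μ ν : ℚ) • zSum a.K)

/-- The product of the factors of all commutators in `P`. -/
def zetaProd (μ : Fin m → ℕ) (ν : Fin n → ℕ) (P : List (Op m n s × Op m n s)) : Series s :=
  (P.map fun c => zetaFactor μ ν c.1 c.2).prod

/-- The argument `z_S` of a final operator `𝓔_0(z_S)`, where `z_∅ = 0` is replaced by `t` (an
operator `𝓔_0(0)` arises only from `[𝓔_e(0), 𝓔_{-e}(0)]`). -/
def finalArg (S : Finset (Fin s)) : Series s := if S = ∅ then tVar s else zSum S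

/-- `P` is a commutation pattern and `w` is its final product of operators of energy zero (indexed
by `T(P)`): `P` is the sequence of commutators of a run of the algorithm whose contribution to the
vacuum expectation value does not vanish. That is, no `ζ`-factor is zero, and none of the
(regularized) operators `𝓔(∅, ∅, {k})`, whose vacuum expectation is zero, is left over. -/
def IsCommutationPattern (μ : Fin m → ℕ) (ν : Fin n → ℕ)
    (P : List (Op m n s × Op m n s)) (w : List (Op m n s)) : Prop :=
  Run μ ν (startOps m n s) P w ∧ zetaProd μ ν P ≠ 0 ∧
    ∀ k : Fin s, (⟨∅, ∅, {k}⟩ : Op m n s) ∉ w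

/-- The connected commutation patterns: those with `|T(P)| = 1`. -/
def connectedPatterns (s : ℕ) (μ : Fin m → ℕ) (ν : Fin n → ℕ) :
    Set (List (Op m n s × Op m n s)) :=
  {P | ∃ w, IsCommutationPattern μ ν P w ∧ w.length = 1}

/-- `[z_1^{r+1} ⋯ z_s^{r+1}]` at `t = 0`. -/
def coeffAt (r : ℕ) (Q : Series s) : ℚ :=
  MvPowerSeries.coeff
    (Finsupp.equivFunOnFinite.symm fun x : Option (Fin s) => x.elim 0 fun _ => r + 1) Q

end

end CompletedCycles

namespace CompletedCycles

/-! ### Traces on left ideals of group algebras -/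

section GroupAlgebra

variable {G : Type*} [Group G] [Fintype G]

/-! The theorem is a computation in the fermionic Fock space. Let `𝓔_e(z)` move one particle from
`k` to `k - e` with weight `exp(z (k + 1/2 - e/2))`. On the state of a Young diagram `𝓔_0(z)` is
diagonal, and its regularized eigenvalue has the numbers `p_k / k!` as coefficients. The matrix
coefficients of products of the `𝓔_{±e}(0)` are characters of symmetric groups. So the generating
series of the disconnected numbers, multiplied by the parts, is the vacuum expectation of the
initial word (`vev_startOn_eq`). The relation `[𝓔_a(z), 𝓔_b(w)] = ζ(a w - b z) 𝓔_{a+b}(z + w)`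
evaluates this expectation by the commutation algorithm.

Fock space is replaced by alternating functions of `N = |ν|` positions with a floor at `-N`. In a
state of energy `E` the sea is full below depth `E`, so the floor disturbs the relation only by a
geometric sum that occurs at total energy zero (`hop_commutator`). The scalars in `opAct` absorb
that sum (`opAct_commutator`).

The irreducible characters `χ` come from Young symmetrizers, so Frobenius' formula `χ = ω` has to be
proved, where `ω` is an alternating sum of permutation characters. The norm of `χ` is one because `c
y c` is always a multiple of the symmetrizer `c`. The pairing of `χ` and `ω` is one because the
symmetrizer pairs with permutation characters in a way that is triangular for dominance
(`sum_youngSymmetrizer_frobChar`). The norm of `ω` is one because the values of `ω` are fermionic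
matrix coefficients, and the commutators of creation and annihilation operators give their
orthogonality (`lower_raise`, `sum_frob_sq`). Hence `χ - ω` has norm zero.

For connectedness, let `C(w)` be the sum over the connected patterns from a word `w`, divided by `ζ`
of the sum of the variables of `w`. It satisfies the same recursion as the expectation. Induction
along the algorithm then shows that the expectation is the sum, over the label sets `A` that contain
a fixed label, of `C` of the part in `A` times the expectation of the rest (`IsExpectation.split`).
This recursion characterizes inclusion-exclusion over set partitions (`eq_cumulant`), so `C` of the
initial word is the cumulant of the generating series. Distinct blocks involve distinct variables,
so taking the coefficient commutes with inclusion-exclusion (`coeffAt_cumulant`).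

For `s > 0` a factor `ζ(e t)` never contributes to a connected pattern: it creates an identity
operator, and any further commutator with that has factor zero. For `s = 0` a connected pattern with
nonzero product consists of one such factor, and `ζ(e t) / ζ(t)` has constant term `e`, as the
commutator of `𝓔_e(0)` and `𝓔_{-e}(0)` requires. -/

theorem trace_mulLeft_mulRight (x c : MonoidAlgebra ℚ G) :
    LinearMap.trace ℚ (MonoidAlgebra ℚ G) (LinearMap.mulLeft ℚ x ∘ₗ LinearMap.mulRight ℚ c) =
      ∑ h : G, (x * (MonoidAlgebra.single h 1 * c)).coeff h := by
  classical
  rw [LinearMap.trace_eq_matrix_trace ℚ (MonoidAlgebra.basis G ℚ), Matrix.trace]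
  refine Finset.sum_congr rfl fun h _ => ?_
  rw [Matrix.diag_apply, LinearMap.toMatrix_apply, MonoidAlgebra.basis_apply]
  rfl

/-- The trace of left multiplication by `x` on the left ideal generated by `c`. -/
noncomputable def idealTrace (c x : MonoidAlgebra ℚ G) : ℚ :=
  LinearMap.trace ℚ (Submodule.span (MonoidAlgebra ℚ G) {c})
    (Algebra.lsmul ℚ ℚ (Submodule.span (MonoidAlgebra ℚ G) {c}) x)

/-- Right multiplication by `c` maps the whole algebra into the ideal and acts on the ideal as the
scalar `n`. So `y ↦ x y c` has the same trace on the algebra as `n x` has on the ideal, and on the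
algebra the trace can be read off in the basis of group elements. -/
theorem idealTrace_eq {c : MonoidAlgebra ℚ G} {n : ℚ} (hcc : c * c = n • c)
    (x : MonoidAlgebra ℚ G) :
    n * idealTrace c x = ∑ h : G, (x * (MonoidAlgebra.single h 1 * c)).coeff h := by
  rw [← trace_mulLeft_mulRight]
  have key := LinearMap.trace_restrict_eq_of_forall_mem
    ((Submodule.span (MonoidAlgebra ℚ G) {c}).restrictScalars ℚ)
    (LinearMap.mulLeft ℚ x ∘ₗ LinearMap.mulRight ℚ c)
    (fun y => by
      rw [Submodule.restrictScalars_mem, Submodule.mem_span_singleton]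
      exact ⟨x * y, by simp [mul_assoc]⟩)
  rw [← key, idealTrace]
  have : (LinearMap.mulLeft ℚ x ∘ₗ LinearMap.mulRight ℚ c).restrict
      (p := (Submodule.span (MonoidAlgebra ℚ G) {c}).restrictScalars ℚ)
      (q := (Submodule.span (MonoidAlgebra ℚ G) {c}).restrictScalars ℚ)
      (fun y _ => by
        rw [Submodule.restrictScalars_mem, Submodule.mem_span_singleton]
        exact ⟨x * y, by simp [mul_assoc]⟩) =
      n • (show Module.End ℚ ((Submodule.span (MonoidAlgebra ℚ G) {c}).restrictScalars ℚ) from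
        Algebra.lsmul ℚ ℚ (Submodule.span (MonoidAlgebra ℚ G) {c}) x) := by
    ext1 ⟨y, hy⟩
    rw [Submodule.restrictScalars_mem, Submodule.mem_span_singleton] at hy
    obtain ⟨z, rfl⟩ := hy
    apply Subtype.ext
    change x * ((z • c) * c) = n • (x * (z • c))
    simp only [smul_eq_mul, mul_assoc, hcc, mul_smul_comm]
  rw [this, map_smul, smul_eq_mul]
  rfl

theorem idealTrace_linear (c : MonoidAlgebra ℚ G) (x : MonoidAlgebra ℚ G) :
    idealTrace c x = ∑ g : G, x.coeff g * idealTrace c (MonoidAlgebra.single g 1) := by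
  classical
  let φ : MonoidAlgebra ℚ G →ₗ[ℚ] ℚ :=
    LinearMap.trace ℚ (Submodule.span (MonoidAlgebra ℚ G) {c}) ∘ₗ
      (Algebra.lsmul ℚ ℚ (Submodule.span (MonoidAlgebra ℚ G) {c})).toLinearMap
  have hx : x = ∑ g : G, x.coeff g • MonoidAlgebra.single g (1 : ℚ) := by
    have := (MonoidAlgebra.basis G ℚ).sum_repr x
    simp only [MonoidAlgebra.basis_apply] at this
    exact this.symm
  change φ x = ∑ g : G, x.coeff g * φ (MonoidAlgebra.single g 1)
  conv_lhs => rw [hx]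
  simp only [map_sum, map_smul, smul_eq_mul]

omit [Fintype G] in
theorem idealTrace_conj (c : MonoidAlgebra ℚ G) (g h : G) :
    idealTrace c (MonoidAlgebra.single (h * g * h⁻¹) 1) =
      idealTrace c (MonoidAlgebra.single g 1) := by
  have e : (MonoidAlgebra.single (h * g * h⁻¹) (1 : ℚ)) =
      MonoidAlgebra.single h 1 * MonoidAlgebra.single g 1 * MonoidAlgebra.single h⁻¹ 1 := by
    simp [MonoidAlgebra.single_mul_single]
  rw [idealTrace, e, map_mul, LinearMap.trace_mul_comm, ← map_mul, ← mul_assoc,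
    MonoidAlgebra.single_mul_single, MonoidAlgebra.single_mul_single]
  simp [idealTrace]

/-- This turns inner products of characters into sums over the coefficients of `c`. After the trace
is expanded over `h`, the substitution `g ↦ h g⁻¹ h⁻¹` makes every `h` contribute the same, since
`θ` is a class function. -/
theorem sum_idealTrace_mul {c : MonoidAlgebra ℚ G} {n : ℚ} (hcc : c * c = n • c)
    (θ : G → ℚ) (hθ : ∀ g h, θ (h * g * h⁻¹) = θ g) :
    n * ∑ g, idealTrace c (MonoidAlgebra.single g 1) * θ g =
      Fintype.card G * ∑ g, c.coeff g * θ g⁻¹ := by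
  rw [Finset.mul_sum]
  simp only [← mul_assoc, idealTrace_eq hcc, Finset.sum_mul]
  rw [Finset.sum_comm, ← nsmul_eq_mul, ← Finset.card_univ, ← Finset.sum_const]
  refine Finset.sum_congr rfl fun h _ => ?_
  rw [← Equiv.sum_comp ((Equiv.inv G).trans (MulAut.conj h).toEquiv)]
  refine Finset.sum_congr rfl fun g _ => ?_
  simp only [Equiv.trans_apply, Equiv.inv_apply, MulEquiv.toEquiv_eq_coe, EquivLike.coe_coe,
    MulAut.conj_apply, hθ]
  rw [mul_assoc (MonoidAlgebra.single (h * g⁻¹ * h⁻¹) 1)]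
  rw [MonoidAlgebra.coeff_single_mul_apply, MonoidAlgebra.coeff_single_mul_apply]
  simp [mul_assoc]

/-- If `c y c` is a multiple of `c` for all `y`, then the left ideal of `c` is absolutely
irreducible. -/
theorem idealTrace_self {c : MonoidAlgebra ℚ G} {n : ℚ} (hc0 : c ≠ 0) (hn : n ≠ 0)
    (hcc : c * c = n • c) (hc : ∀ y, ∃ r : ℚ, c * y * c = r • c) : idealTrace c c = n := by
  have h1 := idealTrace_eq hcc c
  rw [← trace_mulLeft_mulRight] at h1
  choose φ hφ using hc
  let Φ : MonoidAlgebra ℚ G →ₗ[ℚ] ℚ :=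
    { toFun := φ
      map_add' := fun x y => by
        apply smul_left_injective ℚ hc0
        simp only [add_smul, ← hφ, mul_add, add_mul]
      map_smul' := fun r x => by
        apply smul_left_injective ℚ hc0
        simp only [smul_assoc, ← hφ, RingHom.id_apply, mul_smul_comm, smul_mul_assoc] }
  -- The map `y ↦ c y c` has rank one, so its trace is `Φ c = n²`, while `h1` says that its trace is
  -- `n` times the trace on the ideal.
  have h2 : LinearMap.mulLeft ℚ c ∘ₗ LinearMap.mulRight ℚ c = Φ.smulRight c := by
    refine LinearMap.ext fun y => ?_
    change c * (y * c) = φ y • c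
    rw [← hφ, mul_assoc]
  rw [h2, LinearMap.trace_smulRight] at h1
  have h3 : Φ c = n * n := by
    apply smul_left_injective ℚ hc0
    change φ c • c = (n * n) • c
    rw [← hφ, hcc, smul_mul_assoc, hcc, smul_smul]
  rw [h3] at h1
  exact mul_left_cancel₀ hn h1

/-- For `n = 0`, right multiplication by `c` would be nilpotent and have trace zero, but its trace
is the group order times the coefficient of `c` at the identity. -/
theorem sq_scalar_ne_zero {c : MonoidAlgebra ℚ G} {n : ℚ} (hcc : c * c = n • c)
    (h1 : c.coeff 1 = 1) : n ≠ 0 := by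
  rintro rfl
  have h := trace_mulLeft_mulRight 1 c
  rw [zero_smul] at hcc
  have hnil : IsNilpotent (LinearMap.mulLeft ℚ 1 ∘ₗ LinearMap.mulRight ℚ c) := by
    refine ⟨2, ?_⟩
    refine LinearMap.ext fun y => ?_
    simp [pow_two, mul_assoc, hcc]
  have h0 := (LinearMap.isNilpotent_trace_of_isNilpotent hnil).eq_zero
  rw [h0] at h
  simp only [one_mul, MonoidAlgebra.coeff_single_mul_apply, inv_mul_cancel, h1] at h
  simp at h
  exact Nat.cast_ne_zero.2 Fintype.card_ne_zero h.symm

end GroupAlgebra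

/-! ### Young symmetrizers -/

section Young

variable {Y : YoungDiagram}

/-- Maps on the cells that are injective on every column. -/
def ColumnInjective {α : Type*} (f : Cell Y → α) : Prop :=
  ∀ c d : Cell Y, c.1.2 = d.1.2 → f c = f d → c = d

theorem card_row_eq (i : ℕ) : #{c : Cell Y | c.1.1 = i} = Y.rowLen i := by
  rw [YoungDiagram.rowLen_eq_card]
  refine Finset.card_bij (fun c _ => c.1) ?_ ?_ ?_
  · rintro ⟨c, hc⟩ h
    simpa [YoungDiagram.mem_row_iff, ← YoungDiagram.mem_cells, hc] using h
  · exact fun c _ d _ h => Subtype.ext h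
  · intro c hc
    rw [YoungDiagram.mem_row_iff] at hc
    exact ⟨⟨c, hc.1⟩, by simpa using hc.2, rfl⟩

/-- A column of length `l` has at most `min k l` cells with pairwise distinct values below `k`, and
the row numbers attain this bound. Summed over the columns, this is the dominance inequality behind
the triangularity. -/
theorem card_column_lt_le {f : Cell Y → ℕ} (hf : ColumnInjective f) (k j : ℕ) :
    #{c : Cell Y | f c < k ∧ c.1.2 = j} ≤ #{c : Cell Y | c.1.1 < k ∧ c.1.2 = j} := by
  rcases le_total k (Y.colLen j) with hk | hk
  · calc _ ≤ #(range k) := by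
          refine Finset.card_le_card_of_injOn f (fun c hc => ?_) fun c hc d hd h => ?_
          · simp at hc ⊢
            exact hc.1
          · simp at hc hd
            exact hf c d (hc.2.trans hd.2.symm) h
      _ ≤ _ := by
          refine Finset.card_le_card_of_surjOn (fun c => c.1.1) fun i hi => ?_
          have hi' : i < k := by simpa using hi
          have hm : (i, j) ∈ Y := YoungDiagram.mem_iff_lt_colLen.2 (hi'.trans_le hk)
          exact ⟨⟨(i, j), hm⟩, by simpa using hi', rfl⟩
  · refine Finset.card_le_card fun c hc => ?_
    simp only [mem_filter, mem_univ, true_and] at hc ⊢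
    refine ⟨?_, hc.2⟩
    have hm : (c.1.1, c.1.2) ∈ Y := c.2
    rw [hc.2] at hm
    exact (YoungDiagram.mem_iff_lt_colLen.1 hm).trans_le hk

theorem card_eq_sum_columns (p : Cell Y → Prop) [DecidablePred p] :
    #{c : Cell Y | p c} =
      ∑ j ∈ univ.image (fun c : Cell Y => c.1.2), #{c : Cell Y | p c ∧ c.1.2 = j} := by
  rw [Finset.card_eq_sum_card_fiberwise (f := fun c : Cell Y => c.1.2)
    (t := univ.image (fun c : Cell Y => c.1.2)) (fun c _ => by simp)]
  simp only [Finset.filter_filter]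

theorem card_lt_le {f : Cell Y → ℕ} (hf : ColumnInjective f) (k : ℕ) :
    #{c : Cell Y | f c < k} ≤ #{c : Cell Y | c.1.1 < k} := by
  rw [card_eq_sum_columns, card_eq_sum_columns]
  exact Finset.sum_le_sum fun j _ => card_column_lt_le hf k j

/-- A column-injective filling with the row lengths as content is obtained from the row numbers
by a permutation of the columns. -/
theorem exists_column_perm {f : Cell Y → ℕ} (hf : ColumnInjective f)
    (hc : ∀ k, #{c : Cell Y | f c < k} = #{c : Cell Y | c.1.1 < k}) :
    ∃ q : Perm (Cell Y), (∀ c, (q c).1.2 = c.1.2) ∧ ∀ c, (q c).1.1 = f c := by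
  -- Equality of the totals forces equality in every column. With `k` the length of the column of
  -- `c`, all of its cells have row number below `k`, hence also value below `k`.
  have hlt : ∀ c : Cell Y, (f c, c.1.2) ∈ Y := by
    intro c
    have h := hc (Y.colLen c.1.2)
    rw [card_eq_sum_columns, card_eq_sum_columns,
      Finset.sum_eq_sum_iff_of_le fun j _ => card_column_lt_le hf _ j] at h
    have h' := h c.1.2 (by simp)
    have hsub : ({d : Cell Y | f d < Y.colLen c.1.2 ∧ d.1.2 = c.1.2} : Finset (Cell Y)) ⊆
        ({d : Cell Y | d.1.1 < Y.colLen c.1.2 ∧ d.1.2 = c.1.2} : Finset (Cell Y)) := by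
      intro d hd
      simp only [mem_filter, mem_univ, true_and] at hd ⊢
      refine ⟨?_, hd.2⟩
      have hm : (d.1.1, d.1.2) ∈ Y := d.2
      rw [hd.2] at hm
      exact YoungDiagram.mem_iff_lt_colLen.1 hm
    have heq := Finset.eq_of_subset_of_card_le hsub h'.ge
    have hm : (c.1.1, c.1.2) ∈ Y := c.2
    have : c ∈ ({d : Cell Y | d.1.1 < Y.colLen c.1.2 ∧ d.1.2 = c.1.2} : Finset (Cell Y)) := by
      simpa using YoungDiagram.mem_iff_lt_colLen.1 hm
    rw [← heq] at this
    simp only [mem_filter, mem_univ, true_and] at this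
    exact YoungDiagram.mem_iff_lt_colLen.2 this.1
  let q : Cell Y → Cell Y := fun c => ⟨(f c, c.1.2), hlt c⟩
  have hq : Function.Injective q := by
    intro c d h
    have h' := congrArg Subtype.val h
    simp only [q, Prod.mk.injEq] at h'
    exact hf c d h'.2 h'.1
  exact ⟨Equiv.ofBijective q (Finite.injective_iff_bijective.1 hq), fun c => rfl, fun c => rfl⟩

variable (Y)

/-- The permutations that preserve every row. -/
def rowGroup : Subgroup (Perm (Cell Y)) where
  carrier := {p | ∀ c, (p c).1.1 = c.1.1}
  mul_mem' {a b} ha hb c := (ha (b c)).trans (hb c)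
  one_mem' _ := rfl
  inv_mem' {a} ha c := by rw [← ha (a⁻¹ c), Perm.inv_def, Equiv.apply_symm_apply]

/-- The permutations that preserve every column. -/
def colGroup : Subgroup (Perm (Cell Y)) where
  carrier := {p | ∀ c, (p c).1.2 = c.1.2}
  mul_mem' {a b} ha hb c := (ha (b c)).trans (hb c)
  one_mem' _ := rfl
  inv_mem' {a} ha c := by rw [← ha (a⁻¹ c), Perm.inv_def, Equiv.apply_symm_apply]

noncomputable instance : Fintype (rowGroup Y) := Fintype.ofFinite _

noncomputable instance : Fintype (colGroup Y) := Fintype.ofFinite _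

variable {Y}

theorem mem_rowGroup {p : Perm (Cell Y)} : p ∈ rowGroup Y ↔ ∀ c, (p c).1.1 = c.1.1 := Iff.rfl

theorem mem_colGroup {p : Perm (Cell Y)} : p ∈ colGroup Y ↔ ∀ c, (p c).1.2 = c.1.2 := Iff.rfl

theorem eq_one_of_mem_rowGroup_of_mem_colGroup {p : Perm (Cell Y)} (h1 : p ∈ rowGroup Y)
    (h2 : p ∈ colGroup Y) : p = 1 :=
  Equiv.ext fun c => Subtype.ext (Prod.ext (h1 c) (h2 c))

/-- If `g` sends the cells of each column to different rows, then the rows of the images form a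
column-injective filling whose content is given by the row lengths, and a column permutation
accounts for it. Otherwise two cells of one column land in one row. -/
theorem exists_mul_eq_or (g : Perm (Cell Y)) :
    (∃ p ∈ rowGroup Y, ∃ q ∈ colGroup Y, g = p * q) ∨
      ∃ c d : Cell Y, c ≠ d ∧ swap c d ∈ colGroup Y ∧ swap (g c) (g d) ∈ rowGroup Y := by
  by_cases hf : ColumnInjective fun c => (g c).1.1
  · left
    obtain ⟨q, hq, hqf⟩ := exists_column_perm hf fun k => by
      refine Finset.card_equiv g fun c => ?_
      simp
    refine ⟨g * q⁻¹, fun c => ?_, q, hq, by group⟩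
    rw [Perm.mul_apply, ← hqf, Perm.inv_def, Equiv.apply_symm_apply]
  · right
    unfold ColumnInjective at hf
    push Not at hf
    obtain ⟨c, d, h1, h2, h3⟩ := hf
    refine ⟨c, d, h3, fun x => ?_, fun x => ?_⟩
    · rw [swap_apply_def]
      split_ifs with hx hx <;> simp_all
    · rw [swap_apply_def]
      split_ifs with hx hx <;> simp_all

/-- The sum of the row group. -/
noncomputable def rowSum (Y : YoungDiagram) : MonoidAlgebra ℚ (Perm (Cell Y)) :=
  ∑ p : rowGroup Y, MonoidAlgebra.single p.1 (1 : ℚ)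

/-- The signed sum of the column group. -/
noncomputable def colSum (Y : YoungDiagram) : MonoidAlgebra ℚ (Perm (Cell Y)) :=
  ∑ q : colGroup Y, MonoidAlgebra.single q.1 ((Perm.sign q.1 : ℤ) : ℚ)

theorem youngSymmetrizer_eq : youngSymmetrizer Y = rowSum Y * colSum Y := by
  unfold youngSymmetrizer rowSum colSum
  congr 1
  · exact Finset.sum_subtype _ (fun p => by simp [mem_rowGroup]) _
  · exact Finset.sum_subtype _ (fun p => by simp [mem_colGroup]) _

theorem rowSum_mul_single {p : Perm (Cell Y)} (hp : p ∈ rowGroup Y) :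
    rowSum Y * MonoidAlgebra.single p 1 = rowSum Y := by
  rw [rowSum, Finset.sum_mul]
  simp only [MonoidAlgebra.single_mul_single, mul_one]
  exact Equiv.sum_comp (Equiv.mulRight (⟨p, hp⟩ : rowGroup Y))
    fun x => MonoidAlgebra.single x.1 (1 : ℚ)

theorem single_mul_colSum {q : Perm (Cell Y)} (hq : q ∈ colGroup Y) :
    MonoidAlgebra.single q 1 * colSum Y = ((Perm.sign q : ℤ) : ℚ) • colSum Y := by
  rw [colSum, Finset.mul_sum, Finset.smul_sum]
  conv_rhs => rw [← Equiv.sum_comp (Equiv.mulLeft (⟨q, hq⟩ : colGroup Y))]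
  refine Finset.sum_congr rfl fun x _ => ?_
  have : (((Perm.sign q : ℤ) : ℚ)) * ((Perm.sign q : ℤ) : ℚ) = 1 := by
    rw [← Int.cast_mul, ← Units.val_mul, Int.units_mul_self]
    simp
  simp [MonoidAlgebra.single_mul_single, ← mul_assoc, this]

/-- A group element `p q` is absorbed by the two sums up to the sign of `q`. In the other case of
`exists_mul_eq_or` a transposition is absorbed with sign `+` on the left and with sign `-` on the
right, so the product vanishes. -/
theorem rowSum_mul_mul_colSum (y : MonoidAlgebra ℚ (Perm (Cell Y))) :
    ∃ r : ℚ, rowSum Y * y * colSum Y = r • youngSymmetrizer Y := by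
  rw [youngSymmetrizer_eq]
  induction y using MonoidAlgebra.induction_linear with
  | zero => exact ⟨0, by simp⟩
  | add x y hx hy =>
    obtain ⟨r, hr⟩ := hx
    obtain ⟨t, ht⟩ := hy
    exact ⟨r + t, by rw [mul_add, add_mul, hr, ht, add_smul]⟩
  | single g r =>
    have hg : MonoidAlgebra.single g r = r • MonoidAlgebra.single g (1 : ℚ) := by simp
    rw [hg]
    rcases exists_mul_eq_or g with ⟨p, hp, q, hq, rfl⟩ | ⟨c, d, hcd, h1, h2⟩
    · refine ⟨r * ((Perm.sign q : ℤ) : ℚ), ?_⟩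
      have : MonoidAlgebra.single (p * q) (1 : ℚ) =
        MonoidAlgebra.single p 1 * MonoidAlgebra.single q 1 := by
        simp [MonoidAlgebra.single_mul_single]
      rw [mul_smul_comm, smul_mul_assoc, this, ← mul_assoc, rowSum_mul_single hp, mul_assoc,
        single_mul_colSum hq, mul_smul_comm, smul_smul]
    · refine ⟨0, ?_⟩
      have e : MonoidAlgebra.single (swap (g c) (g d)) (1 : ℚ) * MonoidAlgebra.single g 1 =
          MonoidAlgebra.single g 1 * MonoidAlgebra.single (swap c d) 1 := by
        simp only [MonoidAlgebra.single_mul_single, mul_one]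
        congr 1
        rw [Equiv.swap_apply_apply]
        group
      have h : rowSum Y * MonoidAlgebra.single g 1 * colSum Y =
          -(rowSum Y * MonoidAlgebra.single g 1 * colSum Y) := by
        conv_lhs => rw [← rowSum_mul_single h2, mul_assoc (rowSum Y), e, ← mul_assoc, mul_assoc,
          single_mul_colSum h1, Perm.sign_swap hcd]
        simp
      have h0 : rowSum Y * MonoidAlgebra.single g 1 * colSum Y = 0 := by
        have h2 : (2 : ℚ) • (rowSum Y * MonoidAlgebra.single g 1 * colSum Y) = 0 := by
          rw [two_smul]
          nth_rewrite 1 [h]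
          simp
        exact (smul_eq_zero.1 h2).resolve_left two_ne_zero
      rw [mul_smul_comm, smul_mul_assoc, h0]
      simp

/-- A sum over the coefficients of the Young symmetrizer. -/
theorem sum_coeff_youngSymmetrizer (θ : Perm (Cell Y) → ℚ) :
    ∑ g, (youngSymmetrizer Y).coeff g * θ g =
      ∑ p : rowGroup Y, ∑ q : colGroup Y, ((Perm.sign q.1 : ℤ) : ℚ) * θ (p.1 * q.1) := by
  classical
  rw [youngSymmetrizer_eq, rowSum, colSum, Finset.sum_mul_sum]
  simp only [MonoidAlgebra.single_mul_single, one_mul, MonoidAlgebra.coeff_sum,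
    Finsupp.finsetSum_apply, Finset.sum_mul, MonoidAlgebra.coeff_single]
  rw [Finset.sum_comm]
  refine Finset.sum_congr rfl fun p _ => ?_
  rw [Finset.sum_comm]
  refine Finset.sum_congr rfl fun q _ => ?_
  simp [Finsupp.single_apply]

theorem coeff_one_youngSymmetrizer : (youngSymmetrizer Y).coeff 1 = 1 := by
  classical
  have h := sum_coeff_youngSymmetrizer (Y := Y) fun g => if g = 1 then 1 else 0
  simp only [mul_ite, mul_one, mul_zero, Finset.sum_ite_eq', mem_univ, if_true] at h
  rw [h, Finset.sum_eq_single 1, Finset.sum_eq_single 1]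
  · simp
  · intro q _ hq
    simpa using hq
  · simp
  · intro p _ hp
    refine Finset.sum_eq_zero fun q _ => if_neg fun hpq => hp ?_
    apply Subtype.ext
    refine eq_one_of_mem_rowGroup_of_mem_colGroup p.2 ?_
    rw [mul_eq_one_iff_eq_inv.1 hpq]
    exact inv_mem q.2
  · simp

end Young

/-! ### Fillings and their permutation characters -/

section Fillings

variable {X : Type*} [Fintype X] [DecidableEq X] {N : ℕ}

/-- The fillings of `X` with the numbers `i : Fin N`, each occurring `ν i` times. -/
def fillings (X : Type*) [Fintype X] [DecidableEq X] (ν : Fin N → ℤ) : Finset (X → Fin N) :=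
  {f | ∀ i, (#{c | f c = i} : ℤ) = ν i}

theorem mem_fillings {ν : Fin N → ℤ} {f : X → Fin N} :
    f ∈ fillings X ν ↔ ∀ i, (#{c | f c = i} : ℤ) = ν i := by
  simp [fillings]

theorem comp_mem_fillings {ν : Fin N → ℤ} {f : X → Fin N} (p : Perm X) :
    f ∘ p ∈ fillings X ν ↔ f ∈ fillings X ν := by
  simp only [mem_fillings]
  refine forall_congr' fun i => ?_
  rw [show #{c | (f ∘ p) c = i} = #{c | f c = i} from Finset.card_equiv p fun c => by simp]

/-- The character of the permutation representation on fillings. -/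
def fillingChar (ν : Fin N → ℤ) (g : Perm X) : ℕ := #{f ∈ fillings X ν | f ∘ g = f}

theorem sum_lt_of_mem_fillings {ν : Fin N → ℤ} {f : X → Fin N} (hf : f ∈ fillings X ν) (k : ℕ) :
    (#{c | (f c : ℕ) < k} : ℤ) = ∑ i ∈ univ.filter (fun i : Fin N => i.val < k), ν i := by
  rw [mem_fillings] at hf
  simp only [← hf]
  rw [← Nat.cast_sum, Finset.card_eq_sum_card_fiberwise (f := f)
    (t := {i : Fin N | (i : ℕ) < k}) (fun c hc => by simpa using hc)]
  congr 1
  refine Finset.sum_congr rfl fun i hi => ?_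
  rw [Finset.filter_filter]
  congr 1
  ext c
  simp only [mem_filter, mem_univ, true_and] at hi ⊢
  constructor
  · exact fun h => h.2
  · exact fun h => ⟨h ▸ hi, h⟩

end Fillings

/-! ### Pairing the Young symmetrizer with permutation characters -/

section Young

variable {Y : YoungDiagram} {N : ℕ}

/-- Two cells of one column carry the same value. Their transposition fixes `h` and reverses the
sign, so the sum equals its own negative. -/
theorem sum_sign_eq_zero {α : Type*} [DecidableEq α] {h : Cell Y → α} (hh : ¬ ColumnInjective h)
    (k : Cell Y → α) :
    ∑ q : colGroup Y, ((Perm.sign q.1 : ℤ) : ℚ) * (if h ∘ q.1 = k then 1 else 0) = 0 := by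
  unfold ColumnInjective at hh
  push Not at hh
  obtain ⟨c, d, h1, h2, h3⟩ := hh
  have ht : swap c d ∈ colGroup Y := fun x => by
    rw [swap_apply_def]
    split_ifs with hx hx <;> simp_all
  have hs : h ∘ swap c d = h := by
    ext x
    rw [Function.comp_apply, swap_apply_def]
    split_ifs with hx hx <;> simp_all
  have key : ∀ S : ℚ, S = -S → S = 0 := fun S hS => by linarith
  apply key
  conv_lhs => rw [← Equiv.sum_comp (Equiv.mulLeft (⟨swap c d, ht⟩ : colGroup Y))]
  rw [← Finset.sum_neg_distrib]
  refine Finset.sum_congr rfl fun q _ => ?_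
  have e : h ∘ (swap c d * q.1 : Perm (Cell Y)) = h ∘ q.1 := by
    rw [Perm.coe_mul, ← Function.comp_assoc, hs]
  simp only [Equiv.coe_mulLeft, Subgroup.coe_mul, e, Perm.sign_mul, Perm.sign_swap h3]
  rw [← neg_mul]
  simp

open Classical in
-- The fillings `f` fixed by `p q` are reindexed as `h = f ∘ p`, which turns the condition into `h ∘
-- q = h ∘ p⁻¹`. For fixed `h` and `p` the signed sum over `q` then cancels unless `h` is
-- column-injective.
theorem sum_youngSymmetrizer_fillingChar (ν : Fin N → ℤ) :
    ∑ p : rowGroup Y, ∑ q : colGroup Y,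
        ((Perm.sign q.1 : ℤ) : ℚ) * (fillingChar ν (p.1 * q.1) : ℚ) =
      ∑ h ∈ fillings (Cell Y) ν with ColumnInjective h, ∑ p : rowGroup Y, ∑ q : colGroup Y,
        ((Perm.sign q.1 : ℤ) : ℚ) * (if h ∘ q.1 = h ∘ ⇑(p.1⁻¹) then 1 else 0) := by
  have h1 : ∀ (p : rowGroup Y) (q : colGroup Y), (fillingChar ν (p.1 * q.1) : ℚ) =
      ∑ h ∈ fillings (Cell Y) ν, if h ∘ q.1 = h ∘ ⇑(p.1⁻¹) then 1 else 0 := by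
    intro p q
    rw [fillingChar, Finset.sum_boole]
    congr 1
    refine Finset.card_bij (fun f _ => f ∘ p.1) ?_ ?_ ?_
    · intro f hf
      rw [mem_filter] at hf ⊢
      refine ⟨(comp_mem_fillings _).2 hf.1, ?_⟩
      rw [Function.comp_assoc, ← Perm.coe_mul, hf.2, Function.comp_assoc, ← Perm.coe_mul]
      simp
    · intro f _ f' _ h
      exact p.1.surjective.injective_comp_right h
    · intro f hf
      rw [mem_filter] at hf
      refine ⟨f ∘ ⇑(p.1⁻¹), ?_, ?_⟩
      · rw [mem_filter]
        refine ⟨(comp_mem_fillings _).2 hf.1, ?_⟩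
        rw [Function.comp_assoc, ← Perm.coe_mul, inv_mul_cancel_left, hf.2]
      · rw [Function.comp_assoc, ← Perm.coe_mul]
        simp
  simp only [h1]
  rw [Finset.sum_filter_of_ne]
  · rw [Finset.sum_comm (s := fillings (Cell Y) ν)]
    refine Finset.sum_congr rfl fun p _ => ?_
    rw [Finset.sum_comm (s := fillings (Cell Y) ν)]
    simp only [Finset.mul_sum]
  · intro h _ hne
    by_contra hh
    exact hne (Finset.sum_eq_zero fun p _ => sum_sign_eq_zero hh _)

theorem columnInjective_val {h : Cell Y → Fin N} (hh : ColumnInjective h) :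
    ColumnInjective fun c => (h c : ℕ) :=
  fun c d h1 h2 => hh c d h1 (Fin.ext h2)

/-- The pairing of the Young symmetrizer with the permutation character of content `ν` vanishes
unless `ν` is dominated by the row lengths. -/
theorem sum_youngSymmetrizer_fillingChar_eq_zero (ν : Fin N → ℤ) (k : ℕ)
    (hk : (#{c : Cell Y | c.1.1 < k} : ℤ) < ∑ i ∈ univ.filter (fun i : Fin N => i.val < k), ν i) :
    ∑ p : rowGroup Y, ∑ q : colGroup Y,
        ((Perm.sign q.1 : ℤ) : ℚ) * (fillingChar ν (p.1 * q.1) : ℚ) = 0 := by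
  classical
  rw [sum_youngSymmetrizer_fillingChar, Finset.filter_eq_empty_iff.2, Finset.sum_empty]
  intro h hh hc
  have h1 := card_lt_le (columnInjective_val hc) k
  rw [← sum_lt_of_mem_fillings hh k] at hk
  exact absurd h1 (by exact_mod_cast not_le.2 hk)

open Classical in
-- The scalar is the coefficient of the square at the identity, because the symmetrizer itself has
-- coefficient `1` there. The condition `p q p' q' = 1` says that `q' p q` is the inverse of the row
-- permutation `p'`.
theorem youngSymmetrizer_scalar {n : ℚ}
    (hn : youngSymmetrizer Y * youngSymmetrizer Y = n • youngSymmetrizer Y) :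
    n = ∑ p : rowGroup Y, ∑ q : colGroup Y, ∑ q' : colGroup Y,
      ((Perm.sign q.1 : ℤ) : ℚ) * ((Perm.sign q'.1 : ℤ) : ℚ) *
        (if q'.1 * p.1 * q.1 ∈ rowGroup Y then 1 else 0) := by
  have h1 := congrArg (fun x => x.coeff 1) hn
  simp only [MonoidAlgebra.coeff_smul_apply, coeff_one_youngSymmetrizer, smul_eq_mul, mul_one] at h1
  rw [← h1, MonoidAlgebra.coeff_mul_apply_left, Finsupp.sum_fintype _ _ (by simp),
    sum_coeff_youngSymmetrizer]
  refine Finset.sum_congr rfl fun p _ => Finset.sum_congr rfl fun q _ => ?_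
  have h2 := sum_coeff_youngSymmetrizer (Y := Y) fun g =>
    if g = ((p.1 * q.1)⁻¹ * 1) then 1 else 0
  simp only [mul_ite, mul_one, mul_zero, Finset.sum_ite_eq', mem_univ, if_true] at h2
  rw [mul_one, h2, Finset.sum_comm, Finset.mul_sum]
  refine Finset.sum_congr rfl fun q' _ => ?_
  rw [mul_assoc]
  congr 1
  split_ifs with hm
  · rw [Finset.sum_eq_single ⟨_, inv_mem hm⟩]
    · simp [mul_assoc]
    · intro p' _ hp'
      refine if_neg fun h => hp' (Subtype.ext ?_)
      rw [eq_mul_inv_of_mul_eq h]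
      simp [mul_assoc]
    · simp
  · rw [mul_zero]
    refine Finset.sum_eq_zero fun p' _ => if_neg fun h => hm ?_
    have : q'.1 * p.1 * q.1 = p'.1⁻¹ := by
      apply eq_inv_of_mul_eq_one_right
      rw [eq_inv_iff_mul_eq_one] at h
      simpa [mul_assoc] using h
    rw [this]
    exact inv_mem p'.2

/-- The pairing of the Young symmetrizer with the permutation character whose content is given by
the row lengths. -/
theorem sum_youngSymmetrizer_fillingChar_self (hN : Y.colLen 0 ≤ N) {n : ℚ}
    (hn : youngSymmetrizer Y * youngSymmetrizer Y = n • youngSymmetrizer Y) :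
    ∑ p : rowGroup Y, ∑ q : colGroup Y, ((Perm.sign q.1 : ℤ) : ℚ) *
        (fillingChar (fun i : Fin N => (Y.rowLen i : ℤ)) (p.1 * q.1) : ℚ) = n := by
  classical
  have hlt : ∀ c : Cell Y, c.1.1 < N := fun c => by
    have : (c.1.1, c.1.2) ∈ Y := c.2
    exact ((YoungDiagram.mem_iff_lt_colLen.1 this).trans_le
      (Y.colLen_anti 0 _ (Nat.zero_le _))).trans_le hN
  let row : Cell Y → Fin N := fun c => ⟨c.1.1, hlt c⟩
  have hrow : row ∈ fillings (Cell Y) (fun i : Fin N => (Y.rowLen i : ℤ)) := by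
    rw [mem_fillings]
    intro i
    rw [← card_row_eq]
    simp [row, Fin.ext_iff]
  rw [sum_youngSymmetrizer_fillingChar, youngSymmetrizer_scalar hn]
  -- By `exists_column_perm` the remaining fillings are exactly the `row ∘ q'` with `q'` in the
  -- column group.
  have h1 : ∑ h ∈ fillings (Cell Y) (fun i : Fin N => (Y.rowLen i : ℤ)) with ColumnInjective h,
      ∑ p : rowGroup Y, ∑ q : colGroup Y,
        ((Perm.sign q.1 : ℤ) : ℚ) * (if h ∘ q.1 = h ∘ ⇑(p.1⁻¹) then 1 else 0) =
      ∑ q' : colGroup Y, ∑ p : rowGroup Y, ∑ q : colGroup Y,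
        ((Perm.sign q.1 : ℤ) : ℚ) *
          (if q'.1 * q.1 * p.1 * q'.1⁻¹ ∈ rowGroup Y then 1 else 0) := by
    symm
    refine Finset.sum_bij (fun q' _ => row ∘ q'.1) ?_ ?_ ?_ ?_
    · intro q' _
      rw [mem_filter]
      refine ⟨(comp_mem_fillings _).2 hrow, fun c d hcd h => ?_⟩
      apply q'.1.injective
      refine Subtype.ext (Prod.ext (Fin.ext_iff.1 h) ?_)
      rw [q'.2 c, q'.2 d, hcd]
    · intro q1 _ q2 _ h
      apply Subtype.ext
      refine Equiv.ext fun c => Subtype.ext (Prod.ext (Fin.ext_iff.1 (congrFun h c)) ?_)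
      rw [q1.2 c, q2.2 c]
    · intro h hh
      rw [mem_filter] at hh
      obtain ⟨q, hq, hqf⟩ := exists_column_perm (columnInjective_val hh.2) fun k => by
        have h1 := sum_lt_of_mem_fillings hh.1 k
        have h2 := sum_lt_of_mem_fillings hrow k
        exact_mod_cast h1.trans h2.symm
      exact ⟨⟨q, hq⟩, mem_univ _, funext fun c => Fin.ext (hqf c)⟩
    · intro q' _
      refine Finset.sum_congr rfl fun p _ => Finset.sum_congr rfl fun q _ => ?_
      congr 1
      refine if_congr ?_ rfl rfl
      rw [mem_rowGroup, funext_iff]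
      constructor
      · intro h c
        have := h (q'.1 (p.1⁻¹ c))
        apply Fin.ext
        simpa [Perm.mul_apply] using this
      · intro h x
        have := Fin.ext_iff.1 (h (p.1 (q'.1⁻¹ x)))
        simpa [row, Perm.mul_apply] using this
  rw [h1, Finset.sum_comm]
  refine Finset.sum_congr rfl fun p _ => ?_
  -- The substitutions `q' = a⁻¹` and `q = a b` turn `q' q p q'⁻¹` into `b p a`.
  rw [← Equiv.sum_comp (Equiv.inv (colGroup Y))]
  refine Finset.sum_congr rfl fun a _ => ?_
  rw [← Equiv.sum_comp (Equiv.mulLeft a)]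
  refine Finset.sum_congr rfl fun b _ => ?_
  simp [mul_assoc]

end Young

/-! ### The Frobenius class functions -/

section Fillings

variable {X : Type*} [Fintype X] [DecidableEq X] {N : ℕ}

theorem fillingChar_conj (ν : Fin N → ℤ) (g h : Perm X) :
    fillingChar ν (h * g * h⁻¹) = fillingChar ν g := by
  unfold fillingChar
  refine Finset.card_bij (fun f _ => f ∘ h) ?_ ?_ ?_
  · intro f hf
    rw [mem_filter] at hf ⊢
    refine ⟨(comp_mem_fillings _).2 hf.1, ?_⟩
    conv_rhs => rw [← hf.2]
    ext x
    simp
  · intro f _ f' _ h'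
    exact h.surjective.injective_comp_right h'
  · intro f hf
    rw [mem_filter] at hf
    refine ⟨f ∘ ⇑h⁻¹, ?_, ?_⟩
    · rw [mem_filter]
      refine ⟨(comp_mem_fillings _).2 hf.1, ?_⟩
      conv_rhs => rw [← hf.2]
      ext x
      simp
    · ext x
      simp

/-- The position of the `i`-th particle of the vacuum. -/
def vac (i : Fin N) : ℤ := -(i : ℤ) - 1

theorem vac_injective : Function.Injective (vac : Fin N → ℤ) := fun i j h => by
  unfold vac at h
  exact Fin.ext (by omega)

/-- The alternating sum of permutation characters that the Frobenius formula attaches to `κ`. -/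
def frobChar (κ : Fin N → ℤ) (g : Perm X) : ℤ :=
  ∑ σ : Perm (Fin N), (Perm.sign σ : ℤ) * (fillingChar (fun i => κ i - vac (σ i)) g : ℤ)

theorem frobChar_conj (κ : Fin N → ℤ) (g h : Perm X) :
    frobChar κ (h * g * h⁻¹) = frobChar κ g := by
  simp only [frobChar, fillingChar_conj]

omit [Fintype X] [DecidableEq X] in
theorem classFunction_inv [Finite X] {β : Type*} {θ : Perm X → β}
    (hθ : ∀ g h, θ (h * g * h⁻¹) = θ g) (g : Perm X) : θ g⁻¹ = θ g := by
  classical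
  have := Fintype.ofFinite X
  have h : IsConj g g⁻¹ := Perm.isConj_iff_cycleType_eq.2 (Perm.cycleType_inv g).symm
  obtain ⟨c, hc⟩ := isConj_iff.1 h
  rw [← hc, hθ]

end Fillings

/-! ### Irreducible characters against Frobenius class functions -/

section Young

variable (Y : YoungDiagram) (N : ℕ)

/-- The positions `Y_i - i` of the particles of a Young diagram. -/
def particles (i : Fin N) : ℤ := (Y.rowLen i : ℤ) + vac i

variable {Y N}

theorem card_lt_eq_sum (hN : Y.colLen 0 ≤ N) (k : ℕ) : (#{c : Cell Y | c.1.1 < k} : ℤ) =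
    ∑ i ∈ univ.filter (fun i : Fin N => i.val < k), (Y.rowLen i : ℤ) := by
  have hlt : ∀ c : Cell Y, c.1.1 < N := fun c => by
    have : (c.1.1, c.1.2) ∈ Y := c.2
    exact ((YoungDiagram.mem_iff_lt_colLen.1 this).trans_le
      (Y.colLen_anti 0 _ (Nat.zero_le _))).trans_le hN
  refine sum_lt_of_mem_fillings (f := fun c : Cell Y => (⟨c.1.1, hlt c⟩ : Fin N))
    (mem_fillings.2 fun i => ?_) k
  rw [← card_row_eq]
  simp [Fin.ext_iff]

/-- The content that belongs to `σ` is `Y_i + σ i - i`. If `σ ≠ 1` and `k₀` is the first index that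
it moves, then `σ k₀ > k₀`, so the sum of the first `k₀ + 1` entries exceeds that of the row lengths
and the term vanishes by dominance. Only `σ = 1` remains, whose content is given by the row lengths.
-/
theorem sum_youngSymmetrizer_frobChar (hN : Y.colLen 0 ≤ N) {n : ℚ}
    (hn : youngSymmetrizer Y * youngSymmetrizer Y = n • youngSymmetrizer Y) :
    ∑ g, (youngSymmetrizer Y).coeff g * (frobChar (particles Y N) g : ℚ) = n := by
  rw [sum_coeff_youngSymmetrizer]
  simp only [frobChar, Int.cast_sum, Finset.mul_sum]
  have h0 : ∀ p : rowGroup Y, ∑ q : colGroup Y, ∑ σ : Perm (Fin N),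
      ((Perm.sign q.1 : ℤ) : ℚ) *
        (((Perm.sign σ : ℤ) * (fillingChar (fun i => particles Y N i - vac (σ i))
          (p.1 * q.1) : ℤ) : ℤ) : ℚ) =
      ∑ σ : Perm (Fin N), ((Perm.sign σ : ℤ) : ℚ) * ∑ q : colGroup Y,
      ((Perm.sign q.1 : ℤ) : ℚ) *
        (fillingChar (fun i => particles Y N i - vac (σ i)) (p.1 * q.1) : ℚ) := by
    intro p
    rw [Finset.sum_comm]
    refine Finset.sum_congr rfl fun σ _ => ?_
    rw [Finset.mul_sum]
    refine Finset.sum_congr rfl fun q _ => ?_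
    push_cast
    ring
  simp only [h0]
  rw [Finset.sum_comm]
  simp only [← Finset.mul_sum]
  rw [Finset.sum_eq_single 1]
  · have h1 := sum_youngSymmetrizer_fillingChar_self hN hn
    simpa [particles] using h1
  · intro σ _ hσ
    rw [mul_eq_zero]
    right
    obtain ⟨k₀, hk, hmin⟩ : ∃ k₀ : Fin N, σ k₀ ≠ k₀ ∧ ∀ i < k₀, σ i = i := by
      have hex : ∃ k : Fin N, σ k ≠ k := by
        by_contra hcon
        push Not at hcon
        exact hσ (Equiv.ext hcon)
      obtain ⟨k, hk⟩ := hex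
      have hne : (univ.filter fun i : Fin N => σ i ≠ i).Nonempty := ⟨k, by simpa using hk⟩
      refine ⟨_, (mem_filter.1 (Finset.min'_mem _ hne)).2, fun i hi => ?_⟩
      by_contra hcon
      exact absurd (Finset.min'_le _ i (by simpa using hcon)) (not_le.2 hi)
    have hgt : k₀ < σ k₀ := by
      refine lt_of_le_of_ne ?_ (Ne.symm hk)
      by_contra hcon
      have := hmin _ (not_le.1 hcon)
      exact hk (σ.injective this)
    refine sum_youngSymmetrizer_fillingChar_eq_zero _ (k₀ + 1) ?_
    rw [card_lt_eq_sum hN]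
    refine Finset.sum_lt_sum (fun i hi => ?_) ⟨k₀, by simp, ?_⟩
    · rw [mem_filter] at hi
      have : (i : ℕ) ≤ (σ i : ℕ) := by
        rcases Nat.lt_succ_iff_lt_or_eq.1 hi.2 with h | h
        · rw [hmin i h]
        · rw [Fin.ext h]
          exact hgt.le
      simp only [particles, vac]
      omega
    · have : (k₀ : ℕ) < (σ k₀ : ℕ) := hgt
      simp only [particles, vac]
      omega
  · simp

/-- **Frobenius' character formula**, provided that the Frobenius class function has norm one. -/
theorem idealTrace_eq_frobChar (hN : Y.colLen 0 ≤ N)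
    (hω : ∑ g : Perm (Cell Y), frobChar (particles Y N) g ^ 2 = Fintype.card (Perm (Cell Y)))
    (g : Perm (Cell Y)) :
    idealTrace (youngSymmetrizer Y) (MonoidAlgebra.single g 1) = frobChar (particles Y N) g := by
  set c := youngSymmetrizer Y with hc
  have hmul : ∀ y, ∃ r : ℚ, c * y * c = r • c := by
    intro y
    obtain ⟨r, hr⟩ := rowSum_mul_mul_colSum (Y := Y) (colSum Y * y * rowSum Y)
    refine ⟨r, ?_⟩
    rw [hc, ← hr, youngSymmetrizer_eq]
    simp only [mul_assoc]
  obtain ⟨n, hn⟩ := hmul 1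
  rw [mul_one] at hn
  have hn0 : n ≠ 0 := sq_scalar_ne_zero hn coeff_one_youngSymmetrizer
  have hc0 : c ≠ 0 := by
    intro h0
    have := coeff_one_youngSymmetrizer (Y := Y)
    rw [← hc, h0] at this
    simp at this
  set χ : Perm (Cell Y) → ℚ := fun g => idealTrace c (MonoidAlgebra.single g 1) with hχ
  set ω : Perm (Cell Y) → ℚ := fun g => (frobChar (particles Y N) g : ℚ) with hω'
  have hχc : ∀ g h, χ (h * g * h⁻¹) = χ g := fun g h => idealTrace_conj c g h
  have hωc : ∀ g h, ω (h * g * h⁻¹) = ω g := fun g h => by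
    simp only [hω', frobChar_conj]
  have h1 : ∑ g, χ g * χ g = Fintype.card (Perm (Cell Y)) := by
    have := sum_idealTrace_mul hn χ hχc
    simp only [classFunction_inv hχc] at this
    rw [← idealTrace_linear, idealTrace_self hc0 hn0 hn hmul, mul_comm] at this
    exact mul_right_cancel₀ hn0 this
  have h2 : ∑ g, χ g * ω g = Fintype.card (Perm (Cell Y)) := by
    have := sum_idealTrace_mul hn ω hωc
    simp only [classFunction_inv hωc] at this
    rw [sum_youngSymmetrizer_frobChar hN hn, mul_comm] at this
    exact mul_right_cancel₀ hn0 this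
  have h3 : ∑ g, ω g * ω g = Fintype.card (Perm (Cell Y)) := by
    simp only [hω', ← pow_two]
    exact_mod_cast hω
  -- Both norms and the pairing equal the group order, so the difference has norm zero, and rational
  -- squares with sum zero all vanish.
  have h4 : ∑ g, (χ g - ω g) ^ 2 = 0 := by
    calc _ = ∑ g, χ g * χ g - 2 * ∑ g, χ g * ω g + ∑ g, ω g * ω g := by
          rw [Finset.mul_sum, ← Finset.sum_sub_distrib, ← Finset.sum_add_distrib]
          exact Finset.sum_congr rfl fun g _ => by ring
      _ = 0 := by rw [h1, h2, h3]; ring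
  rw [Finset.sum_eq_zero_iff_of_nonneg fun g _ => sq_nonneg _] at h4
  have := h4 g (mem_univ g)
  exact sub_eq_zero.1 (pow_eq_zero_iff two_ne_zero |>.1 this)

end Young

/-! ### Frobenius class functions in terms of cycle types -/

section Parts

variable {N : ℕ} {ι κ : Type*} [Fintype ι] [Fintype κ]

/-- The number of ways to distribute the parts `a j` among the numbers `i : Fin N` with total
`ν i` for each `i`. -/
noncomputable def partCount (a : ι → ℕ) (ν : Fin N → ℤ) : ℕ :=
  Nat.card {f : ι → Fin N // ∀ i, ∑ j with f j = i, (a j : ℤ) = ν i}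

theorem exists_equiv_of_map_eq {a : ι → ℕ} {b : κ → ℕ}
    (h : univ.val.map a = univ.val.map b) : ∃ e : ι ≃ κ, ∀ j, b (e j) = a j := by
  classical
  have hc : ∀ v, Fintype.card {j // a j = v} = Fintype.card {j // b j = v} := by
    intro v
    have := congrArg (Multiset.count v) h
    rw [Multiset.count_map, Multiset.count_map] at this
    rw [Fintype.card_subtype, Fintype.card_subtype]
    simpa [Finset.card, Finset.filter, eq_comm] using this
  exact ⟨Equiv.ofFiberEquiv fun v => Fintype.equivOfCardEq (hc v),
    fun j => Equiv.ofFiberEquiv_map _ _⟩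

theorem partCount_congr {a : ι → ℕ} {b : κ → ℕ} (h : univ.val.map a = univ.val.map b)
    (ν : Fin N → ℤ) : partCount a ν = partCount b ν := by
  obtain ⟨e, he⟩ := exists_equiv_of_map_eq h
  refine Nat.card_congr ((Equiv.arrowCongr e (Equiv.refl (Fin N))).subtypeEquiv fun f => ?_)
  refine forall_congr' fun i => ?_
  rw [Finset.sum_filter, Finset.sum_filter, ← Equiv.sum_comp e]
  simp [he]

/-- The coefficient of the state `κ` in the state that the parts `a` create from the vacuum. -/
noncomputable def frob (a : ι → ℕ) (κ : Fin N → ℤ) : ℤ :=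
  ∑ σ : Perm (Fin N), (Perm.sign σ : ℤ) * (partCount a (fun i => κ i - vac (σ i)) : ℤ)

theorem frob_congr {a : ι → ℕ} {b : κ → ℕ} (h : univ.val.map a = univ.val.map b)
    (k : Fin N → ℤ) : frob a k = frob b k := by
  simp only [frob, partCount_congr h]

variable {X : Type*} [Fintype X] [DecidableEq X]

/-- A filling is fixed by `g` exactly if it is constant on cycles, that is, if it factors through
`π`. Each cycle then contributes its length to the content. -/
theorem fillingChar_eq_partCount (ν : Fin N → ℤ) (g : Perm X) [DecidableEq ι] (π : X → ι)
    (hπ : Function.Surjective π) (h1 : ∀ x, π (g x) = π x)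
    (h2 : ∀ x y, π x = π y → g.SameCycle x y) :
    fillingChar ν g = partCount (fun j => #{x | π x = j}) ν := by
  rw [partCount, Nat.card_eq_fintype_card, Fintype.card_subtype]
  symm
  refine Finset.card_bij (fun F _ => F ∘ π) ?_ ?_ ?_
  · intro F hF
    simp only [mem_filter, mem_univ, true_and] at hF
    rw [mem_filter, mem_fillings]
    refine ⟨fun i => ?_, funext fun x => congrArg F (h1 x)⟩
    rw [← hF i, ← Nat.cast_sum, Finset.card_eq_sum_card_fiberwise (f := π)
      (t := {j | F j = i}) (fun x hx => by simpa using hx)]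
    congr 1
    refine Finset.sum_congr rfl fun j hj => ?_
    rw [Finset.filter_filter]
    congr 1
    ext x
    simp only [mem_filter, mem_univ, true_and, Function.comp_apply] at hj ⊢
    exact ⟨fun h => h.2, fun h => ⟨h ▸ hj, h⟩⟩
  · exact fun F _ F' _ h => hπ.injective_comp_right h
  · intro f hf
    rw [mem_filter, mem_fillings] at hf
    have hinv : ∀ x y, π x = π y → f x = f y := by
      intro x y hxy
      obtain ⟨k, hk⟩ := h2 x y hxy
      rw [← hk]
      have hg : ∀ x, f (g x) = f x := fun x => congrFun hf.2 x
      have hn : ∀ (n : ℕ) x, f ((g ^ n) x) = f x := by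
        intro n
        induction n with
        | zero => simp
        | succ n ih => intro x; rw [pow_succ', Perm.mul_apply, hg, ih]
      cases k with
      | ofNat n => exact (hn n x).symm
      | negSucc n =>
        rw [← hn (n + 1) ((g ^ Int.negSucc n) x), ← Perm.mul_apply]
        simp
    have hF : (f ∘ Function.surjInv hπ) ∘ π = f := by
      ext x
      rw [Function.comp_apply, Function.comp_apply, hinv _ x (Function.surjInv_eq hπ _)]
    refine ⟨f ∘ Function.surjInv hπ, ?_, hF⟩
    simp only [mem_filter, mem_univ, true_and]
    intro i
    rw [← hf.1 i, ← Nat.cast_sum, Finset.card_eq_sum_card_fiberwise (f := π) (s := {c | f c = i})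
      (t := {j | (f ∘ Function.surjInv hπ) j = i})
      (fun x hx => by
        have : f x = i := by simpa using hx
        have h3 := congrFun hF x
        simp only [Function.comp_apply] at h3
        simp [h3, this])]
    congr 1
    refine Finset.sum_congr rfl fun j hj => ?_
    rw [Finset.filter_filter]
    congr 1
    ext x
    simp only [mem_filter, mem_univ, true_and, Function.comp_apply] at hj ⊢
    refine ⟨fun h => ⟨?_, h⟩, fun h => h.2⟩
    rw [← hj, ← h]
    exact (congrFun hF x).symm

/-- The cycles of a permutation: the nontrivial ones and the fixed points. -/
abbrev CycleIndex (g : Perm X) : Type _ := g.cycleFactorsFinset ⊕ {x // x ∉ g.support}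

/-- The lengths of the cycles. -/
def cycleLength (g : Perm X) : CycleIndex g → ℕ := Sum.elim (fun c => #c.1.support) fun _ => 1

theorem map_cycleLength (g : Perm X) :
    univ.val.map (cycleLength g) = g.partition.parts := by
  rw [Perm.parts_partition, Perm.cycleType_def]
  have : (univ : Finset (CycleIndex g)) = univ.disjSum univ := univ_disjSum_univ.symm
  rw [this, Finset.val_disjSum, Multiset.disjSum, Multiset.map_add, Multiset.map_map,
    Multiset.map_map]
  congr 1
  · rw [Finset.univ_eq_attach, Finset.attach_val]
    exact Multiset.attach_map_val' g.cycleFactorsFinset.val (fun c => #c.support)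
  · rw [← Fintype.card_coe, ← Fintype.card_subtype_compl]
    exact Multiset.map_const' _ _

/-- The cycle that contains a point. -/
def cycleIndexOf (g : Perm X) (x : X) : CycleIndex g :=
  if hx : x ∈ g.support then Sum.inl ⟨g.cycleOf x, Perm.cycleOf_mem_cycleFactorsFinset_iff.2 hx⟩
  else Sum.inr ⟨x, hx⟩

theorem fillingChar_eq (ν : Fin N → ℤ) (g : Perm X) :
    fillingChar ν g = partCount (cycleLength g) ν := by
  classical
  rw [fillingChar_eq_partCount ν g (cycleIndexOf g)]
  · congr 1
    funext j
    rcases j with ⟨c, hc⟩ | ⟨y, hy⟩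
    · change _ = #c.support
      congr 1
      ext x
      rw [mem_filter, and_iff_right (mem_univ x), cycleIndexOf]
      split_ifs with hx
      · rw [Sum.inl.injEq, Subtype.mk.injEq, eq_comm,
          Perm.eq_cycleOf_of_mem_cycleFactorsFinset_iff g c hc]
      · simp only [false_iff]
        exact fun h => hx (Perm.mem_cycleFactorsFinset_support_le hc h)
    · change _ = 1
      rw [Finset.card_eq_one]
      refine ⟨y, ?_⟩
      ext x
      rw [mem_filter, and_iff_right (mem_univ x), cycleIndexOf, mem_singleton]
      split_ifs with hx
      · simp only [false_iff]
        rintro rfl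
        exact hy hx
      · rw [Sum.inr.injEq, Subtype.mk.injEq]
  · rintro (⟨c, hc⟩ | ⟨y, hy⟩)
    · obtain ⟨x, hx⟩ := (Perm.mem_cycleFactorsFinset_iff.1 hc).1.nonempty_support
      refine ⟨x, ?_⟩
      rw [cycleIndexOf, dif_pos (Perm.mem_cycleFactorsFinset_support_le hc hx), Sum.inl.injEq,
        Subtype.mk.injEq]
      exact (Perm.cycle_is_cycleOf hx hc).symm
    · exact ⟨y, by rw [cycleIndexOf, dif_neg hy]⟩
  · intro x
    by_cases hx : x ∈ g.support
    · have h : g.cycleOf (g x) = g.cycleOf x :=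
        ((Perm.SameCycle.refl g x).apply_right).symm.cycleOf_eq
      simp only [cycleIndexOf, hx, Perm.apply_mem_support, dif_pos, h]
    · rw [Perm.notMem_support.1 hx]
  · intro x y h
    unfold cycleIndexOf at h
    split_ifs at h with hx hy hy
    · rw [Sum.inl.injEq, Subtype.mk.injEq] at h
      exact (Perm.sameCycle_iff_cycleOf_eq_of_mem_support hx hy).2 h
    · rw [Sum.inr.injEq, Subtype.mk.injEq] at h
      rw [h]

theorem frobChar_eq_frob (k : Fin N → ℤ) (g : Perm X) {a : ι → ℕ}
    (h : univ.val.map a = g.partition.parts) : frobChar k g = frob a k := by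
  simp only [frobChar, frob, fillingChar_eq,
    partCount_congr ((map_cycleLength g).trans h.symm)]

end Parts

/-! ### Fermionic states with `N` particles -/

section States

variable {𝔽 : Type*} [Field 𝔽] {N : ℕ}

/-- Alternating functions of the positions of `N` particles that vanish if a particle is below `-N`
and that are homogeneous of energy `E`. -/
structure IsState (E : ℤ) (Φ : (Fin N → ℤ) → 𝔽) : Prop where
  alt : ∀ κ (σ : Perm (Fin N)), Φ (κ ∘ σ) = ((Perm.sign σ : ℤ) : 𝔽) * Φ κ
  supp : ∀ κ i, κ i < -(N : ℤ) → Φ κ = 0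
  deg : ∀ κ, ∑ i, κ i ≠ ∑ i, vac (N := N) i + E → Φ κ = 0

theorem IsState.add {E : ℤ} {Φ Ψ : (Fin N → ℤ) → 𝔽} (h1 : IsState E Φ) (h2 : IsState E Ψ) :
    IsState E (Φ + Ψ) where
  alt κ σ := by simp only [Pi.add_apply, h1.alt κ σ, h2.alt κ σ, mul_add]
  supp κ i h := by simp only [Pi.add_apply, h1.supp κ i h, h2.supp κ i h, add_zero]
  deg κ h := by simp only [Pi.add_apply, h1.deg κ h, h2.deg κ h, add_zero]

theorem IsState.smul {E : ℤ} {Φ : (Fin N → ℤ) → 𝔽} (c : 𝔽) (h1 : IsState E Φ) :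
    IsState E (c • Φ) where
  alt κ σ := by simp only [Pi.smul_apply, h1.alt κ σ, smul_eq_mul, mul_left_comm]
  supp κ i h := by simp only [Pi.smul_apply, h1.supp κ i h, smul_zero]
  deg κ h := by simp only [Pi.smul_apply, h1.deg κ h, smul_zero]

theorem IsState.eq_zero_of_not_injective [CharZero 𝔽] {E : ℤ} {Φ : (Fin N → ℤ) → 𝔽}
    (h : IsState E Φ) {κ : Fin N → ℤ} (hκ : ¬ Function.Injective κ) : Φ κ = 0 := by
  rw [Function.Injective] at hκ
  push Not at hκ
  obtain ⟨i, j, hij, hne⟩ := hκ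
  have h1 := h.alt κ (swap i j)
  have h2 : κ ∘ swap i j = κ := by
    ext x
    rw [Function.comp_apply, swap_apply_def]
    split_ifs with hx hx <;> simp_all
  rw [h2, Perm.sign_swap hne] at h1
  simp only [Units.val_neg, Units.val_one, Int.cast_neg, Int.cast_one, neg_mul, one_mul] at h1
  exact self_eq_neg.1 h1

theorem sum_vac : ∑ i, vac (N := N) i = ∑ x ∈ Ico (-(N : ℤ)) 0, x := by
  refine Finset.sum_bij (fun i _ => vac i) ?_ ?_ ?_ fun _ _ => rfl
  · intro i _
    have := i.2
    rw [mem_Ico, vac]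
    omega
  · exact fun i _ j _ h => vac_injective h
  · intro x hx
    rw [mem_Ico] at hx
    refine ⟨⟨(-x - 1).toNat, by omega⟩, mem_univ _, ?_⟩
    simp only [vac]
    omega

theorem sum_eq_sum_image {κ : Fin N → ℤ} (hκ : Function.Injective κ) :
    ∑ i, κ i = ∑ x ∈ univ.image κ, x :=
  (Finset.sum_image (f := fun x => x) fun _ _ _ _ h => hκ h).symm

/-- The energy is at least the total depth of the holes in the sea: the particles outside the sea
have nonnegative positions, so dropping them does not increase the sum. -/
theorem sum_le_sum_add {κ : Fin N → ℤ} (hκ : Function.Injective κ) (hs : ∀ i, -(N : ℤ) ≤ κ i) :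
    ∑ i, vac (N := N) i ≤
      ∑ i, κ i + ∑ x ∈ Ico (-(N : ℤ)) 0 \ univ.image κ, x := by
  rw [sum_vac, sum_eq_sum_image hκ,
    ← Finset.sum_inter_add_sum_sdiff (Ico (-(N : ℤ)) 0) (univ.image κ)]
  have h : ∑ x ∈ Ico (-(N : ℤ)) 0 ∩ univ.image κ, x ≤ ∑ x ∈ univ.image κ, x := by
    refine Finset.sum_le_sum_of_subset_of_nonneg Finset.inter_subset_right fun x hx hx' => ?_
    rw [mem_image] at hx
    obtain ⟨i, -, rfl⟩ := hx
    have := hs i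
    by_contra hcon
    exact hx' (mem_inter.2 ⟨mem_Ico.2 ⟨this, by omega⟩, mem_image_of_mem _ (mem_univ i)⟩)
  omega

/-- A state of energy `E` contains every particle of the sea below the depth `E`. -/
theorem IsState.eq_zero_of_missing [CharZero 𝔽] {E : ℤ} {Φ : (Fin N → ℤ) → 𝔽} (h : IsState E Φ)
    {κ : Fin N → ℤ} {v : ℤ} (h1 : -(N : ℤ) ≤ v) (h2 : v < 0) (hv : ∀ i, κ i ≠ v)
    (hE : E < -v) : Φ κ = 0 := by
  by_contra hne
  have hinj : Function.Injective κ := by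
    by_contra hcon
    exact hne (h.eq_zero_of_not_injective hcon)
  have hs : ∀ i, -(N : ℤ) ≤ κ i := fun i => by
    by_contra hcon
    exact hne (h.supp κ i (not_le.1 hcon))
  have hd : ∑ i, κ i = ∑ i, vac (N := N) i + E := by
    by_contra hcon
    exact hne (h.deg κ hcon)
  have key := sum_le_sum_add hinj hs
  have hle : ∑ x ∈ Ico (-(N : ℤ)) 0 \ univ.image κ, x ≤ v := by
    have hmem : v ∈ Ico (-(N : ℤ)) 0 \ univ.image κ := by
      simp [h1, h2, hv]
    rw [← Finset.add_sum_erase _ _ hmem]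
    have : ∑ x ∈ (Ico (-(N : ℤ)) 0 \ univ.image κ).erase v, x ≤ 0 := by
      refine Finset.sum_nonpos fun x hx => ?_
      simp only [mem_erase, mem_sdiff, mem_Ico] at hx
      omega
    omega
  omega

theorem IsState.eq_zero_of_neg [CharZero 𝔽] {E : ℤ} {Φ : (Fin N → ℤ) → 𝔽} (h : IsState E Φ)
    (hE : E < 0) : Φ = 0 := by
  ext κ
  by_contra hne
  have hinj : Function.Injective κ := by
    by_contra hcon
    exact hne (h.eq_zero_of_not_injective hcon)
  have hs : ∀ i, -(N : ℤ) ≤ κ i := fun i => by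
    by_contra hcon
    exact hne (h.supp κ i (not_le.1 hcon))
  have hd : ∑ i, κ i = ∑ i, vac (N := N) i + E := by
    by_contra hcon
    exact hne (h.deg κ hcon)
  have key := sum_le_sum_add hinj hs
  have hle : ∑ x ∈ Ico (-(N : ℤ)) 0 \ univ.image κ, x ≤ 0 := by
    refine Finset.sum_nonpos fun x hx => ?_
    simp only [mem_sdiff, mem_Ico] at hx
    omega
  omega

variable (𝔽 N) in
/-- The vacuum. -/
def vacuum (κ : Fin N → ℤ) : 𝔽 :=
  ∑ σ : Perm (Fin N), if κ = vac ∘ σ then ((Perm.sign σ : ℤ) : 𝔽) else 0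

theorem vacuum_isState : IsState 0 (vacuum 𝔽 N) where
  alt κ τ := by
    simp only [vacuum]
    rw [Finset.mul_sum, ← Equiv.sum_comp (Equiv.mulRight τ)]
    refine Finset.sum_congr rfl fun σ _ => ?_
    simp only [Equiv.coe_mulRight, Perm.coe_mul, ← Function.comp_assoc,
      τ.surjective.injective_comp_right.eq_iff, Perm.sign_mul]
    rw [mul_ite, mul_zero]
    push_cast
    simp only [mul_comm]
  supp κ i h := by
    refine Finset.sum_eq_zero fun σ _ => if_neg ?_
    rintro rfl
    have := (σ i).2
    simp only [Function.comp_apply, vac] at h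
    omega
  deg κ h := by
    refine Finset.sum_eq_zero fun σ _ => if_neg ?_
    rintro rfl
    apply h
    rw [add_zero]
    exact Equiv.sum_comp σ vac

theorem vacuum_vac : vacuum 𝔽 N vac = 1 := by
  rw [vacuum, Finset.sum_eq_single 1]
  · simp
  · intro σ _ hσ
    refine if_neg fun h => hσ ?_
    exact Equiv.ext fun i => (vac_injective (congrFun h i)).symm
  · simp

/-- The operator that lowers the energy of one particle by `e`, with weight
`q ^ (2 k + 1 - e)` if the particle moves from `k` to `k - e`. Particles do not move
below `-N`. -/
def hop (e : ℤ) (q : 𝔽) : Module.End 𝔽 ((Fin N → ℤ) → 𝔽) where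
  toFun Φ κ := if ∀ i, -(N : ℤ) ≤ κ i then
    ∑ i, q ^ (2 * κ i + 1 + e) * Φ (κ + Pi.single i e) else 0
  map_add' Φ Ψ := by
    ext κ
    simp only [Pi.add_apply, mul_add, Finset.sum_add_distrib]
    split_ifs <;> simp
  map_smul' c Φ := by
    ext κ
    simp only [Pi.smul_apply, smul_eq_mul, RingHom.id_apply, Finset.mul_sum, mul_ite, mul_zero,
      mul_left_comm]

theorem hop_apply (e : ℤ) (q : 𝔽) (Φ : (Fin N → ℤ) → 𝔽) {κ : Fin N → ℤ}
    (h : ∀ i, -(N : ℤ) ≤ κ i) :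
    hop e q Φ κ = ∑ i, q ^ (2 * κ i + 1 + e) * Φ (κ + Pi.single i e) := if_pos h

theorem hop_apply_of_lt (e : ℤ) (q : 𝔽) (Φ : (Fin N → ℤ) → 𝔽) {κ : Fin N → ℤ} {i : Fin N}
    (h : κ i < -(N : ℤ)) : hop e q Φ κ = 0 :=
  if_neg fun h' => absurd (h' i) (not_le.2 h)

theorem comp_add_single (κ : Fin N → ℤ) (σ : Perm (Fin N)) (i : Fin N) (e : ℤ) :
    κ ∘ σ + Pi.single i e = (κ + Pi.single (σ i) e) ∘ σ := by
  ext j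
  simp [Pi.single_apply]

theorem IsState.hop {E : ℤ} {Φ : (Fin N → ℤ) → 𝔽} (h : IsState E Φ) (e : ℤ) (q : 𝔽) :
    IsState (E - e) (hop e q Φ) where
  alt κ σ := by
    by_cases hκ : ∀ i, -(N : ℤ) ≤ κ i
    · rw [hop_apply e q Φ hκ, hop_apply e q Φ (κ := κ ∘ σ) fun i => hκ (σ i), Finset.mul_sum]
      conv_rhs => rw [← Equiv.sum_comp σ]
      refine Finset.sum_congr rfl fun i _ => ?_
      rw [comp_add_single, h.alt, Function.comp_apply]
      ring
    · push Not at hκ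
      obtain ⟨i, hi⟩ := hκ
      rw [hop_apply_of_lt e q Φ hi, hop_apply_of_lt e q Φ (i := σ⁻¹ i) (by simpa using hi),
        mul_zero]
  supp κ i hi := hop_apply_of_lt e q Φ hi
  deg κ hκ := by
    change (if _ then _ else _) = _
    split_ifs with h1
    · refine Finset.sum_eq_zero fun i _ => ?_
      rw [h.deg, mul_zero]
      simp only [Pi.add_apply, Finset.sum_add_distrib, Finset.sum_pi_single', mem_univ, if_true]
      omega
    · rfl

/-- The commutation relation. -/
theorem hop_commutator [CharZero 𝔽] {E : ℤ} {Φ : (Fin N → ℤ) → 𝔽} (h : IsState E Φ) {a b : ℤ}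
    {p q : 𝔽} (hp : p ≠ 0) (hq : q ≠ 0) (ha : 0 ≤ a) (hb : b < 0) (hE : E - b ≤ N) :
    hop a p (hop b q Φ) = hop b q (hop a p Φ) +
      ((q ^ a * p ^ (-b) - q ^ (-a) * p ^ b) • hop (a + b) (p * q) Φ +
        (if a + b = 0 then ∑ v ∈ Ico (-(N : ℤ)) (-N + a), (p * q) ^ (2 * v + 1 - a) else 0) • Φ) := by
  ext κ
  simp only [Pi.add_apply, Pi.smul_apply, smul_eq_mul]
  by_cases hκ : ∀ i, -(N : ℤ) ≤ κ i
  swap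
  · push Not at hκ
    obtain ⟨i, hi⟩ := hκ
    simp [hop_apply_of_lt _ _ _ hi, h.supp κ i hi]
  by_cases hinj : Function.Injective κ
  swap
  · rw [((h.hop b q).hop a p).eq_zero_of_not_injective hinj,
      ((h.hop a p).hop b q).eq_zero_of_not_injective hinj,
      (h.hop (a + b) (p * q)).eq_zero_of_not_injective hinj, h.eq_zero_of_not_injective hinj]
    simp
  have hE0 : 0 ≤ E ∨ Φ = 0 := by
    rcases le_or_gt 0 E with h0 | h0
    · exact Or.inl h0
    · exact Or.inr (h.eq_zero_of_neg h0)
  rcases hE0 with hE0 | rfl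
  swap
  · simp
  have hQ : p * q ≠ 0 := mul_ne_zero hp hq
  have hab : hop a p (hop b q Φ) κ = ∑ i, ∑ j, p ^ (2 * κ i + 1 + a) *
      (q ^ (2 * (κ + Pi.single i a : Fin N → ℤ) j + 1 + b) * Φ (κ + Pi.single i a + Pi.single j b)) := by
    rw [hop_apply _ _ _ hκ]
    refine Finset.sum_congr rfl fun i _ => ?_
    rw [hop_apply, Finset.mul_sum]
    intro j
    have := hκ j
    simp only [Pi.add_apply, Pi.single_apply]
    split_ifs <;> omega
  -- In this order the shift by `b < 0` comes first and may leave the range above the floor, which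
  -- kills the term. In the other order the shift by `a ≥ 0` comes first and no restriction arises.
  have hba : hop b q (hop a p Φ) κ = ∑ i, ∑ j, if -(N : ℤ) ≤ κ j + b then
      q ^ (2 * κ j + 1 + b) * (p ^ (2 * (κ + Pi.single j b : Fin N → ℤ) i + 1 + a) *
        Φ (κ + Pi.single i a + Pi.single j b)) else 0 := by
    rw [hop_apply _ _ _ hκ, Finset.sum_comm]
    refine Finset.sum_congr rfl fun j _ => ?_
    split_ifs with hj
    · rw [hop_apply, Finset.mul_sum]
      · refine Finset.sum_congr rfl fun i _ => ?_
        rw [add_right_comm κ]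
      · intro i
        have := hκ i
        simp only [Pi.add_apply, Pi.single_apply]
        split_ifs with hij
        · rw [hij]; exact hj
        · omega
    · rw [hop_apply_of_lt _ _ _ (i := j) (by simpa using hj), mul_zero, Finset.sum_const_zero]
  -- the off-diagonal terms cancel
  have hdiff : hop a p (hop b q Φ) κ - hop b q (hop a p Φ) κ =
      ∑ i, (p ^ (2 * κ i + 1 + a) * (q ^ (2 * (κ i + a) + 1 + b) * Φ (κ + Pi.single i (a + b))) -
        if -(N : ℤ) ≤ κ i + b then q ^ (2 * κ i + 1 + b) * (p ^ (2 * (κ i + b) + 1 + a) *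
          Φ (κ + Pi.single i (a + b))) else 0) := by
    rw [hab, hba, ← Finset.sum_sub_distrib]
    refine Finset.sum_congr rfl fun i _ => ?_
    rw [← Finset.sum_sub_distrib, Finset.sum_eq_single i]
    · simp only [Pi.add_apply, Pi.single_eq_same, add_assoc, ← Pi.single_add]
    · intro j _ hji
      simp only [Pi.add_apply, Pi.single_eq_of_ne hji, Pi.single_eq_of_ne hji.symm, add_zero]
      split_ifs with hj
      · ring
      · rw [h.supp _ j]
        · ring
        · simpa [Pi.single_eq_of_ne hji] using hj
    · simp
  -- The diagonal terms lost at the floor have `κ i < -N - b`, which is below depth `E` because `E -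
  -- b ≤ N`. If `a + b = 0`, every position from `-N` to `-N + a - 1` is occupied and contributes
  -- once. Otherwise the shift by `a + b` leaves a hole at `κ i`, and `Φ` vanishes there.
  have hcorr : ∑ i, (if ¬ -(N : ℤ) ≤ κ i + b then q ^ (2 * κ i + 1 + b) *
      (p ^ (2 * (κ i + b) + 1 + a) * Φ (κ + Pi.single i (a + b))) else 0) =
      (if a + b = 0 then ∑ v ∈ Ico (-(N : ℤ)) (-N + a), (p * q) ^ (2 * v + 1 - a) else 0) *
        Φ κ := by
    split_ifs with h0
    · have hb' : b = -a := by omega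
      subst hb'
      simp only [add_neg_cancel, Pi.single_zero, add_zero]
      by_cases hΦ : Φ κ = 0
      · simp [hΦ]
      rw [Finset.sum_mul, ← Finset.sum_filter]
      refine Finset.sum_bij (fun i _ => κ i) ?_ ?_ ?_ ?_
      · intro i hi
        rw [mem_filter] at hi
        rw [mem_Ico]
        exact ⟨hκ i, by omega⟩
      · exact fun i _ j _ hij => hinj hij
      · intro v hv
        rw [mem_Ico] at hv
        by_contra hcon
        refine hΦ (h.eq_zero_of_missing hv.1 (by omega) (fun i hi => hcon ?_) (by omega))
        exact ⟨i, by rw [mem_filter]; exact ⟨mem_univ _, by omega⟩, hi⟩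
      · intro i _
        rw [mul_zpow, ← mul_assoc, mul_comm (p ^ _)]
        congr 3; ring
    · rw [zero_mul]
      refine Finset.sum_eq_zero fun i _ => ?_
      split_ifs with hi
      · rfl
      · rw [h.eq_zero_of_missing (hκ i) (by omega) (fun j => ?_) (by omega)]
        · ring
        · simp only [Pi.add_apply, Pi.single_apply]
          split_ifs with hji
          · rw [hji]; omega
          · rw [add_zero]
            exact fun hc => hji (hinj hc)
  rw [← sub_eq_iff_eq_add', hdiff, hop_apply _ _ _ hκ, ← hcorr, Finset.mul_sum,
    ← Finset.sum_add_distrib]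
  refine Finset.sum_congr rfl fun i _ => ?_
  have e1 : p ^ (2 * κ i + 1 + a) * q ^ (2 * (κ i + a) + 1 + b) =
      q ^ a * p ^ (-b) * (p * q) ^ (2 * κ i + 1 + (a + b)) := by
    rw [mul_zpow]
    calc _ = q ^ (a + (2 * κ i + 1 + (a + b))) * p ^ (-b + (2 * κ i + 1 + (a + b))) := by
          rw [mul_comm]; congr 2 <;> ring
      _ = _ := by rw [zpow_add₀ hq, zpow_add₀ hp]; ring
  have e2 : q ^ (2 * κ i + 1 + b) * p ^ (2 * (κ i + b) + 1 + a) =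
      q ^ (-a) * p ^ b * (p * q) ^ (2 * κ i + 1 + (a + b)) := by
    rw [mul_zpow]
    calc _ = q ^ (-a + (2 * κ i + 1 + (a + b))) * p ^ (b + (2 * κ i + 1 + (a + b))) := by
          congr 2 <;> ring
      _ = _ := by rw [zpow_add₀ hq, zpow_add₀ hp]; ring
  simp only [← mul_assoc, e1, e2]
  by_cases hi : -(N : ℤ) ≤ κ i + b
  · simp only [hi, if_true, not_true, if_false]
    ring
  · simp only [hi, if_false, not_false_iff, if_true]
    ring

end States

/-! ### Young diagrams and positions of particles -/

section Diagrams

theorem sum_rowLen (Y : YoungDiagram) : ∑ i ∈ range (Y.colLen 0), Y.rowLen i = #Y.cells := by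
  rw [Finset.card_eq_sum_card_fiberwise (f := Prod.fst) (t := range (Y.colLen 0))]
  · exact Finset.sum_congr rfl fun i _ => Y.rowLen_eq_card
  · rintro ⟨i, j⟩ h
    rw [mem_coe, mem_range]
    exact (YoungDiagram.mem_iff_lt_colLen.1 h).trans_le (Y.colLen_anti 0 j (Nat.zero_le _))

theorem colLen_le_card (Y : YoungDiagram) : Y.colLen 0 ≤ #Y.cells := by
  rw [YoungDiagram.colLen_eq_card]
  exact Finset.card_le_card (Finset.filter_subset _ _)

theorem rowLen_eq_zero {Y : YoungDiagram} {i : ℕ} (h : Y.colLen 0 ≤ i) : Y.rowLen i = 0 := by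
  by_contra hne
  exact absurd (YoungDiagram.mem_iff_lt_colLen.1
    (YoungDiagram.mem_iff_lt_rowLen.2 (Nat.pos_of_ne_zero hne))) (not_lt.2 h)

theorem rowLens_diagram {d : ℕ} (p : d.Partition) :
    (diagram p).rowLens = p.parts.sort (· ≥ ·) :=
  YoungDiagram.rowLens_ofRowLens_eq_self fun _ hx => p.parts_pos ((Multiset.mem_sort _).1 hx)

theorem card_diagram {d : ℕ} (p : d.Partition) : #(diagram p).cells = d := by
  rw [← sum_rowLen]
  have h1 : ∑ i ∈ range ((diagram p).colLen 0), (diagram p).rowLen i =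
      (diagram p).rowLens.sum := by
    rw [YoungDiagram.rowLens, Finset.sum_range, ← List.sum_ofFn]
    congr 1
    refine List.ext_getElem (by simp) fun i _ _ => by simp
  rw [h1, rowLens_diagram, ← Multiset.sum_coe, Multiset.sort_eq, p.parts_sum]

theorem diagram_injective {d : ℕ} : Function.Injective (diagram (d := d)) := by
  intro p q h
  have h' := congrArg (fun Y => (Y.rowLens : Multiset ℕ)) h
  simp only [rowLens_diagram, Multiset.sort_eq] at h'
  exact Nat.Partition.ext h'

theorem exists_diagram_eq {d : ℕ} (Y : YoungDiagram) (hY : #Y.cells = d) :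
    ∃ p : d.Partition, diagram p = Y := by
  refine ⟨⟨Y.rowLens, fun {i} hi => Y.pos_of_mem_rowLens i (Multiset.mem_coe.1 hi), ?_⟩, ?_⟩
  · rw [← hY, ← sum_rowLen, Multiset.sum_coe, YoungDiagram.rowLens, Finset.sum_range,
      ← List.sum_ofFn]
    congr 1
    refine List.ext_getElem (by simp) fun i _ _ => by simp
  · have : (Y.rowLens : Multiset ℕ).sort (· ≥ ·) = Y.rowLens := by
      rw [Multiset.coe_sort]
      exact List.mergeSort_eq_self _ Y.rowLens_sorted.pairwise
    rw [diagram]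
    simp only [this]
    exact YoungDiagram.ofRowLens_to_rowLens_eq_self

variable {N : ℕ}

theorem particles_strictAnti (Y : YoungDiagram) : StrictAnti (particles Y N) := by
  intro i j h
  have h1 := Y.rowLen_anti i j h.le
  have h2 : (i : ℕ) < j := h
  simp only [particles, vac]
  omega

theorem le_particles (Y : YoungDiagram) (i : Fin N) : -(N : ℤ) ≤ particles Y N i := by
  have := i.2
  simp only [particles, vac]
  omega

theorem sum_particles {Y : YoungDiagram} (hN : Y.colLen 0 ≤ N) :
    ∑ i, particles Y N i = ∑ i, vac (N := N) i + #Y.cells := by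
  have h1 : ∑ i : Fin N, Y.rowLen i = #Y.cells := by
    rw [← Finset.sum_range fun i => Y.rowLen i, ← sum_rowLen]
    symm
    refine Finset.sum_subset (by simpa using hN) fun i _ hi => ?_
    rw [mem_range, not_lt] at hi
    exact rowLen_eq_zero hi
  simp only [particles, Finset.sum_add_distrib, ← h1, Nat.cast_sum]
  ring

theorem particles_injective {Y Z : YoungDiagram} (hY : Y.colLen 0 ≤ N) (hZ : Z.colLen 0 ≤ N)
    (h : particles Y N = particles Z N) : Y = Z := by
  have h1 : ∀ i, Y.rowLen i = Z.rowLen i := by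
    intro i
    by_cases hi : i < N
    · have := congrFun h ⟨i, hi⟩
      simp only [particles] at this
      omega
    · rw [rowLen_eq_zero (by omega), rowLen_eq_zero (by omega)]
  ext ⟨i, j⟩
  rw [YoungDiagram.mem_cells, YoungDiagram.mem_cells, YoungDiagram.mem_iff_lt_rowLen,
    YoungDiagram.mem_iff_lt_rowLen, h1]

theorem antitone_add_of_strictAnti {κ : Fin N → ℤ} (h : StrictAnti κ) :
    Antitone fun i => κ i + (i : ℤ) := by
  have key : ∀ (n : ℕ) (i j : Fin N), (j : ℕ) = i + n → κ j + (j : ℤ) ≤ κ i + (i : ℤ) := by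
    intro n
    induction n with
    | zero => intro i j hij; rw [show j = i from Fin.ext (by omega)]
    | succ n ih =>
      intro i j hij
      have h1 := ih i ⟨i + n, by omega⟩ rfl
      have h2 : κ j < κ ⟨i + n, by omega⟩ := h (by rw [Fin.lt_def]; simp; omega)
      simp only at h1
      omega
  intro i j hij
  exact key (j - i) i j (by have : (i : ℕ) ≤ j := hij; omega)

/-- Decreasing positions come from a Young diagram. -/
theorem exists_particles_eq {κ : Fin N → ℤ} (h : StrictAnti κ) (hs : ∀ i, -(N : ℤ) ≤ κ i) :
    ∃ Y : YoungDiagram, Y.colLen 0 ≤ N ∧ particles Y N = κ := by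
  have hanti := antitone_add_of_strictAnti h
  have hnn : ∀ i, 0 ≤ κ i - vac i := by
    intro i
    have hi := i.2
    have h1 : κ ⟨N - 1, by omega⟩ + ((N - 1 : ℕ) : ℤ) ≤ κ i + (i : ℤ) :=
      hanti (show i ≤ ⟨N - 1, by omega⟩ by rw [Fin.le_def]; simp; omega)
    have h2 := hs ⟨N - 1, by omega⟩
    simp only [vac]
    omega
  have hex : ∃ Y : YoungDiagram, ∀ i j, (i, j) ∈ Y ↔ ∃ h : i < N,
      j < (κ ⟨i, h⟩ - vac ⟨i, h⟩).toNat := by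
    refine ⟨⟨(univ : Finset (Fin N)).biUnion fun i =>
      (range (κ i - vac i).toNat).image fun j => ((i : ℕ), j), ?_⟩, ?_⟩
    · rintro ⟨i, j⟩ ⟨i', j'⟩ hle hmem
      simp only [coe_biUnion, coe_image, Set.mem_iUnion, Set.mem_image, mem_coe, mem_range,
        Prod.mk.injEq, mem_univ, exists_prop, true_and] at hmem ⊢
      obtain ⟨k, l, hl, rfl, rfl⟩ := hmem
      have h1 : i' ≤ k := hle.1
      have h2 : j' ≤ l := hle.2
      refine ⟨⟨i', by omega⟩, j', ?_, rfl, rfl⟩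
      have h3 := hanti (show (⟨i', by omega⟩ : Fin N) ≤ k from h1)
      simp only [vac] at h3 hl ⊢
      omega
    · intro i j
      rw [← YoungDiagram.mem_cells]
      simp only [mem_biUnion, mem_univ, true_and, mem_image, mem_range, Prod.mk.injEq]
      constructor
      · rintro ⟨k, l, hl, rfl, rfl⟩
        exact ⟨k.2, hl⟩
      · rintro ⟨hi, hj⟩
        exact ⟨⟨i, hi⟩, j, hj, rfl, rfl⟩
  obtain ⟨Y, hY⟩ := hex
  refine ⟨Y, ?_, funext fun i => ?_⟩
  · by_contra hcon
    have := (hY N 0).1 (YoungDiagram.mem_iff_lt_colLen.2 (not_le.1 hcon))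
    exact lt_irrefl _ this.1
  · have h1 : Y.rowLen i = (κ i - vac i).toNat := by
      refine eq_of_forall_lt_iff fun j => ?_
      rw [← YoungDiagram.mem_iff_lt_rowLen, hY]
      exact ⟨fun h => h.2, fun h => ⟨i.2, h⟩⟩
    have := hnn i
    simp only [particles, h1]
    omega

theorem exists_strictAnti_comp {κ : Fin N → ℤ} (h : Function.Injective κ) :
    ∃ σ : Perm (Fin N), StrictAnti (κ ∘ σ) := by
  refine ⟨Tuple.sort (-κ), fun i j hij => ?_⟩
  have hm := Tuple.monotone_sort (-κ) hij.le
  simp only [Function.comp_apply, Pi.neg_apply, neg_le_neg_iff] at hm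
  refine lt_of_le_of_ne hm fun hc => ?_
  exact hij.ne ((Tuple.sort (-κ)).injective (h hc)).symm

/-- Injective positions are those of a unique partition, up to a unique permutation. -/
theorem exists_partition_perm {d : ℕ} {κ : Fin N → ℤ} (h : Function.Injective κ)
    (hs : ∀ i, -(N : ℤ) ≤ κ i) (hE : ∑ i, κ i = ∑ i, vac (N := N) i + d) :
    ∃ (p : d.Partition) (σ : Perm (Fin N)), κ = particles (diagram p) N ∘ σ := by
  obtain ⟨σ, hσ⟩ := exists_strictAnti_comp h
  obtain ⟨Y, hYN, hY⟩ := exists_particles_eq hσ fun i => hs (σ i)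
  have hc : #Y.cells = d := by
    have h1 := sum_particles hYN
    rw [hY] at h1
    have h2 : ∑ i, (κ ∘ σ) i = ∑ i, κ i := Equiv.sum_comp σ κ
    rw [h2, hE] at h1
    omega
  obtain ⟨p, hp⟩ := exists_diagram_eq Y hc
  refine ⟨p, σ⁻¹, ?_⟩
  rw [hp, hY]
  ext i
  simp

theorem partition_perm_unique {d : ℕ} (hd : d ≤ N) {p q : d.Partition} {σ τ : Perm (Fin N)}
    (h : particles (diagram p) N ∘ σ = particles (diagram q) N ∘ τ) : p = q ∧ σ = τ := by
  have hp := particles_strictAnti (N := N) (diagram p)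
  have hq := particles_strictAnti (N := N) (diagram q)
  have hr : Set.range (particles (diagram p) N) = Set.range (particles (diagram q) N) := by
    rw [← σ.surjective.range_comp, h, τ.surjective.range_comp]
  have h1 : particles (diagram p) N = particles (diagram q) N := by
    have hp' : StrictMono (OrderDual.toDual ∘ particles (diagram p) N) := fun i j hij => hp hij
    have hq' : StrictMono (OrderDual.toDual ∘ particles (diagram q) N) := fun i j hij => hq hij
    have := (hp'.range_inj hq').1 (by rw [Set.range_comp, Set.range_comp, hr])
    exact OrderDual.toDual.injective.comp_left this
  have hle : ∀ p : d.Partition, (diagram p).colLen 0 ≤ N := fun p =>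
    (colLen_le_card _).trans ((card_diagram p).le.trans hd)
  refine ⟨diagram_injective (particles_injective (hle p) (hle q) h1), ?_⟩
  rw [h1] at h
  exact Equiv.ext fun i => hq.injective (congrFun h i)

/-- A state is determined by its values on partitions. -/
theorem IsState.expand {𝔽 : Type*} [Field 𝔽] [CharZero 𝔽] {d : ℕ} (hd : d ≤ N)
    {Φ : (Fin N → ℤ) → 𝔽} (h : IsState (d : ℤ) Φ) (κ : Fin N → ℤ) :
    Φ κ = ∑ p : d.Partition, ∑ σ : Perm (Fin N),
      if κ = particles (diagram p) N ∘ σ then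
        ((Perm.sign σ : ℤ) : 𝔽) * Φ (particles (diagram p) N) else 0 := by
  by_cases hne : ∃ (p : d.Partition) (σ : Perm (Fin N)), κ = particles (diagram p) N ∘ σ
  · obtain ⟨p, σ, rfl⟩ := hne
    rw [Finset.sum_eq_single p, Finset.sum_eq_single σ]
    · rw [if_pos rfl, h.alt]
    · exact fun τ _ hτ => if_neg fun hc => hτ (partition_perm_unique hd hc).2.symm
    · simp
    · exact fun q _ hq => Finset.sum_eq_zero fun τ _ =>
        if_neg fun hc => hq (partition_perm_unique hd hc).1.symm
    · simp
  · push Not at hne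
    rw [Finset.sum_eq_zero fun p _ => Finset.sum_eq_zero fun σ _ => if_neg (hne p σ)]
    by_contra hΦ
    have hinj : Function.Injective κ := by
      by_contra hcon
      exact hΦ (h.eq_zero_of_not_injective hcon)
    have hs : ∀ i, -(N : ℤ) ≤ κ i := fun i => by
      by_contra hcon
      exact hΦ (h.supp κ i (not_le.1 hcon))
    have hE : ∑ i, κ i = ∑ i, vac (N := N) i + d := by
      by_contra hcon
      exact hΦ (h.deg κ hcon)
    obtain ⟨p, σ, hκ⟩ := exists_partition_perm hinj hs hE
    exact hne p σ hκ

end Diagrams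

/-! ### Creation and annihilation operators -/

section Parts

variable {𝔽 : Type*} [Field 𝔽] {N : ℕ}

/-- The product of the operators that remove energies `a ∈ l`. -/
def lower (l : List ℕ) : Module.End 𝔽 ((Fin N → ℤ) → 𝔽) := (l.map fun a : ℕ => hop (a : ℤ) 1).prod

/-- The product of the operators that add energies `a ∈ l`. -/
def raise (l : List ℕ) : Module.End 𝔽 ((Fin N → ℤ) → 𝔽) := (l.map fun a : ℕ => hop (-(a : ℤ)) 1).prod

/-- The change of the positions if particle `f j` moves by `l j`. -/
def displacement (l : List ℕ) (f : Fin l.length → Fin N) : Fin N → ℤ :=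
  ∑ j, Pi.single (f j) (l.get j : ℤ)

theorem displacement_nonneg (l : List ℕ) (f : Fin l.length → Fin N) (i : Fin N) :
    0 ≤ displacement l f i := by
  rw [displacement, Finset.sum_apply]
  refine Finset.sum_nonneg fun j _ => ?_
  rw [Pi.single_apply]
  split_ifs <;> simp

theorem sum_displacement_cons {M : Type*} [AddCommMonoid M] (a : ℕ) (l : List ℕ)
    (F : (Fin N → ℤ) → M) :
    ∑ f, F (displacement (a :: l) f) = ∑ i, ∑ f, F (Pi.single i (a : ℤ) + displacement l f) := by
  rw [← Fintype.sum_prod_type' (f := fun (i : Fin N) (f : Fin l.length → Fin N) =>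
    F ((Pi.single i (a : ℤ) : Fin N → ℤ) + displacement l f))]
  refine (Fintype.sum_equiv (Fin.consEquiv fun _ : Fin (l.length + 1) => Fin N) _ _ ?_).symm
  rintro ⟨i, f⟩
  refine congrArg F ?_
  unfold displacement
  symm
  refine (Fin.sum_univ_succ (M := Fin N → ℤ) (n := l.length) _).trans ?_
  rfl

theorem lower_apply (l : List ℕ) (Φ : (Fin N → ℤ) → 𝔽) {κ : Fin N → ℤ}
    (hκ : ∀ i, -(N : ℤ) ≤ κ i) : lower l Φ κ = ∑ f, Φ (κ + displacement l f) := by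
  induction l generalizing κ with
  | nil => simp [lower, displacement]
  | cons a l ih =>
    have h1 : lower (a :: l) Φ = hop (a : ℤ) 1 (lower l Φ) := by simp [lower]
    rw [h1, hop_apply _ _ _ hκ, sum_displacement_cons a l fun x => Φ (κ + x)]
    refine Finset.sum_congr rfl fun i _ => ?_
    rw [one_zpow, one_mul, ih]
    · simp only [add_assoc]
    · intro j
      have := hκ j
      simp only [Pi.add_apply, Pi.single_apply]
      split_ifs <;> omega

theorem raise_isState (l : List ℕ) {E : ℤ} {Φ : (Fin N → ℤ) → 𝔽} (h : IsState E Φ) :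
    IsState (E + (l.sum : ℕ)) (raise l Φ) := by
  induction l with
  | nil => simpa [raise] using h
  | cons a l ih =>
    have h1 : raise (a :: l) Φ = hop (-(a : ℤ)) 1 (raise l Φ) := by simp [raise]
    rw [h1]
    convert ih.hop (-(a : ℤ)) 1 using 1
    push_cast [List.sum_cons]
    ring

theorem raise_apply (l : List ℕ) {E : ℤ} {Φ : (Fin N → ℤ) → 𝔽} (h : IsState E Φ)
    (κ : Fin N → ℤ) : raise l Φ κ = ∑ f, Φ (κ - displacement l f) := by
  by_cases hκ : ∀ i, -(N : ℤ) ≤ κ i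
  · induction l generalizing κ with
    | nil => simp [raise, displacement]
    | cons a l ih =>
      have h1 : raise (a :: l) Φ = hop (-(a : ℤ)) 1 (raise l Φ) := by simp [raise]
      rw [h1, hop_apply _ _ _ hκ, sum_displacement_cons a l fun x => Φ (κ - x)]
      refine Finset.sum_congr rfl fun i _ => ?_
      rw [one_zpow, one_mul]
      by_cases hi : -(N : ℤ) ≤ κ i - a
      · rw [ih]
        · simp only [sub_eq_add_neg, Pi.single_neg, neg_add, add_assoc]
        · intro j
          have := hκ j
          simp only [Pi.add_apply, Pi.single_apply]
          split_ifs with hj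
          · rw [hj]; omega
          · omega
      -- A particle below the floor makes both sides vanish, since the remaining displacements only
      -- move it further down.
      · rw [(raise_isState l h).supp _ i (by simp only [Pi.add_apply, Pi.single_eq_same]; omega)]
        symm
        refine Finset.sum_eq_zero fun f _ => h.supp _ i ?_
        have := displacement_nonneg l f i
        simp only [Pi.sub_apply, Pi.add_apply, Pi.single_eq_same]
        omega
  · push Not at hκ
    obtain ⟨i, hi⟩ := hκ
    rw [(raise_isState l h).supp κ i hi]
    symm
    refine Finset.sum_eq_zero fun f _ => h.supp _ i ?_
    have := displacement_nonneg l f i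
    simp only [Pi.sub_apply]
    omega

theorem partCount_eq (l : List ℕ) (ν : Fin N → ℤ) :
    partCount l.get ν = #{f : Fin l.length → Fin N | displacement l f = ν} := by
  classical
  rw [partCount, Nat.card_eq_fintype_card, Fintype.card_subtype]
  congr 1
  ext f
  simp only [mem_filter, mem_univ, true_and, funext_iff, displacement, Finset.sum_apply,
    Pi.single_apply, Finset.sum_filter, eq_comm]

/-- A way to move the particles from `vac ∘ σ` to `κ` by the parts in `l` is a distribution of these
parts with content `κ - vac ∘ σ`. -/
theorem raise_vacuum (l : List ℕ) (κ : Fin N → ℤ) :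
    raise l (vacuum 𝔽 N) κ = (frob l.get κ : 𝔽) := by
  rw [raise_apply l vacuum_isState]
  simp only [vacuum, frob, Int.cast_sum]
  rw [Finset.sum_comm]
  refine Finset.sum_congr rfl fun σ _ => ?_
  rw [← Finset.sum_filter, Finset.sum_const, partCount_eq, nsmul_eq_mul]
  push_cast
  rw [mul_comm]
  congr 3
  ext f
  simp only [mem_filter, mem_univ, true_and, funext_iff, Pi.sub_apply, Function.comp_apply]
  refine forall_congr' fun i => ?_
  constructor <;> intro h <;> omega

theorem displacement_comp (l : List ℕ) (f : Fin l.length → Fin N) (τ : Perm (Fin N)) (i : Fin N) :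
    displacement l (τ ∘ f) (τ i) = displacement l f i := by
  simp [displacement, Pi.single_apply]

/-- The state is expanded over partitions and permutations of positions. Moving from `vac` to the
positions permuted by `σ` amounts to moving from `vac ∘ σ⁻¹` to the decreasing positions, so the
coefficients are those of `raise_vacuum`, with the sum running over `σ⁻¹`. -/
theorem lower_vac [CharZero 𝔽] (l : List ℕ) {d : ℕ} (hd : d ≤ N) {Φ : (Fin N → ℤ) → 𝔽}
    (h : IsState (d : ℤ) Φ) : lower l Φ vac =
      ∑ p : d.Partition, (frob l.get (particles (diagram p) N) : 𝔽) *
        Φ (particles (diagram p) N) := by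
  rw [lower_apply]
  swap
  · intro i
    have := i.2
    simp only [vac]
    omega
  simp only [h.expand hd (vac + displacement l _)]
  rw [Finset.sum_comm]
  refine Finset.sum_congr rfl fun p _ => ?_
  rw [Finset.sum_comm, frob, Int.cast_sum, Finset.sum_mul]
  conv_rhs => rw [← Equiv.sum_comp (Equiv.inv _)]
  refine Finset.sum_congr rfl fun σ _ => ?_
  rw [← Finset.sum_filter, Finset.sum_const, partCount_eq, nsmul_eq_mul]
  simp only [Equiv.inv_apply, Perm.sign_inv]
  push_cast
  rw [← mul_assoc, mul_comm ((Perm.sign σ : ℤ) : 𝔽)]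
  congr 3
  refine Finset.card_bij (fun f _ => σ ∘ f) ?_ ?_ ?_
  · intro f hf
    simp only [mem_filter, mem_univ, true_and] at hf ⊢
    ext i
    obtain ⟨k, rfl⟩ := σ.surjective i
    have h1 := congrFun hf k
    simp only [Pi.add_apply, Function.comp_apply] at h1
    rw [displacement_comp, Perm.inv_def, Equiv.symm_apply_apply]
    omega
  · exact fun f _ f' _ hff => σ.injective.comp_left hff
  · intro f hf
    simp only [mem_filter, mem_univ, true_and] at hf ⊢
    have h2 : σ ∘ (⇑(σ⁻¹) ∘ f) = f := by
      ext1 j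
      simp
    refine ⟨⇑(σ⁻¹) ∘ f, ?_, h2⟩
    ext k
    have h1 := congrFun hf (σ k)
    have h3 := displacement_comp l (⇑(σ⁻¹) ∘ f) σ k
    rw [h2] at h3
    simp only [Perm.inv_def, Equiv.symm_apply_apply] at h1 h3
    simp only [Pi.add_apply, Function.comp_apply, Perm.inv_def]
    omega

theorem map_get_univ (l : List ℕ) : (univ : Finset (Fin l.length)).val.map l.get = (l : Multiset ℕ) := by
  rw [Fin.univ_val_map, List.ofFn_get]

/-- No commutation relation is needed: the coefficients in `raise_vacuum` depend only on the
multiset of parts. -/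
theorem raise_vacuum_perm {l l' : List ℕ} (h : l.Perm l') :
    raise l (vacuum 𝔽 N) = raise l' (vacuum 𝔽 N) := by
  ext κ
  rw [raise_vacuum, raise_vacuum, frob_congr (a := l.get) (b := l'.get)]
  rw [map_get_univ, map_get_univ, Multiset.coe_eq_coe]
  exact h

/-- Moving an annihilation operator through creation operators. -/
theorem hop_raise [CharZero 𝔽] {x : ℕ} (hx : 0 < x) (l : List ℕ) (hl : ∀ y ∈ l, 0 < y)
    (hN : l.sum ≤ N) :
    hop (x : ℤ) 1 (raise l (vacuum 𝔽 N)) =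
      ((x * l.count x : ℕ) : 𝔽) • raise (l.erase x) (vacuum 𝔽 N) := by
  induction l with
  | nil =>
    rw [List.count_nil, mul_zero, Nat.cast_zero, zero_smul]
    have h := raise_isState (𝔽 := 𝔽) (N := N) [] vacuum_isState
    exact (h.hop (x : ℤ) 1).eq_zero_of_neg (by simpa using hx)
  | cons y l ih =>
    have hcons : ∀ y l, raise (y :: l) (vacuum 𝔽 N) =
        hop (-(y : ℤ)) 1 (raise l (vacuum 𝔽 N)) := fun y l => by simp [raise]
    have hy : 0 < y := hl y (by simp)
    rw [List.sum_cons] at hN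
    have hst := raise_isState (𝔽 := 𝔽) l vacuum_isState (N := N)
    rw [hcons, hop_commutator hst one_ne_zero one_ne_zero (by omega) (by omega) (by omega),
      ih (fun y hy => hl y (by simp [hy])) (by omega), map_smul, ← hcons]
    -- For weights `1` the factor of the hop term is zero, and the central term is a sum of `x`
    -- ones, present only if `x = y`.
    simp only [one_zpow, mul_one, sub_self, zero_smul, zero_add, Finset.sum_const, nsmul_eq_mul,
      Int.card_Ico]
    by_cases hxy : x = y
    · subst hxy
      have h1 : ((x * l.count x : ℕ) : 𝔽) • raise (x :: l.erase x) (vacuum 𝔽 N) =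
          ((x * l.count x : ℕ) : 𝔽) • raise l (vacuum 𝔽 N) := by
        by_cases hm : x ∈ l
        · rw [raise_vacuum_perm (List.perm_cons_erase hm).symm]
        · rw [List.count_eq_zero.2 hm]
          simp
      rw [h1, List.erase_cons_head, List.count_cons_self, if_pos (by omega), ← add_smul]
      congr 1
      have : (-(N : ℤ) + x - -N).toNat = x := by omega
      rw [this]
      push_cast
      ring
    · rw [if_neg (by omega), zero_smul, add_zero, List.erase_cons_tail (by simpa using Ne.symm hxy),
        List.count_cons_of_ne (Ne.symm hxy)]

/-- The order of the centralizer of a permutation with cycle lengths `m`. -/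
def centralizerOrder (m : Multiset ℕ) : ℕ := m.prod * ∏ v ∈ m.toFinset, (m.count v).factorial

theorem centralizerOrder_cons (x : ℕ) (m : Multiset ℕ) :
    centralizerOrder (x ::ₘ m) = x * (m.count x + 1) * centralizerOrder m := by
  have h : ∏ v ∈ m.toFinset, (m.count v).factorial =
      ∏ v ∈ insert x m.toFinset, (m.count v).factorial := by
    refine Finset.prod_subset (Finset.subset_insert _ _) fun v _ hv => ?_
    rw [Multiset.mem_toFinset] at hv
    rw [Multiset.count_eq_zero.2 hv, Nat.factorial_zero]
  rw [centralizerOrder, centralizerOrder, h, Multiset.toFinset_cons, Multiset.prod_cons,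
    ← Finset.mul_prod_erase _ _ (Finset.mem_insert_self x m.toFinset),
    ← Finset.mul_prod_erase _ (fun v => (m.count v).factorial)
      (Finset.mem_insert_self x m.toFinset), Multiset.count_cons_self, Nat.factorial_succ,
    Finset.prod_congr rfl fun v hv =>
      by rw [Multiset.count_cons_of_ne (Finset.ne_of_mem_erase hv)]]
  ring

/-- The rightmost annihilation operator, moved through the creation operators, removes one part
equal to `x` with factor `x` times its multiplicity. These factors multiply up to the order of the
centralizer, and a part without a partner gives zero. -/
theorem lower_raise [CharZero 𝔽] (l l' : List ℕ) (hl : ∀ y ∈ l, 0 < y) (hl' : ∀ y ∈ l', 0 < y)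
    (hs : l.sum = l'.sum) (hN : l'.sum ≤ N) :
    lower l (raise l' (vacuum 𝔽 N)) vac =
      if l.Perm l' then (centralizerOrder (l : Multiset ℕ) : 𝔽) else 0 := by
  induction l using List.reverseRecOn generalizing l' with
  | nil =>
    have : l' = [] := by
      rcases l' with _ | ⟨a, l'⟩
      · rfl
      · have := hl' a (by simp)
        simp at hs
        omega
    subst this
    simp [lower, raise, vacuum_vac, centralizerOrder]
  | append_singleton l x ih =>
    have hx : 0 < x := hl x (by simp)
    have h1 : ∀ Φ : (Fin N → ℤ) → 𝔽, lower (l ++ [x]) Φ = lower l (hop (x : ℤ) 1 Φ) := by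
      simp [lower]
    rw [h1, hop_raise hx l' hl' hN, map_smul, Pi.smul_apply, smul_eq_mul]
    by_cases hm : x ∈ l'
    · have hp := List.perm_cons_erase hm
      have hsum := hp.sum_eq
      rw [List.sum_cons] at hsum
      rw [List.sum_append, List.sum_singleton] at hs
      rw [ih (l'.erase x) (fun y hy => hl y (by simp [hy]))
        (fun y hy => hl' y (List.mem_of_mem_erase hy)) (by omega) (by omega)]
      have hiff : (l ++ [x]).Perm l' ↔ l.Perm (l'.erase x) := by
        exact ⟨fun h => (List.perm_cons x).1
            ((List.perm_append_singleton x l).symm.trans (h.trans hp)),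
          fun h => (List.perm_append_singleton x l).trans
            (((List.perm_cons x).2 h).trans hp.symm)⟩
      rw [mul_ite, mul_zero]
      simp only [hiff]
      split_ifs with h
      · have h2 : ((l ++ [x] : List ℕ) : Multiset ℕ) = x ::ₘ (l : Multiset ℕ) := by
          rw [Multiset.cons_coe, Multiset.coe_eq_coe]
          exact List.perm_append_singleton x l
        have h3 : l'.count x = l.count x + 1 := by
          rw [hp.count_eq, List.count_cons_self, h.count_eq]
        rw [h2, centralizerOrder_cons, Multiset.coe_count, h3]
        push_cast
        ring
      · rfl
    · rw [List.count_eq_zero.2 hm, if_neg]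
      · simp
      · exact fun h => hm (h.subset (by simp))

end Parts

/-! ### The Frobenius class functions have norm one -/

section Norm

variable {N : ℕ}

/-- Column orthogonality: inserting a complete set of states between the annihilation and the
creation operators in `lower_raise` gives the sum over partitions. -/
theorem sum_frob_mul_frob (l l' : List ℕ) (hl : ∀ y ∈ l, 0 < y) (hl' : ∀ y ∈ l', 0 < y) {d : ℕ}
    (hs : l.sum = d) (hs' : l'.sum = d) (hN : d ≤ N) :
    ∑ p : d.Partition, (frob l.get (particles (diagram p) N) : ℚ) *
      (frob l'.get (particles (diagram p) N) : ℚ) =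
      if l.Perm l' then (centralizerOrder (l : Multiset ℕ) : ℚ) else 0 := by
  have hst := raise_isState (𝔽 := ℚ) (N := N) l' vacuum_isState
  rw [hs', zero_add] at hst
  rw [← lower_raise l l' hl hl' (hs.trans hs'.symm) (hs'.le.trans hN), lower_vac l hN hst]
  simp only [raise_vacuum]

theorem centralizerOrder_pos {m : Multiset ℕ} (h : ∀ x ∈ m, 0 < x) : 0 < centralizerOrder m := by
  refine Nat.mul_pos (Multiset.prod_pos fun x hx => h x hx) ?_
  exact Finset.prod_pos fun v _ => Nat.factorial_pos _

/-- Row orthogonality. -/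
theorem sum_frob_sq {d : ℕ} (hN : d ≤ N) (p : d.Partition) :
    ∑ a : d.Partition, (frob a.parts.toList.get (particles (diagram p) N) : ℚ) ^ 2 /
      (centralizerOrder a.parts : ℚ) = 1 := by
  let A : Matrix d.Partition d.Partition ℚ := fun a p =>
    (frob a.parts.toList.get (particles (diagram p) N) : ℚ) / (centralizerOrder a.parts : ℚ)
  let B : Matrix d.Partition d.Partition ℚ := fun p a =>
    (frob a.parts.toList.get (particles (diagram p) N) : ℚ)
  have hAB : A * B = 1 := by
    ext a b
    rw [Matrix.mul_apply, Matrix.one_apply]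
    have h := sum_frob_mul_frob (N := N) a.parts.toList b.parts.toList
      (fun y hy => a.parts_pos (Multiset.mem_toList.1 hy))
      (fun y hy => b.parts_pos (Multiset.mem_toList.1 hy)) (d := d)
      (by rw [Multiset.sum_toList, a.parts_sum]) (by rw [Multiset.sum_toList, b.parts_sum]) hN
    have h0 : (centralizerOrder a.parts : ℚ) ≠ 0 :=
      Nat.cast_ne_zero.2 (centralizerOrder_pos fun x hx => a.parts_pos hx).ne'
    simp only [A, B, div_mul_eq_mul_div, ← Finset.sum_div, h, Multiset.coe_toList]
    have hiff : a.parts.toList.Perm b.parts.toList ↔ a = b := by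
      rw [← Multiset.coe_eq_coe, Multiset.coe_toList, Multiset.coe_toList]
      exact ⟨Nat.Partition.ext, fun h => h ▸ rfl⟩
    simp only [hiff]
    split_ifs
    · exact div_self h0
    · exact zero_div _
  -- Both indices run over the partitions of `d`, so the matrices are square and the one-sided
  -- inverse is two-sided. This turns column orthogonality into row orthogonality.
  have hBA' : B * A = 1 := mul_eq_one_comm.1 hAB
  have hBA := congrFun (congrFun hBA' p) p
  rw [Matrix.mul_apply, Matrix.one_apply_eq] at hBA
  rw [← hBA]
  refine Finset.sum_congr rfl fun a _ => ?_
  simp only [A, B]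
  ring

variable {X : Type*} [Fintype X] [DecidableEq X]

theorem centralizerOrder_add_replicate {m : Multiset ℕ} (h : 1 ∉ m) (k : ℕ) :
    centralizerOrder (m + Multiset.replicate k 1) = k.factorial * centralizerOrder m := by
  induction k with
  | zero => simp
  | succ k ih =>
    rw [Multiset.replicate_succ, Multiset.add_cons, centralizerOrder_cons, ih, Nat.factorial_succ,
      Multiset.count_add, Multiset.count_eq_zero.2 h, Multiset.count_replicate_self]
    ring

/-- The cycle type omits the fixed points, so the parts equal to `1` are split off; `k` of them
contribute `k!` to the order of the centralizer. -/
theorem card_partition_eq (a : (Fintype.card X).Partition) :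
    #{g : Perm X | g.partition = a} * centralizerOrder a.parts = (Fintype.card X).factorial := by
  set m := a.parts.filter fun n => 2 ≤ n with hm
  have hsplit : a.parts = m + Multiset.replicate (a.parts.count 1) 1 := by
    rw [hm, ← Multiset.filter_eq']
    conv_lhs => rw [← Multiset.filter_add_not (fun n => 2 ≤ n) a.parts]
    congr 1
    refine Multiset.filter_congr fun x hx => ?_
    have := a.parts_pos hx
    omega
  have hsum := a.parts_sum
  rw [hsplit, Multiset.sum_add, Multiset.sum_replicate, smul_eq_mul, mul_one] at hsum
  have h1 : 1 ∉ m := by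
    intro h
    rw [hm, Multiset.mem_filter] at h
    omega
  have hset : ∀ g : Perm X, g.partition = a ↔ g.cycleType = m := by
    intro g
    constructor
    · rintro rfl
      rw [hm, Perm.filter_parts_partition_eq_cycleType]
    · intro h
      apply Nat.Partition.ext
      rw [Perm.parts_partition, h, hsplit, ← Perm.sum_cycleType, h]
      congr 2
      omega
  have hc := Perm.card_of_cycleType_mul_eq X m
  rw [if_pos ⟨by omega, fun x hx => by rw [hm, Multiset.mem_filter] at hx; exact hx.2⟩] at hc
  rw [← hc, hsplit, centralizerOrder_add_replicate h1]
  simp only [hset, centralizerOrder]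
  rw [show Fintype.card X - m.sum = a.parts.count 1 by omega]
  ring

theorem frobChar_eq_frob_toList (k : Fin N → ℤ) (g : Perm X) :
    frobChar k g = frob g.partition.parts.toList.get k := by
  apply frobChar_eq_frob
  rw [map_get_univ, Multiset.coe_toList]

/-- Grouping the permutations by cycle type weights each class by the group order over the order of
the centralizer, and row orthogonality applies. -/
theorem sum_frobChar_sq (Y : YoungDiagram) (hN : #Y.cells ≤ N) :
    ∑ g : Perm (Cell Y), frobChar (particles Y N) g ^ 2 = Fintype.card (Perm (Cell Y)) := by
  have hcard : Fintype.card (Cell Y) = #Y.cells := Fintype.card_coe _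
  obtain ⟨p, hp⟩ := exists_diagram_eq (d := Fintype.card (Cell Y)) Y hcard.symm
  have h1 := sum_frob_sq (N := N) (by rw [hcard]; exact hN) p
  rw [hp] at h1
  have h2 : ∑ g : Perm (Cell Y), (frobChar (particles Y N) g : ℚ) ^ 2 =
      ((Fintype.card (Cell Y)).factorial : ℚ) := by
    rw [← Finset.sum_fiberwise univ (fun g : Perm (Cell Y) => g.partition),
      ← mul_one ((Fintype.card (Cell Y)).factorial : ℚ), ← h1, Finset.mul_sum]
    refine Finset.sum_congr rfl fun a _ => ?_
    have h0 : (centralizerOrder a.parts : ℚ) ≠ 0 :=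
      Nat.cast_ne_zero.2 (centralizerOrder_pos fun x hx => a.parts_pos hx).ne'
    rw [← card_partition_eq a, Finset.sum_congr rfl (g := fun _ =>
      (frob a.parts.toList.get (particles Y N) : ℚ) ^ 2) fun g hg => by
        rw [frobChar_eq_frob_toList, (mem_filter.1 hg).2], Finset.sum_const, nsmul_eq_mul]
    push_cast
    field_simp
  rw [Fintype.card_perm]
  exact_mod_cast h2

/-- **Frobenius' character formula**. -/
theorem irrChar_eq_frob (Y : YoungDiagram) (hN : #Y.cells ≤ N) (l : List ℕ)
    (hl : ∀ y ∈ l, 0 < y) (hs : l.sum = #Y.cells) :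
    irrChar Y (l : Multiset ℕ) = frob l.get (particles Y N) := by
  classical
  have hex : ∃ σ : Perm (Cell Y), σ.partition.parts = (l : Multiset ℕ) := by
    have hcard : Fintype.card (Cell Y) = #Y.cells := Fintype.card_coe _
    let a : (Fintype.card (Cell Y)).Partition :=
      ⟨(l : Multiset ℕ), fun {y} hy => hl y (Multiset.mem_coe.1 hy), by
        rw [Multiset.sum_coe, hs, hcard]⟩
    have h := card_partition_eq (X := Cell Y) a
    have hpos : 0 < #{g : Perm (Cell Y) | g.partition = a} := by
      rcases Nat.eq_zero_or_pos #{g : Perm (Cell Y) | g.partition = a} with h0 | h0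
      · rw [h0, zero_mul] at h
        exact absurd h.symm (Nat.factorial_ne_zero _)
      · exact h0
    obtain ⟨g, hg⟩ := Finset.card_pos.1 hpos
    exact ⟨g, congrArg Nat.Partition.parts (mem_filter.1 hg).2⟩
  have hdec : irrChar Y (l : Multiset ℕ) =
      LinearMap.trace ℚ (IrrepSpace Y) (irrep Y hex.choose) := by
    unfold irrChar
    split_ifs
    rfl
  rw [hdec]
  have h1 := idealTrace_eq_frobChar ((colLen_le_card Y).trans hN) (sum_frobChar_sq Y hN) hex.choose
  rw [frobChar_eq_frob _ _ (a := l.get) (by rw [map_get_univ, hex.choose_spec])] at h1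
  exact h1

end Norm

/-! ### The operators of the algorithm -/

section Labels

variable {m n s : ℕ}

/-- The set of labels of an operator. -/
def Op.labels (a : Op m n s) : Finset (Fin m ⊕ Fin n ⊕ Fin s) := a.I.disjSum (a.J.disjSum a.K)

theorem Op.mem_labels_inl {a : Op m n s} {i : Fin m} : Sum.inl i ∈ a.labels ↔ i ∈ a.I := by
  simp [Op.labels]

theorem Op.mem_labels_inr_inl {a : Op m n s} {j : Fin n} :
    Sum.inr (Sum.inl j) ∈ a.labels ↔ j ∈ a.J := by
  simp [Op.labels]

theorem Op.mem_labels_inr_inr {a : Op m n s} {k : Fin s} :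
    Sum.inr (Sum.inr k) ∈ a.labels ↔ k ∈ a.K := by
  simp [Op.labels]

theorem Op.labels_merge (a b : Op m n s) : (a.merge b).labels = a.labels ∪ b.labels := by
  ext x
  rcases x with i | j | k <;>
    simp [Op.mem_labels_inl, Op.mem_labels_inr_inl, Op.mem_labels_inr_inr, Op.merge]

theorem Op.disjoint_K {a b : Op m n s} (h : Disjoint a.labels b.labels) : Disjoint a.K b.K := by
  rw [Finset.disjoint_left] at h ⊢
  intro k h1 h2
  exact h (Op.mem_labels_inr_inr.2 h1) (Op.mem_labels_inr_inr.2 h2)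

/-- The contribution of a label to the energy. -/
def labelEnergy (μ : Fin m → ℕ) (ν : Fin n → ℕ) : Fin m ⊕ Fin n ⊕ Fin s → ℤ :=
  Sum.elim (fun i => (μ i : ℤ)) (Sum.elim (fun j => -(ν j : ℤ)) fun _ => 0)

variable (μ : Fin m → ℕ) (ν : Fin n → ℕ)

theorem Op.energy_eq (a : Op m n s) : a.energy μ ν = ∑ x ∈ a.labels, labelEnergy μ ν x := by
  simp [Op.labels, Finset.sum_disjSum, labelEnergy, Op.energy, sub_eq_add_neg]

theorem Op.energy_merge {a b : Op m n s} (h : Disjoint a.labels b.labels) :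
    (a.merge b).energy μ ν = a.energy μ ν + b.energy μ ν := by
  rw [Op.energy_eq, Op.energy_eq, Op.energy_eq, Op.labels_merge, Finset.sum_union h]

/-- Words whose operators have disjoint nonempty sets of labels. -/
def Good (w : List (Op m n s)) : Prop :=
  w.Pairwise (fun a b => Disjoint a.labels b.labels) ∧ ∀ a ∈ w, a.labels.Nonempty

theorem Good.sublist {w w' : List (Op m n s)} (h : Good w) (hs : w'.Sublist w) : Good w' :=
  ⟨h.1.sublist hs, fun a ha => h.2 a (hs.subset ha)⟩

theorem Good.perm {w w' : List (Op m n s)} (h : Good w) (hs : w.Perm w') : Good w' :=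
  ⟨h.1.perm hs fun h => Disjoint.symm h, fun a ha => h.2 a (hs.symm.subset ha)⟩

theorem swap_perm {α : Type*} (u v : List α) (a b : α) :
    (u ++ a :: b :: v).Perm (u ++ b :: a :: v) :=
  (List.Perm.swap b a v).append_left u

theorem Good.swap {u v : List (Op m n s)} {a b : Op m n s} (h : Good (u ++ a :: b :: v)) :
    Good (u ++ b :: a :: v) := h.perm (swap_perm u v a b)

theorem Good.disjoint {u v : List (Op m n s)} {a b : Op m n s} (h : Good (u ++ a :: b :: v)) :
    Disjoint a.labels b.labels :=
  (List.pairwise_cons.1 (List.pairwise_append.1 h.1).2.1).1 b (by simp)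

theorem Good.merge {u v : List (Op m n s)} {a b : Op m n s} (h : Good (u ++ a :: b :: v)) :
    Good (u ++ a.merge b :: v) := by
  have h' := h.perm (List.perm_middle.trans (List.perm_middle.cons a))
  obtain ⟨h1, h2⟩ := h'
  rw [List.pairwise_cons, List.pairwise_cons] at h1
  refine Good.perm ?_ List.perm_middle.symm
  refine ⟨?_, ?_⟩
  · rw [List.pairwise_cons]
    refine ⟨fun c hc => ?_, h1.2.2⟩
    rw [Op.labels_merge, Finset.disjoint_union_left]
    exact ⟨h1.1 c (by simp only [List.mem_cons]; exact Or.inr hc), h1.2.1 c hc⟩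
  · intro c hc
    rw [List.mem_cons] at hc
    rcases hc with rfl | hc
    · rw [Op.labels_merge]
      exact (h2 a (by simp)).mono Finset.subset_union_left
    · exact h2 c (by simp only [List.mem_cons]; exact Or.inr (Or.inr hc))

theorem Good.notMem {u v : List (Op m n s)} {a b : Op m n s} (h : Good (u ++ a :: b :: v)) :
    a ∉ u := by
  intro ha
  have h1 := (List.pairwise_append.1 h.1).2.2 a ha a (by simp)
  exact (h.2 a (by simp)).ne_empty (disjoint_self.1 h1)

/-- The set of labels of a word. -/
def wordLabels (w : List (Op m n s)) : Finset (Fin m ⊕ Fin n ⊕ Fin s) :=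
  w.foldr (fun a S => a.labels ∪ S) ∅

theorem mem_wordLabels {w : List (Op m n s)} {x : Fin m ⊕ Fin n ⊕ Fin s} :
    x ∈ wordLabels w ↔ ∃ a ∈ w, x ∈ a.labels := by
  induction w with
  | nil => simp [wordLabels]
  | cons a w ih =>
    have : wordLabels (a :: w) = a.labels ∪ wordLabels w := rfl
    rw [this, mem_union, ih]
    simp

theorem Good.sum_labels {w : List (Op m n s)} (h : Good w) (f : Fin m ⊕ Fin n ⊕ Fin s → ℤ) :
    (w.map fun a => ∑ x ∈ a.labels, f x).sum = ∑ x ∈ wordLabels w, f x := by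
  induction w with
  | nil => simp [wordLabels]
  | cons a w ih =>
    have : wordLabels (a :: w) = a.labels ∪ wordLabels w := rfl
    rw [this, List.map_cons, List.sum_cons, ih (h.sublist (List.sublist_cons_self a w)),
      Finset.sum_union]
    rw [Finset.disjoint_left]
    intro x hx hx'
    rw [mem_wordLabels] at hx'
    obtain ⟨b, hb, hxb⟩ := hx'
    exact Finset.disjoint_left.1 ((List.pairwise_cons.1 h.1).1 b hb) hx hxb

/-- Each `ν j` is used at most once, as the label sets are disjoint. This is why `∑ j, ν j`
particles suffice: no state that arises has more energy than that. -/
theorem Good.neg_sum_energy_le {w : List (Op m n s)} (h : Good w) :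
    -(w.map fun a => a.energy μ ν).sum ≤ ((∑ j, ν j : ℕ) : ℤ) := by
  simp only [Op.energy_eq]
  rw [h.sum_labels, ← Finset.sum_neg_distrib]
  let g : Fin m ⊕ Fin n ⊕ Fin s → ℤ := Sum.elim (fun _ => 0) (Sum.elim (fun j => (ν j : ℤ))
    fun _ => 0)
  calc ∑ x ∈ wordLabels w, -labelEnergy μ ν x ≤ ∑ x ∈ wordLabels w, g x := by
        refine Finset.sum_le_sum fun x _ => ?_
        rcases x with i | j | k <;> simp [labelEnergy, g]
    _ ≤ ∑ x, g x := by
        refine Finset.sum_le_sum_of_subset_of_nonneg (Finset.subset_univ _) fun x _ _ => ?_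
        rcases x with i | j | k <;> simp [g]
    _ = _ := by simp [g]

end Labels

/-! ### The operators of the symbols -/

section Operators

variable {𝔽 : Type*} [Field 𝔽] {N m n s : ℕ} (μ : Fin m → ℕ) (ν : Fin n → ℕ) (q : Fin s → 𝔽)

/-- The vacuum expectation value of an operator of energy zero. -/
noncomputable def vacValue (a : Op m n s) : 𝔽 :=
  open Classical in
  if ∃ k, a = ⟨∅, ∅, {k}⟩ then 0 else
    if a.K = ∅ then 1 else ((∏ k ∈ a.K, q k) - (∏ k ∈ a.K, q k)⁻¹)⁻¹

/-- The factor of a commutator, where `ζ(e t)` is replaced by `e`. -/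
def commFactor (a b : Op m n s) : 𝔽 :=
  if a.K = ∅ ∧ b.K = ∅ ∧ a.energy μ ν + b.energy μ ν = 0 then (a.energy μ ν : 𝔽)
  else (∏ k ∈ b.K, q k) ^ a.energy μ ν * (∏ k ∈ a.K, q k) ^ (-b.energy μ ν) -
    (∏ k ∈ b.K, q k) ^ (-a.energy μ ν) * (∏ k ∈ a.K, q k) ^ b.energy μ ν

variable (N) in
/-- The operator of a symbol. -/
noncomputable def opAct (a : Op m n s) : Module.End 𝔽 ((Fin N → ℤ) → 𝔽) :=
  if a.energy μ ν = 0 then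
    if a.K = ∅ then 1 else hop 0 (∏ k ∈ a.K, q k) +
      (vacValue q a - ∑ v ∈ Ico (-(N : ℤ)) 0, (∏ k ∈ a.K, q k) ^ (2 * v + 1)) • 1
  else hop (a.energy μ ν) (∏ k ∈ a.K, q k)

theorem IsState.opAct {E : ℤ} {Φ : (Fin N → ℤ) → 𝔽} (h : IsState E Φ) (a : Op m n s) :
    IsState (E - a.energy μ ν) (opAct N μ ν q a Φ) := by
  unfold CompletedCycles.opAct
  split_ifs with h1 h2
  · rw [h1, sub_zero]
    exact h
  · rw [h1]
    have h3 := h.hop 0 (∏ k ∈ a.K, q k)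
    rw [LinearMap.add_apply, LinearMap.smul_apply, Module.End.one_apply]
    refine h3.add ?_
    rw [sub_zero]
    exact h.smul _
  · exact h.hop _ _

variable {μ ν q}

/-- Negative energy requires a label of `ν`. So the exceptional vacuum value `0` belongs only to the
initial cycle operators, and commutators always produce the value that the commutation relation
requires. -/
theorem merge_ne_single {a b : Op m n s} (hb : b.energy μ ν < 0) :
    ¬ ∃ k, a.merge b = ⟨∅, ∅, {k}⟩ := by
  rintro ⟨k, hk⟩
  have hJ := congrArg Op.J hk
  simp only [Op.merge, Finset.union_eq_empty] at hJ
  unfold Op.energy at hb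
  rw [hJ.2, Finset.sum_empty, sub_zero] at hb
  exact absurd hb (not_lt.2 (Finset.sum_nonneg fun i _ => by simp))

/-- Scalars commute, so only the relation of the hop operators matters. If the energies add up to
zero and `Q ≠ Q⁻¹` is the weight of the merged operator, the scalar `1 / (Q - Q⁻¹)` minus the sum
over the sea equals `Q^(-2N) / (Q - Q⁻¹)`; multiplied by `Q^e - Q^(-e)`, this is the geometric sum
that the floor causes. Without cycles the central term is the number `e` of its summands. -/
theorem opAct_commutator [CharZero 𝔽] (hq0 : ∀ k, q k ≠ 0)
    (hq : ∀ K : Finset (Fin s), K ≠ ∅ → ∏ k ∈ K, q k ≠ (∏ k ∈ K, q k)⁻¹)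
    {E : ℤ} {Φ : (Fin N → ℤ) → 𝔽} (h : IsState E Φ) {a b : Op m n s}
    (hab : Disjoint a.labels b.labels) (ha : 0 ≤ a.energy μ ν) (hb : b.energy μ ν < 0)
    (hE : E - b.energy μ ν ≤ N) :
    opAct N μ ν q a (opAct N μ ν q b Φ) = opAct N μ ν q b (opAct N μ ν q a Φ) +
      commFactor μ ν q a b • opAct N μ ν q (a.merge b) Φ := by
  have hK : ∏ k ∈ (a.merge b).K, q k = (∏ k ∈ a.K, q k) * ∏ k ∈ b.K, q k :=
    Finset.prod_union (Op.disjoint_K hab)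
  have hp : ∀ K : Finset (Fin s), ∏ k ∈ K, q k ≠ 0 := fun K =>
    Finset.prod_ne_zero_iff.2 fun k _ => hq0 k
  have hbo : opAct N μ ν q b = hop (b.energy μ ν) (∏ k ∈ b.K, q k) := by
    unfold opAct
    rw [if_neg (by omega)]
  -- This operator is the identity rather than a hop, so the hop relation is not used for it. Its
  -- commutator and the factor both vanish.
  by_cases ha0 : a.energy μ ν = 0 ∧ a.K = ∅
  · have h1 : opAct N μ ν q a = 1 := by
      unfold opAct
      rw [if_pos ha0.1, if_pos ha0.2]
    have h2 : commFactor μ ν q a b = 0 := by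
      unfold commFactor
      rw [if_neg (by rintro ⟨-, -, h⟩; omega), ha0.1, ha0.2]
      simp
    rw [h1, h2, zero_smul, add_zero]
    rfl
  have hao : ∃ c : 𝔽, opAct N μ ν q a = hop (a.energy μ ν) (∏ k ∈ a.K, q k) + c • 1 := by
    unfold opAct
    split_ifs with h1 h2
    · exact absurd ⟨h1, h2⟩ ha0
    · rw [h1]
      exact ⟨_, rfl⟩
    · exact ⟨0, by simp⟩
  obtain ⟨c, hc⟩ := hao
  have hcomm := hop_commutator h (hp a.K) (hp b.K) ha hb hE
  rw [hc, hbo]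
  simp only [LinearMap.add_apply, LinearMap.smul_apply, Module.End.one_apply, map_add, map_smul]
  rw [hcomm, add_right_comm]
  congr 1
  unfold opAct commFactor
  rw [Op.energy_merge μ ν hab, hK]
  by_cases h0 : a.energy μ ν + b.energy μ ν = 0
  swap
  · rw [if_neg h0, if_neg h0, if_neg (by tauto)]
    simp
  rw [if_pos h0, if_pos h0]
  have hKe : (a.merge b).K = ∅ ↔ a.K = ∅ ∧ b.K = ∅ := Finset.union_eq_empty
  by_cases hKK : a.K = ∅ ∧ b.K = ∅
  · rw [if_pos (hKe.2 hKK), if_pos ⟨hKK.1, hKK.2, h0⟩, hKK.1, hKK.2]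
    simp only [Finset.prod_empty, one_zpow, mul_one, sub_self, zero_smul, zero_add,
      Finset.sum_const, Int.card_Ico, nsmul_eq_mul, Module.End.one_apply]
    congr 1
    have : (-(N : ℤ) + a.energy μ ν - -N).toNat = a.energy μ ν := by omega
    exact_mod_cast congrArg (Int.cast (R := 𝔽)) this
  · rw [if_neg (mt hKe.1 hKK), if_neg (by tauto), LinearMap.add_apply, LinearMap.smul_apply,
      Module.End.one_apply, smul_add, smul_smul, h0]
    congr 2
    have hv : vacValue q (a.merge b) = (((∏ k ∈ a.K, q k) * ∏ k ∈ b.K, q k) -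
        ((∏ k ∈ a.K, q k) * ∏ k ∈ b.K, q k)⁻¹)⁻¹ := by
      unfold vacValue
      rw [if_neg (merge_ne_single hb), if_neg (mt hKe.1 hKK), hK]
    rw [hv]
    have hne := hq _ (mt hKe.1 hKK)
    rw [hK] at hne
    have hb' : b.energy μ ν = -a.energy μ ν := by omega
    rw [hb', neg_neg, ← mul_zpow, ← mul_zpow, mul_comm (∏ k ∈ b.K, q k)]
    have hQ0 : (∏ k ∈ a.K, q k) * ∏ k ∈ b.K, q k ≠ 0 := mul_ne_zero (hp _) (hp _)
    generalize (∏ k ∈ a.K, q k) * ∏ k ∈ b.K, q k = Q at hne hQ0 ⊢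
    generalize a.energy μ ν = e at ha ⊢
    have hne' : Q - Q⁻¹ ≠ 0 := sub_ne_zero.2 hne
    -- A telescoping sum, used twice: `k = f = e` gives the central term, and `k = N`, `f = 0` gives
    -- the sum over the whole sea.
    have geom : ∀ (k : ℕ) (f : ℤ), (∑ v ∈ Ico (-(N : ℤ)) (-N + k), Q ^ (2 * v + 1 - f)) *
        (Q - Q⁻¹) = Q ^ (2 * (-(N : ℤ) + k) - f) - Q ^ (2 * (-(N : ℤ)) - f) := by
      intro k f
      induction k with
      | zero => simp
      | succ k ih =>
        have : Ico (-(N : ℤ)) (-N + (k + 1 : ℕ)) =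
            insert (-(N : ℤ) + k) (Ico (-(N : ℤ)) (-N + k)) := by
          ext x
          simp only [mem_Ico, mem_insert]
          omega
        rw [this, Finset.sum_insert (by simp), add_mul, ih, mul_sub, ← zpow_add_one₀ hQ0,
          ← zpow_sub_one₀ hQ0]
        have e1 : 2 * (-(N : ℤ) + k) + 1 - f + 1 = 2 * (-(N : ℤ) + (k + 1 : ℕ)) - f := by
          push_cast
          ring
        have e2 : 2 * (-(N : ℤ) + k) + 1 - f - 1 = 2 * (-(N : ℤ) + k) - f := by ring
        rw [e1, e2]
        ring
    obtain ⟨k, rfl⟩ := Int.eq_ofNat_of_zero_le ha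
    have g1 := geom k k
    have g2 := geom N 0
    simp only [sub_zero, neg_add_cancel, mul_zero, zpow_zero] at g2
    apply mul_right_cancel₀ hne'
    have g3 : ((Q - Q⁻¹)⁻¹ - ∑ v ∈ Ico (-(N : ℤ)) 0, Q ^ (2 * v + 1)) * (Q - Q⁻¹) =
        Q ^ (2 * -(N : ℤ)) := by
      rw [sub_mul, inv_mul_cancel₀ hne', g2, sub_sub_cancel]
    rw [g1, mul_assoc, g3]
    have e1 : 2 * (-(N : ℤ) + k) - k = k + 2 * -(N : ℤ) := by ring
    have e2 : 2 * (-(N : ℤ)) - k = -k + 2 * -(N : ℤ) := by ring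
    rw [e1, e2, zpow_add₀ hQ0, zpow_add₀ hQ0]
    ring

end Operators

/-! ### Vacuum expectation values of words -/

section Vev

variable {𝔽 : Type*} [Field 𝔽] {N m n s : ℕ} (μ : Fin m → ℕ) (ν : Fin n → ℕ) (q : Fin s → 𝔽)

theorem sum_comp_vac (f : ℤ → 𝔽) : ∑ i, f (vac (N := N) i) = ∑ x ∈ Ico (-(N : ℤ)) 0, f x := by
  refine Finset.sum_bij (fun i _ => vac i) ?_ ?_ ?_ fun _ _ => rfl
  · intro i _
    have := i.2
    rw [mem_Ico, vac]
    omega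
  · exact fun i _ j _ h => vac_injective h
  · intro x hx
    rw [mem_Ico] at hx
    refine ⟨⟨(-x - 1).toNat, by omega⟩, mem_univ _, ?_⟩
    simp only [vac]
    omega

theorem hop_zero_vacuum (p : 𝔽) :
    hop 0 p (vacuum 𝔽 N) = (∑ v ∈ Ico (-(N : ℤ)) 0, p ^ (2 * v + 1)) • vacuum 𝔽 N := by
  ext κ
  rw [Pi.smul_apply, smul_eq_mul]
  by_cases h0 : vacuum 𝔽 N κ = 0
  · rw [h0, mul_zero]
    change (if _ then _ else _) = _
    simp [h0]
  obtain ⟨σ, -, hσ⟩ := Finset.exists_ne_zero_of_sum_ne_zero h0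
  have hκ : κ = vac ∘ σ := by
    by_contra h
    exact hσ (if_neg h)
  rw [hop_apply]
  · simp only [Pi.single_zero, add_zero, ← Finset.sum_mul]
    congr 1
    rw [← sum_comp_vac, hκ]
    exact Equiv.sum_comp σ fun i => p ^ (2 * vac i + 1)
  · intro i
    have := (σ i).2
    rw [hκ, Function.comp_apply, vac]
    omega

/-- The sum subtracted in `opAct` is the eigenvalue of `hop 0` on the vacuum, so that only
`vacValue` is left. -/
theorem opAct_vacuum {a : Op m n s} (ha : a.energy μ ν = 0) :
    opAct N μ ν q a (vacuum 𝔽 N) = vacValue q a • vacuum 𝔽 N := by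
  unfold opAct
  rw [if_pos ha]
  split_ifs with hK
  · rw [vacValue, if_neg, if_pos hK, one_smul]
    · rfl
    · rintro ⟨k, rfl⟩
      simp at hK
  · rw [LinearMap.add_apply, LinearMap.smul_apply, Module.End.one_apply, hop_zero_vacuum,
      ← add_smul, add_sub_cancel]

variable (N) in
/-- The operator of a word. -/
noncomputable def wordAct (w : List (Op m n s)) : Module.End 𝔽 ((Fin N → ℤ) → 𝔽) :=
  (w.map (opAct N μ ν q)).prod

theorem wordAct_append (u v : List (Op m n s)) (Φ : (Fin N → ℤ) → 𝔽) :
    wordAct N μ ν q (u ++ v) Φ = wordAct N μ ν q u (wordAct N μ ν q v Φ) := by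
  rw [wordAct, List.map_append, List.prod_append]
  rfl

theorem wordAct_cons (a : Op m n s) (v : List (Op m n s)) (Φ : (Fin N → ℤ) → 𝔽) :
    wordAct N μ ν q (a :: v) Φ = opAct N μ ν q a (wordAct N μ ν q v Φ) := by
  rw [wordAct, List.map_cons, List.prod_cons]
  rfl

theorem IsState.wordAct {E : ℤ} {Φ : (Fin N → ℤ) → 𝔽} (h : IsState E Φ) (w : List (Op m n s)) :
    IsState (E - (w.map fun a => a.energy μ ν).sum) (wordAct N μ ν q w Φ) := by
  induction w with
  | nil => simpa [CompletedCycles.wordAct] using h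
  | cons a w ih =>
    rw [wordAct_cons, List.map_cons, List.sum_cons]
    convert ih.opAct μ ν q a using 1
    ring

/-- The vacuum expectation value of a word. -/
noncomputable def vev (w : List (Op m n s)) : 𝔽 :=
  wordAct (∑ j, ν j) μ ν q w (vacuum 𝔽 _) vac

variable {μ ν q}

/-- The operators of `v` produce a state of energy `E`, and `E` minus the energy of `b` is minus the
total energy of `b :: v`. That is at most the number of particles by `Good.neg_sum_energy_le`, as
the commutation relation requires. -/
theorem vev_step [CharZero 𝔽] (hq0 : ∀ k, q k ≠ 0)
    (hq : ∀ K : Finset (Fin s), K ≠ ∅ → ∏ k ∈ K, q k ≠ (∏ k ∈ K, q k)⁻¹)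
    {u v : List (Op m n s)} {a b : Op m n s} (h : Good (u ++ a :: b :: v))
    (ha : 0 ≤ a.energy μ ν) (hb : b.energy μ ν < 0) :
    vev μ ν q (u ++ a :: b :: v) = vev μ ν q (u ++ b :: a :: v) +
      commFactor μ ν q a b * vev μ ν q (u ++ a.merge b :: v) := by
  have hbv : Good (b :: v) := h.sublist
    ((List.sublist_cons_self a _).trans (List.sublist_append_right u _))
  have hE := hbv.neg_sum_energy_le μ ν
  rw [List.map_cons, List.sum_cons] at hE
  have hs := (vacuum_isState (𝔽 := 𝔽) (N := ∑ j, ν j)).wordAct μ ν q v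
  have := opAct_commutator hq0 hq hs h.disjoint ha hb (by omega)
  unfold vev
  rw [wordAct_append, wordAct_append, wordAct_append, wordAct_cons, wordAct_cons, wordAct_cons,
    wordAct_cons, wordAct_cons, this, map_add, map_smul]
  rfl

/-- A nonzero total energy kills the value at the vacuum. If the total is zero, then `v` has
positive energy and already annihilates the vacuum. -/
theorem vev_eq_zero_of_head_neg [CharZero 𝔽] {v : List (Op m n s)} {b : Op m n s}
    (hb : b.energy μ ν < 0) : vev μ ν q (b :: v) = 0 := by
  have hs := (vacuum_isState (𝔽 := 𝔽) (N := ∑ j, ν j)).wordAct μ ν q v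
  have hs' := hs.opAct μ ν q b
  unfold vev
  rw [wordAct_cons]
  by_cases h0 : (v.map fun a => a.energy μ ν).sum + b.energy μ ν = 0
  · rw [hs.eq_zero_of_neg (by omega), map_zero]
    rfl
  · exact hs'.deg _ (by omega)

theorem vev_eq_zero_of_nonneg [CharZero 𝔽] {w : List (Op m n s)}
    (h : ∀ a ∈ w, 0 ≤ a.energy μ ν) (h' : ¬ ∀ a ∈ w, a.energy μ ν = 0) : vev μ ν q w = 0 := by
  have hs := (vacuum_isState (𝔽 := 𝔽) (N := ∑ j, ν j)).wordAct μ ν q w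
  unfold vev
  rw [hs.eq_zero_of_neg, Pi.zero_apply]
  push Not at h'
  obtain ⟨a, ha, h0⟩ := h'
  have := List.single_le_sum (l := w.map fun a => a.energy μ ν) (by simpa using h) _
    (List.mem_map_of_mem ha)
  have := h a ha
  omega

theorem vev_of_energy_eq_zero {w : List (Op m n s)} (h : ∀ a ∈ w, a.energy μ ν = 0) :
    vev μ ν q w = (w.map (vacValue q)).prod := by
  have key : wordAct (∑ j, ν j) μ ν q w (vacuum 𝔽 _) =
      (w.map (vacValue q)).prod • vacuum 𝔽 (∑ j, ν j) := by
    induction w with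
    | nil => simp [wordAct]
    | cons a w ih =>
      rw [wordAct_cons, ih fun c hc => h c (List.mem_cons_of_mem a hc), map_smul,
        opAct_vacuum μ ν q (h a List.mem_cons_self), smul_smul, List.map_cons, List.prod_cons,
        mul_comm]
  rw [vev, key, Pi.smul_apply, vacuum_vac, smul_eq_mul, mul_one]

end Vev

/-! ### Runs of the algorithm -/

section Runs

variable {m n s : ℕ} {μ : Fin m → ℕ} {ν : Fin n → ℕ}

theorem nonneg_or_exists_neg {α : Type*} (e : α → ℤ) (w : List α) :
    (∀ a ∈ w, 0 ≤ e a) ∨ ∃ u b v, w = u ++ b :: v ∧ (∀ c ∈ u, 0 ≤ e c) ∧ e b < 0 := by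
  induction w with
  | nil => simp
  | cons a w ih =>
    by_cases ha : 0 ≤ e a
    · rcases ih with ih | ⟨u, b, v, rfl, hu, hb⟩
      · left
        simpa [ha] using ih
      · refine Or.inr ⟨a :: u, b, v, rfl, ?_, hb⟩
        simpa [ha] using hu
    · exact Or.inr ⟨[], a, w, rfl, by simp, not_le.1 ha⟩

theorem first_neg_unique {α : Type*} {e : α → ℤ} {u u' v v' : List α} {b b' : α}
    (h : u ++ b :: v = u' ++ b' :: v') (hu : ∀ c ∈ u, 0 ≤ e c) (hb : e b < 0)
    (hu' : ∀ c ∈ u', 0 ≤ e c) (hb' : e b' < 0) : u = u' ∧ b = b' ∧ v = v' := by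
  induction u generalizing u' with
  | nil =>
    cases u' with
    | nil => simpa using h
    | cons c u' =>
      rw [List.nil_append, List.cons_append, List.cons_eq_cons] at h
      have := hu' c List.mem_cons_self
      rw [h.1] at hb
      omega
  | cons c u ih =>
    cases u' with
    | nil =>
      rw [List.nil_append, List.cons_append, List.cons_eq_cons] at h
      have := hu c List.mem_cons_self
      rw [h.1] at this
      omega
    | cons c' u' =>
      rw [List.cons_append, List.cons_append, List.cons_eq_cons] at h
      have := ih h.2 (fun x hx => hu x (List.mem_cons_of_mem c hx))
        (fun x hx => hu' x (List.mem_cons_of_mem c' hx))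
      exact ⟨by rw [h.1, this.1], this.2⟩

theorem first_pair_unique {α : Type*} {e : α → ℤ} {u u' v v' : List α} {a a' b b' : α}
    (h : u ++ a :: b :: v = u' ++ a' :: b' :: v') (hu : ∀ c ∈ u, 0 ≤ e c) (ha : 0 ≤ e a)
    (hb : e b < 0) (hu' : ∀ c ∈ u', 0 ≤ e c) (ha' : 0 ≤ e a') (hb' : e b' < 0) :
    u = u' ∧ a = a' ∧ b = b' ∧ v = v' := by
  have h2 : (u ++ [a]) ++ b :: v = (u' ++ [a']) ++ b' :: v' := by simpa using h
  obtain ⟨h3, h4, h5⟩ := first_neg_unique (e := e) h2 (by simpa [or_imp, forall_and] using ⟨hu, ha⟩)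
    hb (by simpa [or_imp, forall_and] using ⟨hu', ha'⟩) hb'
  rw [List.append_singleton_inj] at h3
  exact ⟨h3.1, h3.2, h4, h5⟩

/-- Induction along the algorithm. -/
theorem word_induction {motive : List (Op m n s) → Prop}
    (nonneg : ∀ w, (∀ a ∈ w, 0 ≤ a.energy μ ν) → motive w)
    (dead : ∀ b v, b.energy μ ν < 0 → motive (b :: v))
    (step : ∀ u v a b, (∀ c ∈ u, 0 ≤ c.energy μ ν) → 0 ≤ a.energy μ ν → b.energy μ ν < 0 →
      motive (u ++ b :: a :: v) → motive (u ++ a.merge b :: v) → motive (u ++ a :: b :: v))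
    (w : List (Op m n s)) : motive w := by
  -- A commutator shortens the word. Passing keeps its length but shortens the prefix `u` before the
  -- first operator of negative energy, which is what the inner induction uses.
  induction hl : w.length using Nat.strong_induction_on generalizing w with
  | _ l ih =>
    rcases nonneg_or_exists_neg (fun a : Op m n s => a.energy μ ν) w with h | ⟨u, b, v, rfl, hu, hb⟩
    · exact nonneg w h
    · induction u using List.reverseRecOn generalizing v with
      | nil => exact dead b v hb
      | append_singleton u a ihu =>
        rw [List.append_assoc, List.singleton_append]
        have hu' : ∀ c ∈ u, 0 ≤ c.energy μ ν := fun c hc => hu c (List.mem_append_left _ hc)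
        refine step u v a b hu' (hu a (by simp)) hb ?_ ?_
        · refine ihu (a :: v) ?_ hu'
          rw [← hl]
          simp
        · refine ih _ ?_ _ rfl
          rw [← hl]
          simp

theorem run_of_nonneg {w w' : List (Op m n s)} {P : List (Op m n s × Op m n s)}
    (hw : ∀ a ∈ w, 0 ≤ a.energy μ ν) (h : Run μ ν w P w') :
    (∀ a ∈ w, a.energy μ ν = 0) ∧ P = [] ∧ w' = w := by
  cases h with
  | done w h => exact ⟨h, rfl, rfl⟩
  | pass u v a b P w' hu ha hb h =>
    have := hw b (by simp)
    omega
  | commutator u v a b P w' hu ha hb h =>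
    have := hw b (by simp)
    omega

theorem not_run_of_head_neg {v w' : List (Op m n s)} {b : Op m n s}
    {P : List (Op m n s × Op m n s)} (hb : b.energy μ ν < 0) : ¬ Run μ ν (b :: v) P w' := by
  have key : ∀ u' v' : List (Op m n s), ∀ a' b' : Op m n s, b :: v = u' ++ a' :: b' :: v' →
      (∀ c ∈ u', 0 ≤ c.energy μ ν) → ¬ 0 ≤ a'.energy μ ν := by
    intro u' v' a' b' h hu' ha'
    cases u' with
    | nil =>
      rw [List.nil_append, List.cons_eq_cons] at h
      rw [← h.1] at ha'
      omega
    | cons c u' =>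
      rw [List.cons_append, List.cons_eq_cons] at h
      have := hu' c List.mem_cons_self
      rw [← h.1] at this
      omega
  intro h
  generalize hw : b :: v = w at h
  cases h with
  | done w h =>
    have := h b (by simp [← hw])
    omega
  | pass u v a b P w' hu ha hb h => exact key _ _ _ _ hw hu ha
  | commutator u v a b P w' hu ha hb h => exact key _ _ _ _ hw hu ha

theorem run_step {u v w' : List (Op m n s)} {a b : Op m n s} {P : List (Op m n s × Op m n s)}
    (hu : ∀ c ∈ u, 0 ≤ c.energy μ ν) (ha : 0 ≤ a.energy μ ν) (hb : b.energy μ ν < 0) :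
    Run μ ν (u ++ a :: b :: v) P w' ↔ Run μ ν (u ++ b :: a :: v) P w' ∨
      ∃ P', P = (a, b) :: P' ∧ Run μ ν (u ++ a.merge b :: v) P' w' := by
  constructor
  · intro h
    generalize hw : u ++ a :: b :: v = w at h
    cases h with
    | done w h =>
      have := h b (by simp [← hw])
      omega
    | pass u' v' a' b' P w' hu' ha' hb' h =>
      obtain ⟨rfl, rfl, rfl, rfl⟩ :=
        first_pair_unique (e := fun c : Op m n s => c.energy μ ν) hw hu ha hb hu' ha' hb'
      exact Or.inl h
    | commutator u' v' a' b' P w' hu' ha' hb' h =>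
      obtain ⟨rfl, rfl, rfl, rfl⟩ :=
        first_pair_unique (e := fun c : Op m n s => c.energy μ ν) hw hu ha hb hu' ha' hb'
      exact Or.inr ⟨P, rfl, h⟩
  · rintro (h | ⟨P', rfl, h⟩)
    · exact .pass u v a b P w' hu ha hb h
    · exact .commutator u v a b P' w' hu ha hb h

/-- The operator `b` remains the leftmost one of negative energy while it passes, so the first
commutator involves it and an operator that stood to its left. A run in which `b` reaches the front
is discarded. -/
theorem run_head {u v w' : List (Op m n s)} {b : Op m n s} {P : List (Op m n s × Op m n s)}
    (hu : ∀ c ∈ u, 0 ≤ c.energy μ ν) (hb : b.energy μ ν < 0) (h : Run μ ν (u ++ b :: v) P w') :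
    ∃ c ∈ u, ∃ P', P = (c, b) :: P' := by
  induction u using List.reverseRecOn generalizing v with
  | nil => exact absurd h (not_run_of_head_neg hb)
  | append_singleton u a ih =>
    have hu' : ∀ c ∈ u, 0 ≤ c.energy μ ν := fun c hc => hu c (List.mem_append_left _ hc)
    rw [List.append_assoc, List.singleton_append, run_step hu' (hu a (by simp)) hb] at h
    rcases h with h | ⟨P', rfl, -⟩
    · obtain ⟨c, hc, h⟩ := ih hu' h
      exact ⟨c, List.mem_append_left _ hc, h⟩
    · exact ⟨a, by simp, P', rfl⟩

variable (μ ν) in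
/-- The sequences of commutators of the complete runs that end with a single operator which is
not one of the `𝓔(∅, ∅, {k})`. -/
def patterns (w : List (Op m n s)) : Set (List (Op m n s × Op m n s)) :=
  {P | ∃ w', Run μ ν w P w' ∧ w'.length = 1 ∧ ∀ k : Fin s, (⟨∅, ∅, {k}⟩ : Op m n s) ∉ w'}

theorem patterns_step {u v : List (Op m n s)} {a b : Op m n s}
    (hu : ∀ c ∈ u, 0 ≤ c.energy μ ν) (ha : 0 ≤ a.energy μ ν) (hb : b.energy μ ν < 0) :
    patterns μ ν (u ++ a :: b :: v) = patterns μ ν (u ++ b :: a :: v) ∪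
      List.cons (a, b) '' patterns μ ν (u ++ a.merge b :: v) := by
  ext P
  simp only [patterns, Set.mem_ofPred_eq, Set.mem_union, Set.mem_image, run_step hu ha hb]
  constructor
  · rintro ⟨w', h | ⟨P', rfl, h⟩, h'⟩
    · exact Or.inl ⟨w', h, h'⟩
    · exact Or.inr ⟨P', ⟨w', h, h'⟩, rfl⟩
  · rintro (⟨w', h, h'⟩ | ⟨P', ⟨w', h, h'⟩, rfl⟩)
    · exact ⟨w', Or.inl h, h'⟩
    · exact ⟨w', Or.inr ⟨P', rfl, h⟩, h'⟩

theorem patterns_of_head_neg {v : List (Op m n s)} {b : Op m n s} (hb : b.energy μ ν < 0) :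
    patterns μ ν (b :: v) = ∅ :=
  Set.eq_empty_of_forall_notMem fun _ ⟨_, h, _⟩ => not_run_of_head_neg hb h

theorem patterns_of_nonneg {w : List (Op m n s)} (hw : ∀ a ∈ w, 0 ≤ a.energy μ ν) :
    patterns μ ν w ⊆ {[]} := by
  rintro P ⟨w', h, -⟩
  exact (run_of_nonneg hw h).2.1

theorem patterns_finite (w : List (Op m n s)) : (patterns μ ν w).Finite := by
  induction w using word_induction (μ := μ) (ν := ν) with
  | nonneg w hw => exact (Set.finite_singleton _).subset (patterns_of_nonneg hw)
  | dead b v hb => simp [patterns_of_head_neg hb]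
  | step u v a b hu ha hb h1 h2 =>
    rw [patterns_step hu ha hb]
    exact h1.union (h2.image _)

/-- If `b` passes `a`, its first partner comes from `u`, and `a` is not in `u` because label sets
are disjoint and nonempty. So the recorded commutators determine the choices, and sums over patterns
satisfy the recursion of the algorithm. -/
theorem patterns_disjoint {u v : List (Op m n s)} {a b : Op m n s}
    (h : Good (u ++ a :: b :: v)) (hu : ∀ c ∈ u, 0 ≤ c.energy μ ν) (hb : b.energy μ ν < 0) :
    Disjoint (patterns μ ν (u ++ b :: a :: v))
      (List.cons (a, b) '' patterns μ ν (u ++ a.merge b :: v)) := by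
  rw [Set.disjoint_left]
  rintro P ⟨w', hr, -⟩ ⟨P', -, rfl⟩
  obtain ⟨c, hc, P'', he⟩ := run_head hu hb hr
  rw [List.cons_eq_cons, Prod.mk.injEq] at he
  rw [← he.1.1] at hc
  exact h.notMem hc

variable {𝔽 : Type*} [Field 𝔽] (q : Fin s → 𝔽)

variable (μ ν) in
/-- The product of the factors of a sequence of commutators. -/
def factorProd (P : List (Op m n s × Op m n s)) : 𝔽 :=
  (P.map fun c => commFactor μ ν q c.1 c.2).prod

variable (μ ν) in
/-- The sum over the connected patterns that start with `w`. -/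
noncomputable def patternSum (w : List (Op m n s)) : 𝔽 :=
  ∑ᶠ P ∈ patterns μ ν w, factorProd μ ν q P

theorem patternSum_step {u v : List (Op m n s)} {a b : Op m n s} (h : Good (u ++ a :: b :: v))
    (hu : ∀ c ∈ u, 0 ≤ c.energy μ ν) (ha : 0 ≤ a.energy μ ν) (hb : b.energy μ ν < 0) :
    patternSum μ ν q (u ++ a :: b :: v) = patternSum μ ν q (u ++ b :: a :: v) +
      commFactor μ ν q a b * patternSum μ ν q (u ++ a.merge b :: v) := by
  unfold patternSum
  rw [patterns_step hu ha hb, finsum_mem_union (patterns_disjoint h hu hb) (patterns_finite _)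
    ((patterns_finite _).image _), finsum_mem_image (List.cons_injective.injOn)]
  congr 1
  exact (mul_finsum_mem (factorProd μ ν q) (commFactor μ ν q a b)).symm

theorem patternSum_of_head_neg {v : List (Op m n s)} {b : Op m n s} (hb : b.energy μ ν < 0) :
    patternSum μ ν q (b :: v) = 0 := by
  rw [patternSum, patterns_of_head_neg hb, finsum_mem_empty]

theorem patternSum_of_nonneg {w : List (Op m n s)} (hw : ∀ a ∈ w, 0 ≤ a.energy μ ν)
    (h : ¬ ((∀ a ∈ w, a.energy μ ν = 0) ∧ w.length = 1 ∧
      ∀ k : Fin s, (⟨∅, ∅, {k}⟩ : Op m n s) ∉ w)) : patternSum μ ν q w = 0 := by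
  have : patterns μ ν w = ∅ := by
    refine Set.eq_empty_of_forall_notMem fun P hP => ?_
    obtain ⟨w', hr, h1⟩ := hP
    obtain ⟨h2, -, rfl⟩ := run_of_nonneg hw hr
    exact h ⟨h2, h1⟩
  rw [patternSum, this, finsum_mem_empty]

theorem patternSum_singleton {a : Op m n s} (ha : a.energy μ ν = 0)
    (h : ∀ k : Fin s, a ≠ ⟨∅, ∅, {k}⟩) : patternSum μ ν q [a] = 1 := by
  have : patterns μ ν [a] = {[]} := by
    refine (patterns_of_nonneg (by simp [ha])).antisymm ?_
    rw [Set.singleton_subset_iff]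
    exact ⟨[a], .done _ (by simp [ha]), rfl, by simpa using fun k h' => h k h'.symm⟩
  rw [patternSum, this, finsum_mem_singleton]
  rfl

/-- The values `1 / ζ(z_K)`, with `1` for `K = ∅`. -/
noncomputable def invZeta (K : Finset (Fin s)) : 𝔽 :=
  if K = ∅ then 1 else ((∏ k ∈ K, q k) - (∏ k ∈ K, q k)⁻¹)⁻¹

/-- The labels of the completed cycles in a word. -/
def wordCycles (w : List (Op m n s)) : Finset (Fin s) :=
  univ.filter fun k : Fin s => Sum.inr (Sum.inr k) ∈ wordLabels w

variable (μ ν) in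
/-- The connected part of the vacuum expectation value of a word. -/
noncomputable def connectedVev (w : List (Op m n s)) : 𝔽 :=
  patternSum μ ν q w * invZeta q (wordCycles w)

theorem wordLabels_perm {w w' : List (Op m n s)} (h : w.Perm w') :
    wordLabels w = wordLabels w' := by
  ext x
  simp only [mem_wordLabels, h.mem_iff]

theorem wordLabels_merge (u v : List (Op m n s)) (a b : Op m n s) :
    wordLabels (u ++ a.merge b :: v) = wordLabels (u ++ a :: b :: v) := by
  ext x
  simp only [mem_wordLabels, List.mem_append, List.mem_cons, or_and_right, exists_or,
    exists_eq_left, Op.labels_merge, mem_union, or_assoc]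

theorem connectedVev_step {u v : List (Op m n s)} {a b : Op m n s} (h : Good (u ++ a :: b :: v))
    (hu : ∀ c ∈ u, 0 ≤ c.energy μ ν) (ha : 0 ≤ a.energy μ ν) (hb : b.energy μ ν < 0) :
    connectedVev μ ν q (u ++ a :: b :: v) = connectedVev μ ν q (u ++ b :: a :: v) +
      commFactor μ ν q a b * connectedVev μ ν q (u ++ a.merge b :: v) := by
  simp only [connectedVev, wordCycles, patternSum_step q h hu ha hb, wordLabels_merge,
    wordLabels_perm (swap_perm u v a b)]
  ring

theorem connectedVev_singleton {a : Op m n s} (ha : a.energy μ ν = 0) :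
    connectedVev μ ν q [a] = vacValue q a := by
  have hK : wordCycles [a] = a.K := by
    ext k
    simp [wordCycles, mem_wordLabels, Op.mem_labels_inr_inr]
  unfold connectedVev vacValue
  rw [hK]
  split_ifs with h h'
  · obtain ⟨k, rfl⟩ := h
    rw [patternSum_of_nonneg q (by simp [ha]), zero_mul]
    rintro ⟨-, -, h⟩
    exact h k (by simp)
  · rw [patternSum_singleton q ha (by simpa using h), invZeta, if_pos h', one_mul]
  · rw [patternSum_singleton q ha (by simpa using h), invZeta, if_neg h', one_mul]

end Runs

/-! ### Decomposition of vacuum expectation values into connected ones -/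

section Splitting

variable {m n s : ℕ}

/-- The operators of a word whose labels lie in `A`. -/
def inside (A : Finset (Fin m ⊕ Fin n ⊕ Fin s)) (w : List (Op m n s)) : List (Op m n s) :=
  w.filter fun c => c.labels ⊆ A

/-- The operators of a word whose labels do not lie in `A`. -/
def outside (A : Finset (Fin m ⊕ Fin n ⊕ Fin s)) (w : List (Op m n s)) : List (Op m n s) :=
  w.filter fun c => ¬ c.labels ⊆ A

theorem mem_inside {A : Finset (Fin m ⊕ Fin n ⊕ Fin s)} {w : List (Op m n s)} {c : Op m n s} :
    c ∈ inside A w ↔ c ∈ w ∧ c.labels ⊆ A := by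
  simp [inside]

theorem mem_outside {A : Finset (Fin m ⊕ Fin n ⊕ Fin s)} {w : List (Op m n s)} {c : Op m n s} :
    c ∈ outside A w ↔ c ∈ w ∧ ¬ c.labels ⊆ A := by
  simp [outside]

theorem Good.inside {w : List (Op m n s)} (h : Good w) (A : Finset (Fin m ⊕ Fin n ⊕ Fin s)) :
    Good (inside A w) := h.sublist List.filter_sublist

theorem Good.outside {w : List (Op m n s)} (h : Good w) (A : Finset (Fin m ⊕ Fin n ⊕ Fin s)) :
    Good (outside A w) := h.sublist List.filter_sublist

theorem Good.nodup {w : List (Op m n s)} (h : Good w) : w.Nodup := by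
  rw [List.nodup_iff_pairwise_ne]
  refine h.1.imp_of_mem ?_
  rintro a b ha - hab rfl
  exact (h.2 a ha).ne_empty (disjoint_self.1 hab)

theorem Good.disjoint_of_ne {w : List (Op m n s)} (h : Good w) {a b : Op m n s} (ha : a ∈ w)
    (hb : b ∈ w) (hab : a ≠ b) : Disjoint a.labels b.labels :=
  haveI : Std.Symm fun a b : Op m n s => Disjoint a.labels b.labels := ⟨fun _ _ h => h.symm⟩
  h.1.forall ha hb hab

theorem Good.eq_of_mem {w : List (Op m n s)} (h : Good w) {a b : Op m n s} (ha : a ∈ w)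
    (hb : b ∈ w) {x : Fin m ⊕ Fin n ⊕ Fin s} (hxa : x ∈ a.labels) (hxb : x ∈ b.labels) :
    a = b := by
  by_contra hab
  exact Finset.disjoint_left.1 (h.disjoint_of_ne ha hb hab) hxa hxb

/-- `A` is a union of label sets of operators of `w`, as far as labels in `w` are concerned. -/
def Saturated (A : Finset (Fin m ⊕ Fin n ⊕ Fin s)) (w : List (Op m n s)) : Prop :=
  ∀ c ∈ w, c.labels ⊆ A ∨ Disjoint c.labels A

open Classical in
/-- The term of the decomposition. -/
noncomputable def splitTerm {𝔽 : Type*} [Field 𝔽] (F G : List (Op m n s) → 𝔽)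
    (w : List (Op m n s)) (A : Finset (Fin m ⊕ Fin n ⊕ Fin s)) : 𝔽 :=
  if Saturated A w then G (inside A w) * F (outside A w) else 0

variable {𝔽 : Type*} [Field 𝔽] (μ : Fin m → ℕ) (ν : Fin n → ℕ)
  (cf : Op m n s → Op m n s → 𝔽)

/-- A function of words that can be evaluated by the commutation algorithm. -/
structure IsExpectation (F : List (Op m n s) → 𝔽) : Prop where
  step : ∀ {u v : List (Op m n s)} {a b : Op m n s}, Good (u ++ a :: b :: v) →
    (∀ c ∈ u, 0 ≤ c.energy μ ν) → 0 ≤ a.energy μ ν → b.energy μ ν < 0 →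
    F (u ++ a :: b :: v) = F (u ++ b :: a :: v) + cf a b * F (u ++ a.merge b :: v)
  dead : ∀ {v : List (Op m n s)} {b : Op m n s}, b.energy μ ν < 0 → F (b :: v) = 0
  nonneg : ∀ {w : List (Op m n s)}, (∀ a ∈ w, 0 ≤ a.energy μ ν) →
    (¬ ∀ a ∈ w, a.energy μ ν = 0) → F w = 0

variable {μ ν cf}

/-- If `a` and `b` lie on the same side of `A`, the recursion applies to `G` or to `F`, and the
other factor does not change. If `A` separates them, their order is invisible in both subwords, and
`A` is not saturated for the merged word. -/
theorem splitTerm_step {F G : List (Op m n s) → 𝔽} (hF : IsExpectation μ ν cf F)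
    (hG : IsExpectation μ ν cf G) {u v : List (Op m n s)} {a b : Op m n s}
    (h : Good (u ++ a :: b :: v)) (hu : ∀ c ∈ u, 0 ≤ c.energy μ ν) (ha : 0 ≤ a.energy μ ν)
    (hb : b.energy μ ν < 0) (A : Finset (Fin m ⊕ Fin n ⊕ Fin s)) :
    splitTerm F G (u ++ a :: b :: v) A = splitTerm F G (u ++ b :: a :: v) A +
      cf a b * splitTerm F G (u ++ a.merge b :: v) A := by
  have hsat : Saturated A (u ++ b :: a :: v) ↔ Saturated A (u ++ a :: b :: v) := by
    simp only [Saturated, (swap_perm u v a b).mem_iff]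
  have hab := h.disjoint
  have hane := h.2 a (by simp)
  have hbne := h.2 b (by simp)
  have hi := h.inside A
  have ho := h.outside A
  unfold splitTerm
  rw [hsat]
  by_cases hs : Saturated A (u ++ a :: b :: v)
  swap
  · have : ¬ Saturated A (u ++ a.merge b :: v) := by
      refine fun hs' => hs fun c hc => ?_
      simp only [List.mem_append, List.mem_cons] at hc
      have hm := hs' (a.merge b) (by simp)
      rw [Op.labels_merge, Finset.union_subset_iff, Finset.disjoint_union_left] at hm
      rcases hc with hc | rfl | rfl | hc
      · exact hs' c (by simp [hc])
      · exact hm.imp And.left And.left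
      · exact hm.imp And.right And.right
      · exact hs' c (by simp [hc])
    rw [if_neg hs, if_neg hs, if_neg this, mul_zero, add_zero]
  rw [if_pos hs, if_pos hs]
  have hrest : ∀ c ∈ u ++ v, c.labels ⊆ A ∨ Disjoint c.labels A := fun c hc => hs c (by
    simp only [List.mem_append, List.mem_cons] at hc ⊢
    tauto)
  have hsm : Saturated A (u ++ a.merge b :: v) ↔
      ((a.merge b).labels ⊆ A ∨ Disjoint (a.merge b).labels A) := by
    refine ⟨fun h' => h' _ (by simp), fun h' c hc => ?_⟩
    simp only [List.mem_append, List.mem_cons] at hc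
    rcases hc with hc | rfl | hc
    · exact hrest c (by simp [hc])
    · exact h'
    · exact hrest c (by simp [hc])
  rw [Op.labels_merge, Finset.union_subset_iff, Finset.disjoint_union_left] at hsm
  have hdisj : ∀ c : Op m n s, c.labels.Nonempty → Disjoint c.labels A → ¬ c.labels ⊆ A :=
    fun c hc h1 h2 => hc.ne_empty (Finset.disjoint_self_iff_empty _ |>.1 (h1.mono_right h2))
  have hui : ∀ c ∈ inside A u, 0 ≤ c.energy μ ν := fun c hc => hu c (mem_inside.1 hc).1
  have huo : ∀ c ∈ outside A u, 0 ≤ c.energy μ ν := fun c hc => hu c (mem_outside.1 hc).1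
  have hml : (a.merge b).labels ⊆ A ↔ a.labels ⊆ A ∧ b.labels ⊆ A := by
    rw [Op.labels_merge, Finset.union_subset_iff]
  rcases hs a (by simp) with h1 | h1 <;> rcases hs b (by simp) with h2 | h2
  · rw [if_pos (hsm.2 (Or.inl ⟨h1, h2⟩))]
    have e1 : inside A (u ++ a :: b :: v) = inside A u ++ a :: b :: inside A v := by
      simp [inside, h1, h2]
    have e2 : inside A (u ++ b :: a :: v) = inside A u ++ b :: a :: inside A v := by
      simp [inside, h1, h2]
    have e3 : inside A (u ++ a.merge b :: v) = inside A u ++ a.merge b :: inside A v := by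
      simp [inside, hml, h1, h2]
    have e4 : outside A (u ++ a :: b :: v) = outside A (u ++ b :: a :: v) := by
      simp [outside, h1, h2]
    have e5 : outside A (u ++ a :: b :: v) = outside A (u ++ a.merge b :: v) := by
      simp [outside, hml, h1, h2]
    rw [e1] at hi
    rw [← e4, ← e5, e1, e2, e3, hG.step hi hui ha hb]
    ring
  · have h2' := hdisj b hbne h2
    rw [if_neg, mul_zero, add_zero]
    · simp [inside, outside, h1, h2']
    · rw [hsm]
      rintro (h3 | h3)
      · exact h2' h3.2
      · exact hdisj a hane h3.1 h1
  · have h1' := hdisj a hane h1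
    rw [if_neg, mul_zero, add_zero]
    · simp [inside, outside, h1', h2]
    · rw [hsm]
      rintro (h3 | h3)
      · exact h1' h3.1
      · exact hdisj b hbne h3.2 h2
  · have h1' := hdisj a hane h1
    have h2' := hdisj b hbne h2
    rw [if_pos (hsm.2 (Or.inr ⟨h1, h2⟩))]
    have e1 : outside A (u ++ a :: b :: v) = outside A u ++ a :: b :: outside A v := by
      simp [outside, h1', h2']
    have e2 : outside A (u ++ b :: a :: v) = outside A u ++ b :: a :: outside A v := by
      simp [outside, h1', h2']
    have e3 : outside A (u ++ a.merge b :: v) = outside A u ++ a.merge b :: outside A v := by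
      simp [outside, hml, h1']
    have e4 : inside A (u ++ a :: b :: v) = inside A (u ++ b :: a :: v) := by
      simp [inside, h1', h2']
    have e5 : inside A (u ++ a :: b :: v) = inside A (u ++ a.merge b :: v) := by
      simp [inside, hml, h1', h2']
    rw [e1] at ho
    rw [← e4, ← e5, e1, e2, e3, hF.step ho huo ha hb]
    ring

/-- An expectation is the sum over the possible supports of the connected component that contains
a given label. -/
theorem IsExpectation.split {F G : List (Op m n s) → 𝔽} (hF : IsExpectation μ ν cf F)
    (hG : IsExpectation μ ν cf G) {val : Op m n s → 𝔽}
    (hF0 : ∀ w : List (Op m n s), (∀ a ∈ w, a.energy μ ν = 0) → F w = (w.map val).prod)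
    (hG1 : ∀ a : Op m n s, a.energy μ ν = 0 → G [a] = val a)
    (hG0 : ∀ w : List (Op m n s), (∀ a ∈ w, a.energy μ ν = 0) → w.length ≠ 1 → G w = 0)
    (x : Fin m ⊕ Fin n ⊕ Fin s) (w : List (Op m n s)) (hw : Good w) (hx : x ∈ wordLabels w) :
    F w = ∑ A ∈ (wordLabels w).powerset with x ∈ A, splitTerm F G w A := by
  induction w using word_induction (μ := μ) (ν := ν) with
  | nonneg w h0 =>
    by_cases h : ∀ a ∈ w, a.energy μ ν = 0
    swap
    · rw [hF.nonneg h0 h, Finset.sum_eq_zero]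
      intro A _
      unfold splitTerm
      split_ifs with hs
      swap
      · rfl
      push Not at h
      obtain ⟨a, haw, ha⟩ := h
      by_cases haA : a.labels ⊆ A
      · rw [hG.nonneg (fun c hc => h0 c (mem_inside.1 hc).1), zero_mul]
        exact fun h' => ha (h' a (mem_inside.2 ⟨haw, haA⟩))
      · rw [hF.nonneg (fun c hc => h0 c (mem_outside.1 hc).1), mul_zero]
        exact fun h' => ha (h' a (mem_outside.2 ⟨haw, haA⟩))
    -- With all energies zero, `G` vanishes unless the subword is a single operator, which must be
    -- the one that carries `x`. So only its label set contributes.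
    obtain ⟨c, hcw, hxc⟩ := mem_wordLabels.1 hx
    rw [Finset.sum_eq_single_of_mem c.labels]
    · have hin : inside c.labels w = [c] := by
        rw [← List.perm_singleton, List.perm_ext_iff_of_nodup (hw.inside _).nodup (by simp)]
        intro b
        rw [mem_inside, List.mem_singleton]
        constructor
        · rintro ⟨hb, hbc⟩
          obtain ⟨y, hy⟩ := hw.2 b hb
          exact hw.eq_of_mem hb hcw hy (hbc hy)
        · rintro rfl
          exact ⟨hcw, subset_rfl⟩
      have hs : Saturated c.labels w := by
        intro b hb
        by_cases hbc : b = c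
        · rw [hbc]
          exact Or.inl subset_rfl
        · exact Or.inr (hw.disjoint_of_ne hb hcw hbc)
      have hperm : w.Perm (c :: outside c.labels w) := by
        have := List.filter_append_perm (fun b : Op m n s => decide (b.labels ⊆ c.labels)) w
        have h2 : (inside c.labels w ++ outside c.labels w).Perm w := by
          have e : outside c.labels w =
              w.filter fun b : Op m n s => !decide (b.labels ⊆ c.labels) := by
            unfold outside
            congr 1
            funext b
            simp
          rw [e]
          exact this
        rw [hin] at h2
        exact h2.symm
      rw [splitTerm, if_pos hs, hin, hG1 c (h c hcw), hF0 w h,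
        hF0 _ fun b hb => h b (mem_outside.1 hb).1, (hperm.map val).prod_eq, List.map_cons,
        List.prod_cons]
    · rw [mem_filter, mem_powerset]
      exact ⟨fun y hy => mem_wordLabels.2 ⟨c, hcw, hy⟩, hxc⟩
    · intro A hA hAc
      rw [mem_filter, mem_powerset] at hA
      unfold splitTerm
      split_ifs with hs
      swap
      · rfl
      have hcA : c.labels ⊆ A :=
        (hs c hcw).resolve_right fun hd => Finset.disjoint_left.1 hd hxc hA.2
      obtain ⟨y, hyA, hyc⟩ := Finset.exists_of_ssubset (hcA.ssubset_of_ne (Ne.symm hAc))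
      obtain ⟨b, hbw, hyb⟩ := mem_wordLabels.1 (hA.1 hyA)
      have hbA : b.labels ⊆ A :=
        (hs b hbw).resolve_right fun hd => Finset.disjoint_left.1 hd hyb hyA
      rw [hG0, zero_mul]
      · exact fun a ha => h a (mem_inside.1 ha).1
      · intro hl
        obtain ⟨a, ha⟩ := List.length_eq_one_iff.1 hl
        have h1 : c ∈ inside A w := mem_inside.2 ⟨hcw, hcA⟩
        have h2 : b ∈ inside A w := mem_inside.2 ⟨hbw, hbA⟩
        rw [ha, List.mem_singleton] at h1 h2
        rw [h2, ← h1] at hyb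
        exact hyc hyb
  | dead b v hb =>
    rw [hF.dead hb, Finset.sum_eq_zero]
    intro A _
    unfold splitTerm
    split_ifs with hs
    swap
    · rfl
    -- The operator `b` heads one of the two subwords, and the corresponding factor vanishes.
    by_cases hbA : b.labels ⊆ A
    · have : inside A (b :: v) = b :: inside A v := by simp [inside, hbA]
      rw [this, hG.dead hb, zero_mul]
    · have : outside A (b :: v) = b :: outside A v := by simp [outside, hbA]
      rw [this, hF.dead hb, mul_zero]
  | step u v a b hu ha hb h1 h2 =>
    rw [← wordLabels_perm (swap_perm u v a b)] at h1
    rw [wordLabels_merge] at h2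
    rw [hF.step hw hu ha hb, h1 hw.swap hx, h2 hw.merge hx, Finset.mul_sum,
      ← Finset.sum_add_distrib]
    exact Finset.sum_congr rfl fun A _ => (splitTerm_step hF hG hw hu ha hb A).symm

theorem vev_isExpectation [CharZero 𝔽] {q : Fin s → 𝔽} (hq0 : ∀ k, q k ≠ 0)
    (hq : ∀ K : Finset (Fin s), K ≠ ∅ → ∏ k ∈ K, q k ≠ (∏ k ∈ K, q k)⁻¹) :
    IsExpectation μ ν (commFactor μ ν q) (vev μ ν q) where
  step h _ ha hb := vev_step hq0 hq h ha hb
  dead hb := vev_eq_zero_of_head_neg hb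
  nonneg h h' := vev_eq_zero_of_nonneg h h'

theorem connectedVev_isExpectation {q : Fin s → 𝔽} :
    IsExpectation μ ν (commFactor μ ν q) (connectedVev μ ν q) where
  step h hu ha hb := connectedVev_step q h hu ha hb
  dead hb := by rw [connectedVev, patternSum_of_head_neg q hb, zero_mul]
  nonneg h h' := by rw [connectedVev, patternSum_of_nonneg q h (by tauto), zero_mul]

/-- The part of the initial word with labels in `B`. -/
def startOn (B : Finset (Fin m ⊕ Fin n ⊕ Fin s)) : List (Op m n s) := inside B (startOps m n s)

theorem mem_startOps {c : Op m n s} : c ∈ startOps m n s ↔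
    (∃ i, c = ⟨{i}, ∅, ∅⟩) ∨ (∃ k, c = ⟨∅, ∅, {k}⟩) ∨ ∃ j, c = ⟨∅, {j}, ∅⟩ := by
  simp only [startOps, List.mem_append, List.mem_ofFn, eq_comm]

theorem startOps_labels {c : Op m n s} (hc : c ∈ startOps m n s) : ∃ x, c.labels = {x} := by
  rw [mem_startOps] at hc
  rcases hc with ⟨i, rfl⟩ | ⟨k, rfl⟩ | ⟨j, rfl⟩
  · refine ⟨Sum.inl i, ?_⟩
    ext x
    rcases x with x | x | x <;> simp [Op.labels]
  · refine ⟨Sum.inr (Sum.inr k), ?_⟩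
    ext x
    rcases x with x | x | x <;> simp [Op.labels]
  · refine ⟨Sum.inr (Sum.inl j), ?_⟩
    ext x
    rcases x with x | x | x <;> simp [Op.labels]

theorem exists_startOps (x : Fin m ⊕ Fin n ⊕ Fin s) : ∃ c ∈ startOps m n s, x ∈ c.labels := by
  rcases x with i | j | k
  · exact ⟨⟨{i}, ∅, ∅⟩, mem_startOps.2 (by simp), by simp [Op.labels]⟩
  · exact ⟨⟨∅, {j}, ∅⟩, mem_startOps.2 (by simp), by simp [Op.labels]⟩
  · exact ⟨⟨∅, ∅, {k}⟩, mem_startOps.2 (by simp), by simp [Op.labels]⟩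

theorem startOps_good : Good (startOps m n s) := by
  constructor
  · rw [startOps, List.pairwise_append, List.pairwise_append]
    simp only [List.pairwise_ofFn, List.mem_append, List.mem_ofFn]
    refine ⟨fun i j h => ?_, ⟨fun i j h => ?_, fun i j h => ?_, ?_⟩, ?_⟩
    · simp only [Op.labels, Finset.disjoint_left]
      rintro (x | x | x) <;> simp
      rintro rfl
      exact h.ne
    · simp only [Op.labels, Finset.disjoint_left]
      rintro (x | x | x) <;> simp
      rintro rfl
      exact h.ne
    · simp only [Op.labels, Finset.disjoint_left]
      rintro (x | x | x) <;> simp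
      rintro rfl
      exact h.ne
    · rintro _ ⟨i, rfl⟩ _ ⟨j, rfl⟩
      simp only [Op.labels, Finset.disjoint_left]
      rintro (x | x | x) <;> simp
    · rintro _ ⟨i, rfl⟩ _ (⟨j, rfl⟩ | ⟨j, rfl⟩)
      · simp only [Op.labels, Finset.disjoint_left]
        rintro (x | x | x) <;> simp
      · simp only [Op.labels, Finset.disjoint_left]
        rintro (x | x | x) <;> simp
  · intro a ha
    obtain ⟨x, hx⟩ := startOps_labels ha
    rw [hx]
    exact singleton_nonempty x

theorem wordLabels_startOn (B : Finset (Fin m ⊕ Fin n ⊕ Fin s)) : wordLabels (startOn B) = B := by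
  ext x
  simp only [mem_wordLabels, startOn, mem_inside]
  constructor
  · rintro ⟨a, ⟨-, ha⟩, hx⟩
    exact ha hx
  · intro hx
    obtain ⟨c, hc, hxc⟩ := exists_startOps x
    refine ⟨c, ⟨hc, ?_⟩, hxc⟩
    obtain ⟨y, hy⟩ := startOps_labels hc
    rw [hy] at hxc ⊢
    rw [mem_singleton] at hxc
    rwa [← hxc, singleton_subset_iff]

theorem inside_startOn {A B : Finset (Fin m ⊕ Fin n ⊕ Fin s)} (h : A ⊆ B) :
    inside A (startOn B) = startOn A := by
  unfold startOn inside
  rw [List.filter_filter]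
  refine List.filter_congr fun c _ => ?_
  by_cases hc : c.labels ⊆ A
  · simp [hc, hc.trans h]
  · simp [hc]

theorem outside_startOn {A B : Finset (Fin m ⊕ Fin n ⊕ Fin s)} :
    outside A (startOn B) = startOn (B \ A) := by
  unfold startOn inside outside
  rw [List.filter_filter]
  refine List.filter_congr fun c hc => ?_
  obtain ⟨x, hx⟩ := startOps_labels hc
  simp [hx, and_comm]

/-- Every operator of an initial word carries a single label, so every subset of the labels is
saturated and `IsExpectation.split` becomes the recursion that defines connected functions. -/
theorem vev_startOn [CharZero 𝔽] {q : Fin s → 𝔽} (hq0 : ∀ k, q k ≠ 0)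
    (hq : ∀ K : Finset (Fin s), K ≠ ∅ → ∏ k ∈ K, q k ≠ (∏ k ∈ K, q k)⁻¹)
    {x : Fin m ⊕ Fin n ⊕ Fin s} {B : Finset (Fin m ⊕ Fin n ⊕ Fin s)} (hx : x ∈ B) :
    vev μ ν q (startOn B) = ∑ A ∈ B.powerset with x ∈ A,
      connectedVev μ ν q (startOn A) * vev μ ν q (startOn (B \ A)) := by
  rw [(vev_isExpectation hq0 hq).split connectedVev_isExpectation
    (fun w hw => vev_of_energy_eq_zero hw) (fun a ha => connectedVev_singleton q ha) ?_ x
    (startOn B) (startOps_good.inside B) (by rwa [wordLabels_startOn]), wordLabels_startOn]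
  · refine Finset.sum_congr rfl fun A hA => ?_
    rw [mem_filter, mem_powerset] at hA
    rw [splitTerm, if_pos, inside_startOn hA.1, outside_startOn]
    intro c hc
    obtain ⟨y, hy⟩ := startOps_labels (mem_inside.1 hc).1
    rw [hy, singleton_subset_iff, disjoint_singleton_left]
    exact em _
  · intro w hw hl
    rw [connectedVev, patternSum_of_nonneg q (fun a ha => (hw a ha).ge) (by tauto), zero_mul]

theorem startOn_univ : startOn univ = startOps m n s := by simp [startOn, inside]

theorem startOn_empty : startOn ∅ = ([] : List (Op m n s)) := by
  unfold startOn inside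
  rw [List.filter_eq_nil_iff]
  intro c hc
  obtain ⟨x, hx⟩ := startOps_labels hc
  simp [hx]

end Splitting

/-! ### Inclusion-exclusion over set partitions -/

section Cumulants

set_option linter.unusedSectionVars false

variable {L : Type*} [Fintype L] [DecidableEq L] {R : Type*} [CommRing R]

/-- `T` is a set partition of `B`. -/
structure IsSetPartition (B : Finset L) (T : Finset (Finset L)) : Prop where
  nonempty : ∀ S ∈ T, S.Nonempty
  subset : ∀ S ∈ T, S ⊆ B
  cover : ∀ y ∈ B, ∃ S ∈ T, y ∈ S
  unique : ∀ S ∈ T, ∀ S' ∈ T, ∀ y, y ∈ S → y ∈ S' → S = S'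

open Classical in
/-- The set partitions of `B`. -/
noncomputable def setPartitions (B : Finset L) : Finset (Finset (Finset L)) :=
  univ.filter (IsSetPartition B)

theorem mem_setPartitions {B : Finset L} {T : Finset (Finset L)} :
    T ∈ setPartitions B ↔ IsSetPartition B T := by
  simp [setPartitions]

theorem sum_finpartition (B : Finset L) (f : Finset (Finset L) → R) :
    ∑ π : Finpartition B, f π.parts = ∑ T ∈ setPartitions B, f T := by
  refine Finset.sum_bij (fun π _ => π.parts) ?_ ?_ ?_ fun _ _ => rfl
  · intro π _
    rw [mem_setPartitions]
    exact ⟨fun S hS => π.nonempty_of_mem_parts hS, fun S hS => π.le hS,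
      fun y hy => π.exists_mem hy, fun S hS S' hS' y hy hy' => π.eq_of_mem_parts hS hS' hy hy'⟩
  · exact fun π _ ρ _ h => Finpartition.ext h
  · intro T hT
    rw [mem_setPartitions] at hT
    refine ⟨Finpartition.ofPairwiseDisjoint T ?_ |>.copy ?_, mem_univ _, ?_⟩
    · intro S hS S' hS' hne
      rw [Function.onFun, Finset.disjoint_left]
      exact fun y hy hy' => hne (hT.unique S hS S' hS' y hy hy')
    · ext y
      simp only [mem_sup, id_eq]
      exact ⟨fun ⟨S, hS, hy⟩ => hT.subset S hS hy, hT.cover y⟩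
    · simp only [Finpartition.copy_parts, Finpartition.ofPairwiseDisjoint]
      exact Finset.erase_eq_of_notMem fun h => (hT.nonempty _ h).ne_empty rfl

variable (R) in
/-- The Möbius coefficient of a set partition with `k` blocks. -/
def moebiusCoeff (k : ℕ) : R := (-1) ^ (k - 1) * ((k - 1).factorial : R)

/-- The connected function that results from `D` by inclusion-exclusion. -/
noncomputable def cumulant (D : Finset L → R) (B : Finset L) : R :=
  ∑ T ∈ setPartitions B, moebiusCoeff R #T * ∏ S ∈ T, D S

theorem IsSetPartition.nonempty_self {B : Finset L} {T : Finset (Finset L)}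
    (h : IsSetPartition B T) {x : L} (hx : x ∈ B) : T.Nonempty := by
  obtain ⟨S, hS, -⟩ := h.cover x hx
  exact ⟨S, hS⟩

theorem IsSetPartition.card_filter_notMem {B : Finset L} {T : Finset (Finset L)}
    (h : IsSetPartition B T) {x : L} (hx : x ∈ B) : #{S ∈ T | x ∉ S} = #T - 1 := by
  obtain ⟨S, hS, hxS⟩ := h.cover x hx
  rw [← Finset.card_erase_of_mem hS]
  congr 1
  ext S'
  rw [mem_filter, mem_erase]
  constructor
  · rintro ⟨h1, h2⟩
    refine ⟨?_, h1⟩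
    rintro rfl
    exact h2 hxS
  · rintro ⟨h1, h2⟩
    exact ⟨h2, fun h3 => h1 (h.unique S' h2 S hS x h3 hxS)⟩

theorem IsSetPartition.insert {A B : Finset L} {T : Finset (Finset L)}
    (h : IsSetPartition A T) (hA : A ⊆ B) (hne : (B \ A).Nonempty) :
    IsSetPartition B (insert (B \ A) T) where
  nonempty S hS := by
    rcases mem_insert.1 hS with rfl | hS
    · exact hne
    · exact h.nonempty S hS
  subset S hS := by
    rcases mem_insert.1 hS with rfl | hS
    · exact sdiff_subset
    · exact (h.subset S hS).trans hA
  cover y hy := by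
    by_cases hyA : y ∈ A
    · obtain ⟨S, hS, hyS⟩ := h.cover y hyA
      exact ⟨S, mem_insert_of_mem hS, hyS⟩
    · exact ⟨B \ A, mem_insert_self _ _, mem_sdiff.2 ⟨hy, hyA⟩⟩
  unique S hS S' hS' y hy hy' := by
    rcases mem_insert.1 hS with rfl | hS <;> rcases mem_insert.1 hS' with rfl | hS'
    · rfl
    · exact absurd (h.subset S' hS' hy') (mem_sdiff.1 hy).2
    · exact absurd (h.subset S hS hy) (mem_sdiff.1 hy').2
    · exact h.unique S hS S' hS' y hy hy'

theorem IsSetPartition.sdiff_notMem {A B : Finset L} {T : Finset (Finset L)}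
    (h : IsSetPartition A T) : B \ A ∉ T := fun hm => by
  obtain ⟨y, hy⟩ := h.nonempty _ hm
  exact (mem_sdiff.1 hy).2 (h.subset _ hm hy)

theorem IsSetPartition.erase {B S : Finset L} {T : Finset (Finset L)}
    (h : IsSetPartition B T) (hS : S ∈ T) : IsSetPartition (B \ S) (T.erase S) where
  nonempty S' hS' := h.nonempty S' (mem_of_mem_erase hS')
  subset S' hS' := by
    intro y hy
    rw [mem_erase] at hS'
    exact mem_sdiff.2 ⟨h.subset S' hS'.2 hy, fun hy' => hS'.1 (h.unique S' hS'.2 S hS y hy hy')⟩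
  cover y hy := by
    rw [mem_sdiff] at hy
    obtain ⟨S', hS', hyS'⟩ := h.cover y hy.1
    refine ⟨S', mem_erase.2 ⟨?_, hS'⟩, hyS'⟩
    rintro rfl
    exact hy.2 hyS'
  unique S₁ h₁ S₂ h₂ := h.unique S₁ (mem_of_mem_erase h₁) S₂ (mem_of_mem_erase h₂)

theorem IsSetPartition.singleton {B : Finset L} (hB : B.Nonempty) :
    IsSetPartition B {B} where
  nonempty S hS := by rwa [mem_singleton.1 hS]
  subset S hS := by rw [mem_singleton.1 hS]
  cover y hy := ⟨B, mem_singleton_self B, hy⟩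
  unique S hS S' hS' _ _ _ := by rw [mem_singleton.1 hS, mem_singleton.1 hS']

/-- The recursion for the connected function. -/
theorem sum_cumulant_mul {D : Finset L → R} (hD : D ∅ = 1) {B : Finset L} {x : L} (hx : x ∈ B) :
    ∑ A ∈ B.powerset with x ∈ A, cumulant D A * D (B \ A) = D B := by
  have hBmem : B ∈ B.powerset.filter (x ∈ ·) := by simp [hx]
  rw [← Finset.add_sum_erase _ _ hBmem, sdiff_self, bot_eq_empty, hD, mul_one]
  -- Adjoining `B \ A` to a set partition of `A` gives a set partition of `B` with a marked block
  -- that does not contain `x`. Each `T` has `#T - 1` such blocks.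
  have hrest : ∑ A ∈ (B.powerset.filter (x ∈ ·)).erase B, cumulant D A * D (B \ A) =
      ∑ T ∈ setPartitions B, ((#T - 1 : ℕ) : R) * moebiusCoeff R (#T - 1) * ∏ S ∈ T, D S := by
    have h1 : ∀ T ∈ setPartitions B,
        ((#T - 1 : ℕ) : R) * moebiusCoeff R (#T - 1) * ∏ S ∈ T, D S =
          ∑ S ∈ T with x ∉ S, moebiusCoeff R (#T - 1) * ∏ S ∈ T, D S := by
      intro T hT
      rw [mem_setPartitions] at hT
      rw [Finset.sum_const, hT.card_filter_notMem hx, nsmul_eq_mul, mul_assoc]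
    rw [Finset.sum_congr rfl h1]
    simp only [cumulant, Finset.sum_mul]
    rw [Finset.sum_sigma', Finset.sum_sigma']
    refine Finset.sum_bij' (fun p _ => ⟨insert (B \ p.1) p.2, B \ p.1⟩)
      (fun p _ => ⟨B \ p.2, p.1.erase p.2⟩) ?_ ?_ ?_ ?_ ?_
    · rintro ⟨A, T⟩ h
      simp only [mem_sigma, mem_erase, mem_filter, mem_powerset, mem_setPartitions] at h ⊢
      obtain ⟨⟨hne, hA, hxA⟩, hT⟩ := h
      exact ⟨hT.insert hA (sdiff_nonempty.2 fun h => hne (hA.antisymm h)), mem_insert_self _ _,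
        fun h => (mem_sdiff.1 h).2 hxA⟩
    · rintro ⟨T, S⟩ h
      simp only [mem_sigma, mem_erase, mem_filter, mem_powerset, mem_setPartitions] at h ⊢
      obtain ⟨hT, hS, hxS⟩ := h
      refine ⟨⟨?_, sdiff_subset, mem_sdiff.2 ⟨hx, hxS⟩⟩, hT.erase hS⟩
      intro h
      obtain ⟨y, hy⟩ := hT.nonempty S hS
      have := hT.subset S hS hy
      rw [← h] at this
      exact (mem_sdiff.1 this).2 hy
    · rintro ⟨A, T⟩ h
      simp only [mem_sigma, mem_erase, mem_filter, mem_powerset, mem_setPartitions] at h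
      obtain ⟨⟨hne, hA, hxA⟩, hT⟩ := h
      simp only [Finset.sdiff_sdiff_eq_self hA, Finset.erase_insert hT.sdiff_notMem]
    · rintro ⟨T, S⟩ h
      simp only [mem_sigma, mem_filter, mem_setPartitions] at h
      obtain ⟨hT, hS, hxS⟩ := h
      simp only [Finset.sdiff_sdiff_eq_self (hT.subset S hS), Finset.insert_erase hS]
    · rintro ⟨A, T⟩ h
      simp only [mem_sigma, mem_erase, mem_filter, mem_powerset, mem_setPartitions] at h
      obtain ⟨⟨hne, hA, hxA⟩, hT⟩ := h
      simp only [Finset.card_insert_of_notMem hT.sdiff_notMem,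
        Finset.prod_insert hT.sdiff_notMem, Nat.add_sub_cancel]
      ring
  rw [hrest, cumulant, ← Finset.sum_add_distrib]
  rw [Finset.sum_eq_single_of_mem {B} (mem_setPartitions.2 (.singleton ⟨x, hx⟩))]
  · simp [moebiusCoeff]
  · intro T hT hTB
    rw [mem_setPartitions] at hT
    rw [← add_mul]
    have hc : 1 ≤ #T := (hT.nonempty_self hx).card_pos
    have hc1 : #T ≠ 1 := by
      intro h
      obtain ⟨S, rfl⟩ := Finset.card_eq_one.1 h
      refine hTB (congrArg _ ((hT.subset S (mem_singleton_self S)).antisymm fun y hy => ?_))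
      obtain ⟨S', hS', hyS'⟩ := hT.cover y hy
      rwa [mem_singleton.1 hS'] at hyS'
    -- For at least two blocks, the Möbius coefficient for `k + 2` blocks and `k + 1` times the one
    -- for `k + 1` blocks cancel.
    obtain ⟨k, hk⟩ : ∃ k, #T = k + 2 := ⟨#T - 2, by omega⟩
    have : moebiusCoeff R (k + 2) + ((k + 2 - 1 : ℕ) : R) * moebiusCoeff R (k + 2 - 1) = 0 := by
      have e1 : k + 2 - 1 = k + 1 := rfl
      simp only [moebiusCoeff, e1, Nat.add_sub_cancel, Nat.factorial_succ, pow_succ]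
      push_cast
      ring
    rw [hk, this, zero_mul]

/-- The connected function is determined by the recursion. -/
theorem eq_cumulant {D C : Finset L → R} (hD : D ∅ = 1)
    (h : ∀ B x, x ∈ B → D B = ∑ A ∈ B.powerset with x ∈ A, C A * D (B \ A)) (B : Finset L)
    (hB : B.Nonempty) : C B = cumulant D B := by
  induction B using Finset.strongInduction with
  | H B ih =>
    obtain ⟨x, hx⟩ := hB
    have h1 := h B x hx
    rw [← sum_cumulant_mul hD hx] at h1
    have hBmem : B ∈ B.powerset.filter (x ∈ ·) := by simp [hx]
    rw [← Finset.add_sum_erase _ _ hBmem, ← Finset.add_sum_erase _ _ hBmem, sdiff_self,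
      bot_eq_empty, hD, mul_one, mul_one] at h1
    have h2 : ∑ A ∈ (B.powerset.filter (x ∈ ·)).erase B, cumulant D A * D (B \ A) =
        ∑ A ∈ (B.powerset.filter (x ∈ ·)).erase B, C A * D (B \ A) := by
      refine Finset.sum_congr rfl fun A hA => ?_
      simp only [mem_erase, mem_filter, mem_powerset] at hA
      rw [ih A (hA.2.1.ssubset_of_ne hA.1) ⟨x, hA.2.2⟩]
    rw [h2] at h1
    exact (add_right_cancel h1).symm

end Cumulants

/-! ### The vacuum expectation value of the initial word -/

section StartVev

variable {𝔽 : Type*} [Field 𝔽] {N m n s : ℕ}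

/-- The eigenvalue of `𝓔_0(z) - 1 / ζ(z)` on the state of a Young diagram, with `p = exp(z / 2)`. -/
def cycleEigenvalue (Y : YoungDiagram) (p : 𝔽) : 𝔽 :=
  ∑ i ∈ range (Y.colLen 0),
    (p ^ (2 * ((Y.rowLen i : ℤ) - i - 1) + 1) - p ^ (2 * (-(i : ℤ) - 1) + 1))

theorem cycleEigenvalue_eq {Y : YoungDiagram} (hN : Y.colLen 0 ≤ N) (p : 𝔽) :
    cycleEigenvalue Y p = ∑ i, p ^ (2 * particles Y N i + 1) -
      ∑ v ∈ Ico (-(N : ℤ)) 0, p ^ (2 * v + 1) := by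
  rw [← sum_comp_vac fun v => p ^ (2 * v + 1), ← Finset.sum_sub_distrib, cycleEigenvalue,
    Finset.sum_subset (range_subset_range.2 hN), ← Fin.sum_univ_eq_sum_range
      (fun i => p ^ (2 * ((Y.rowLen i : ℤ) - i - 1) + 1) - p ^ (2 * (-(i : ℤ) - 1) + 1))]
  · refine Finset.sum_congr rfl fun i _ => ?_
    simp only [particles, vac]
    congr 4
    ring
  · intro i _ hi
    rw [mem_range, not_lt] at hi
    rw [rowLen_eq_zero hi]
    simp

/-- The selected members of an initial word. -/
theorem startOn_eq (B : Finset (Fin m ⊕ Fin n ⊕ Fin s)) :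
    startOn B =
      ((List.finRange m).filter fun i => Sum.inl i ∈ B).map (fun i => ⟨{i}, ∅, ∅⟩) ++
      (((List.finRange s).filter fun k => Sum.inr (Sum.inr k) ∈ B).map (fun k => ⟨∅, ∅, {k}⟩) ++
      ((List.finRange n).filter fun j => Sum.inr (Sum.inl j) ∈ B).map
        (fun j => (⟨∅, {j}, ∅⟩ : Op m n s))) := by
  have h1 : ∀ i : Fin m, (⟨{i}, ∅, ∅⟩ : Op m n s).labels ⊆ B ↔ Sum.inl i ∈ B := by
    intro i
    rw [show (⟨{i}, ∅, ∅⟩ : Op m n s).labels = {Sum.inl i} by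
      ext x; rcases x with x | x | x <;> simp [Op.labels], singleton_subset_iff]
  have h2 : ∀ k : Fin s, (⟨∅, ∅, {k}⟩ : Op m n s).labels ⊆ B ↔ Sum.inr (Sum.inr k) ∈ B := by
    intro k
    rw [show (⟨∅, ∅, {k}⟩ : Op m n s).labels = {Sum.inr (Sum.inr k)} by
      ext x; rcases x with x | x | x <;> simp [Op.labels], singleton_subset_iff]
  have h3 : ∀ j : Fin n, (⟨∅, {j}, ∅⟩ : Op m n s).labels ⊆ B ↔ Sum.inr (Sum.inl j) ∈ B := by
    intro j
    rw [show (⟨∅, {j}, ∅⟩ : Op m n s).labels = {Sum.inr (Sum.inl j)} by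
      ext x; rcases x with x | x | x <;> simp [Op.labels], singleton_subset_iff]
  simp only [startOn, inside, startOps, List.ofFn_eq_map, List.filter_append, List.filter_map]
  congr 2
  · refine List.filter_congr fun i _ => ?_
    simp [h1]
  · congr 1
    refine List.filter_congr fun i _ => ?_
    simp [h2]
  · congr 1
    refine List.filter_congr fun i _ => ?_
    simp [h3]

variable {μ : Fin m → ℕ} {ν : Fin n → ℕ} {q : Fin s → 𝔽}

theorem wordAct_lower (hμ : ∀ i, 0 < μ i) (l : List (Fin m)) :
    wordAct N μ ν q (l.map fun i => (⟨{i}, ∅, ∅⟩ : Op m n s)) = lower (l.map μ) := by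
  unfold wordAct lower
  rw [List.map_map, List.map_map]
  congr 1
  refine List.map_congr_left fun i _ => ?_
  have := hμ i
  simp only [Function.comp_apply, opAct, Op.energy, Finset.sum_singleton, Finset.sum_empty,
    Finset.prod_empty, sub_zero]
  rw [if_neg (by omega)]

theorem wordAct_raise (hν : ∀ j, 0 < ν j) (l : List (Fin n)) :
    wordAct N μ ν q (l.map fun j => (⟨∅, {j}, ∅⟩ : Op m n s)) = raise (l.map ν) := by
  unfold wordAct raise
  rw [List.map_map, List.map_map]
  congr 1
  refine List.map_congr_left fun j _ => ?_
  have := hν j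
  simp only [Function.comp_apply, opAct, Op.energy, Finset.sum_singleton, Finset.sum_empty,
    Finset.prod_empty, zero_sub]
  rw [if_neg (by omega)]

theorem isState_wordAct_cycles (l : List (Fin s)) {E : ℤ} {Φ : (Fin N → ℤ) → 𝔽}
    (h : IsState E Φ) :
    IsState E (wordAct N μ ν q (l.map fun k => (⟨∅, ∅, {k}⟩ : Op m n s)) Φ) := by
  convert h.wordAct μ ν q (l.map fun k => (⟨∅, ∅, {k}⟩ : Op m n s)) using 1
  rw [List.map_map]
  simp [Function.comp_def, Op.energy]

/-- A hop by `0` is diagonal. The vacuum value of a single cycle is `0`, so its scalar subtracts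
exactly the contribution of the sea, as in the shifted power sums. -/
theorem wordAct_cycles (l : List (Fin s)) (Φ : (Fin N → ℤ) → 𝔽) {Y : YoungDiagram}
    (hY : Y.colLen 0 ≤ N) :
    wordAct N μ ν q (l.map fun k => (⟨∅, ∅, {k}⟩ : Op m n s)) Φ (particles Y N) =
      (l.map fun k => cycleEigenvalue Y (q k)).prod * Φ (particles Y N) := by
  induction l with
  | nil => simp [wordAct]
  | cons k l ih =>
    rw [List.map_cons, wordAct_cons, List.map_cons, List.prod_cons, mul_assoc, ← ih]
    generalize wordAct N μ ν q (l.map fun k => (⟨∅, ∅, {k}⟩ : Op m n s)) Φ = Ψ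
    rw [opAct, if_pos (by simp [Op.energy]), if_neg (by simp), vacValue, if_pos ⟨k, rfl⟩,
      zero_sub, LinearMap.add_apply, LinearMap.smul_apply, Module.End.one_apply, Pi.add_apply,
      Pi.smul_apply, smul_eq_mul, hop_apply _ _ _ (le_particles Y), cycleEigenvalue_eq hY]
    simp only [Finset.prod_singleton, Pi.single_zero, add_zero, ← Finset.sum_mul]
    ring

variable (μ ν) in
/-- The parts of `μ` with labels in `B`. -/
def leftParts (B : Finset (Fin m ⊕ Fin n ⊕ Fin s)) : Multiset ℕ :=
  ({i : Fin m | Sum.inl i ∈ B} : Finset (Fin m)).val.map μ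

/-- The parts of `ν` with labels in `B`. -/
def rightParts (ν : Fin n → ℕ) (B : Finset (Fin m ⊕ Fin n ⊕ Fin s)) : Multiset ℕ :=
  ({j : Fin n | Sum.inr (Sum.inl j) ∈ B} : Finset (Fin n)).val.map ν

/-- The completed cycles with labels in `B`. -/
def cycles (B : Finset (Fin m ⊕ Fin n ⊕ Fin s)) : Finset (Fin s) :=
  {k : Fin s | Sum.inr (Sum.inr k) ∈ B}

theorem val_filter_fin {k : ℕ} (p : Fin k → Prop) [DecidablePred p] :
    (univ.filter p).val = ((List.finRange k).filter p : List (Fin k)) := by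
  rw [Finset.filter_val, ← Multiset.filter_coe]
  rfl

/-- The creation operators produce Frobenius coefficients, the cycles act diagonally, and the
annihilation operators pair the result with Frobenius coefficients again; by Frobenius' formula
these are characters. If the sizes differ, the total energy is nonzero and the value at the vacuum
vanishes. -/
theorem vev_startOn_eq [CharZero 𝔽] (hμ : ∀ i, 0 < μ i) (hν : ∀ j, 0 < ν j)
    (B : Finset (Fin m ⊕ Fin n ⊕ Fin s)) :
    vev μ ν q (startOn B) =
      if (leftParts μ B).sum = (rightParts ν B).sum then
        ∑ p : Nat.Partition (leftParts μ B).sum, (irrChar (diagram p) (leftParts μ B) : 𝔽) *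
          (∏ k ∈ cycles B, cycleEigenvalue (diagram p) (q k)) *
          (irrChar (diagram p) (rightParts ν B) : 𝔽)
      else 0 := by
  set l := ((List.finRange m).filter fun i => Sum.inl i ∈ B).map μ with hl
  set l' := ((List.finRange n).filter fun j => Sum.inr (Sum.inl j) ∈ B).map ν with hl'
  set c := (List.finRange s).filter fun k => Sum.inr (Sum.inr k) ∈ B with hc
  have el : leftParts μ B = l := by
    rw [leftParts, val_filter_fin, Multiset.map_coe]
  have el' : rightParts ν B = l' := by
    rw [rightParts, val_filter_fin, Multiset.map_coe]
  have ec : ∀ f : Fin s → 𝔽, ∏ k ∈ cycles B, f k = (c.map f).prod := by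
    intro f
    rw [Finset.prod, cycles, val_filter_fin, Multiset.map_coe, Multiset.prod_coe]
  have hlpos : ∀ y ∈ l, 0 < y := by
    intro y hy
    rw [hl, List.mem_map] at hy
    obtain ⟨i, -, rfl⟩ := hy
    exact hμ i
  have hlpos' : ∀ y ∈ l', 0 < y := by
    intro y hy
    rw [hl', List.mem_map] at hy
    obtain ⟨i, -, rfl⟩ := hy
    exact hν i
  have hN : l'.sum ≤ ∑ j, ν j := by
    rw [← Multiset.sum_coe, ← el', rightParts]
    exact Finset.sum_le_sum_of_subset (Finset.subset_univ _)
  have hstate := isState_wordAct_cycles (μ := μ) (ν := ν) (q := q) c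
    (raise_isState l' (vacuum_isState (𝔽 := 𝔽) (N := ∑ j, ν j)))
  rw [zero_add] at hstate
  have hvev : vev μ ν q (startOn B) = lower l (wordAct (∑ j, ν j) μ ν q
      (c.map fun k => (⟨∅, ∅, {k}⟩ : Op m n s)) (raise l' (vacuum 𝔽 _))) vac := by
    rw [vev, startOn_eq, wordAct_append, wordAct_append, wordAct_lower hμ, wordAct_raise hν]
  rw [hvev, el, el', Multiset.sum_coe, Multiset.sum_coe]
  split_ifs with hs
  · rw [← hs] at hstate hN
    rw [lower_vac l hN hstate]
    refine Finset.sum_congr rfl fun p _ => ?_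
    have hcard : #(diagram p).cells ≤ ∑ j, ν j := by rwa [card_diagram]
    rw [wordAct_cycles _ _ ((colLen_le_card _).trans hcard), raise_vacuum, ec,
      irrChar_eq_frob _ hcard l hlpos (card_diagram p).symm,
      irrChar_eq_frob _ hcard l' hlpos' (by rw [card_diagram, hs])]
    simp only [Rat.cast_intCast]
    ring
  · have h1 : wordAct (∑ j, ν j) μ ν q
        (((List.finRange m).filter fun i => Sum.inl i ∈ B).map
          fun i => (⟨{i}, ∅, ∅⟩ : Op m n s)) = lower l := wordAct_lower hμ _
    rw [← h1]
    refine (hstate.wordAct μ ν q _).deg _ ?_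
    have h2 : ((((List.finRange m).filter fun i => Sum.inl i ∈ B).map
          fun i => (⟨{i}, ∅, ∅⟩ : Op m n s)).map fun a => a.energy μ ν).sum = (l.sum : ℕ) := by
      rw [hl, List.map_map, ← Nat.coe_castAddMonoidHom, map_list_sum, List.map_map]
      congr 1
    rw [h2]
    omega

end StartVev

/-! ### Exponentials of linear forms -/

section ExpSeries

variable {σ : Type*}

/-- `exp(l)` for a series `l` with constant term zero. -/
noncomputable def expSubst (l : MvPowerSeries σ ℚ) : MvPowerSeries σ ℚ :=
  (PowerSeries.exp ℚ).subst l

/-- The identity is checked for two independent variables, where it is the formula for binomial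
coefficients, and then `l` and `l'` are substituted. -/
theorem expSubst_add {l l' : MvPowerSeries σ ℚ} (h : l.constantCoeff = 0)
    (h' : l'.constantCoeff = 0) : expSubst (l + l') = expSubst l * expSubst l' := by
  have key : (PowerSeries.exp ℚ).subst
      (MvPowerSeries.X 0 + MvPowerSeries.X 1 : MvPowerSeries (Fin 2) ℚ) =
      (PowerSeries.exp ℚ).subst (MvPowerSeries.X 0 : MvPowerSeries (Fin 2) ℚ) *
      (PowerSeries.exp ℚ).subst (MvPowerSeries.X 1 : MvPowerSeries (Fin 2) ℚ) := by
    ext e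
    rw [PowerSeries.coeff_subst_X_zero_add_X_one, PowerSeries.coeff_subst_X_zero_subst_mul_X_one]
    simp only [PowerSeries.coeff_exp, eq_ratCast, Rat.cast_id]
    have h1 := Nat.add_choose_mul_factorial_mul_factorial (e 0) (e 1)
    rw [← Nat.choose_symm_add] at h1
    have h2 : ((e 0).factorial : ℚ) ≠ 0 := by positivity
    have h3 : ((e 1).factorial : ℚ) ≠ 0 := by positivity
    have h4 : ((e 0 + e 1).factorial : ℚ) ≠ 0 := by positivity
    field_simp
    exact_mod_cast h1
  have hs : MvPowerSeries.HasSubst ![l, l'] := by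
    refine MvPowerSeries.hasSubst_of_constantCoeff_zero fun i => ?_
    fin_cases i
    · exact h
    · exact h'
  have comp : ∀ a : MvPowerSeries (Fin 2) ℚ, a.constantCoeff = 0 →
      MvPowerSeries.subst ![l, l'] ((PowerSeries.exp ℚ).subst a) =
        (PowerSeries.exp ℚ).subst (MvPowerSeries.subst ![l, l'] a) := by
    intro a ha
    exact MvPowerSeries.subst_comp_subst_apply
      (PowerSeries.HasSubst.of_constantCoeff_zero ha).const hs _
  have h2 := congrArg (MvPowerSeries.subst ![l, l']) key
  rw [MvPowerSeries.subst_mul hs, comp _ (by simp), comp _ (by simp), comp _ (by simp),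
    MvPowerSeries.subst_add hs, MvPowerSeries.subst_X hs, MvPowerSeries.subst_X hs] at h2
  exact h2

theorem expSubst_zero : expSubst (0 : MvPowerSeries σ ℚ) = 1 := by
  rw [expSubst, PowerSeries.subst_zero_eq_C_constantCoeff]
  simp

theorem expSubst_smul_X (c : ℚ) (x : σ) : expSubst (c • MvPowerSeries.X x) =
    (PowerSeries.rescale c (PowerSeries.exp ℚ)).subst (MvPowerSeries.X x : MvPowerSeries σ ℚ) := by
  rw [PowerSeries.rescale_eq_subst, PowerSeries.subst_comp_subst_apply
    (PowerSeries.HasSubst.smul_X' c) (PowerSeries.HasSubst.X x),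
    PowerSeries.subst_smul (PowerSeries.HasSubst.X x), PowerSeries.subst_X (PowerSeries.HasSubst.X x)]
  rfl

theorem expSubst_sum {ι : Type*} (K : Finset ι) (l : ι → MvPowerSeries σ ℚ)
    (h : ∀ k ∈ K, (l k).constantCoeff = 0) :
    expSubst (∑ k ∈ K, l k) = ∏ k ∈ K, expSubst (l k) := by
  classical
  induction K using Finset.induction_on with
  | empty => simp [expSubst_zero]
  | insert k K hk ih =>
    rw [Finset.sum_insert hk, Finset.prod_insert hk, expSubst_add (h k (mem_insert_self k K)),
      ih fun j hj => h j (mem_insert_of_mem hj)]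
    rw [map_sum]
    exact Finset.sum_eq_zero fun j hj => h j (mem_insert_of_mem hj)

theorem expSubst_nsmul {l : MvPowerSeries σ ℚ} (h : l.constantCoeff = 0) (j : ℕ) :
    expSubst (j • l) = expSubst l ^ j := by
  have := expSubst_sum (range j) (fun _ => l) fun _ _ => h
  simpa using this

theorem expSubst_mul_neg {l : MvPowerSeries σ ℚ} (h : l.constantCoeff = 0) :
    expSubst l * expSubst (-l) = 1 := by
  rw [← expSubst_add h (by simp [h]), add_neg_cancel, expSubst_zero]

theorem map_expSubst_zsmul {𝔽 : Type*} [Field 𝔽] (f : MvPowerSeries σ ℚ →+* 𝔽)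
    {l : MvPowerSeries σ ℚ} (h : l.constantCoeff = 0) (j : ℤ) :
    f (expSubst (j • l)) = f (expSubst l) ^ j := by
  obtain ⟨k, rfl | rfl⟩ := j.eq_nat_or_neg
  · rw [natCast_zsmul, zpow_natCast, expSubst_nsmul h, map_pow]
  · rw [neg_zsmul, natCast_zsmul, zpow_neg, zpow_natCast, ← map_pow, ← expSubst_nsmul h]
    refine eq_inv_of_mul_eq_one_right ?_
    rw [← map_mul, expSubst_mul_neg (by simp [h]), map_one]

end ExpSeries

/-! ### Products of series in disjoint sets of variables -/

section Disjoint

variable {σ : Type*} [DecidableEq σ] {R : Type*} [CommRing R]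

/-- Only the variables in `A` occur in `f`. -/
def DependsOn (A : Finset σ) (f : MvPowerSeries σ R) : Prop :=
  ∀ e : σ →₀ ℕ, ¬ e.support ⊆ A → MvPowerSeries.coeff e f = 0

theorem DependsOn.mul {A B : Finset σ} {f g : MvPowerSeries σ R} (hf : DependsOn A f)
    (hg : DependsOn B g) : DependsOn (A ∪ B) (f * g) := by
  intro e he
  rw [MvPowerSeries.coeff_mul]
  refine Finset.sum_eq_zero fun p hp => ?_
  rw [HasAntidiagonal.mem_antidiagonal] at hp
  by_cases h1 : p.1.support ⊆ A
  · by_cases h2 : p.2.support ⊆ B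
    · refine absurd ?_ he
      rw [← hp]
      exact Finsupp.support_add.trans (Finset.union_subset_union h1 h2)
    · rw [hg _ h2, mul_zero]
  · rw [hf _ h1, zero_mul]

/-- The restriction of an exponent. -/
def restrictExp (e : σ →₀ ℕ) (A : Finset σ) : σ →₀ ℕ := e.filter (· ∈ A)

/-- As the variables are disjoint, only one decomposition of the exponent can contribute to the
product. -/
theorem DependsOn.coeff_mul {A B : Finset σ} (hAB : Disjoint A B) {f g : MvPowerSeries σ R}
    (hf : DependsOn A f) (hg : DependsOn B g) (e : σ →₀ ℕ) :
    MvPowerSeries.coeff (restrictExp e (A ∪ B)) (f * g) =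
      MvPowerSeries.coeff (restrictExp e A) f * MvPowerSeries.coeff (restrictExp e B) g := by
  rw [MvPowerSeries.coeff_mul, Finset.sum_eq_single (restrictExp e A, restrictExp e B)]
  · intro p hp hne
    rw [HasAntidiagonal.mem_antidiagonal] at hp
    by_contra h0
    have h1 : p.1.support ⊆ A := by
      by_contra h
      rw [hf _ h, zero_mul] at h0
      exact h0 rfl
    have h2 : p.2.support ⊆ B := by
      by_contra h
      rw [hg _ h, mul_zero] at h0
      exact h0 rfl
    have h1' : ∀ x, x ∉ A → p.1 x = 0 := fun x hx =>
      Finsupp.notMem_support_iff.1 fun h => hx (h1 h)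
    have h2' : ∀ x, x ∉ B → p.2 x = 0 := fun x hx =>
      Finsupp.notMem_support_iff.1 fun h => hx (h2 h)
    apply hne
    have hx : ∀ x, p.1 x + p.2 x = restrictExp e (A ∪ B) x := fun x => by
      rw [← hp, Finsupp.add_apply]
    refine Prod.ext ?_ ?_
    · ext x
      have := hx x
      simp only [restrictExp, Finsupp.filter_apply, mem_union] at this ⊢
      by_cases hA : x ∈ A
      · rw [h2' x (Finset.disjoint_left.1 hAB hA)] at this
        simpa [hA] using this
      · simp [hA, h1' x hA]
    · ext x
      have := hx x
      simp only [restrictExp, Finsupp.filter_apply, mem_union] at this ⊢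
      by_cases hB : x ∈ B
      · rw [h1' x (Finset.disjoint_right.1 hAB hB)] at this
        simpa [hB] using this
      · simp [hB, h2' x hB]
  · intro h
    refine absurd ?_ h
    rw [HasAntidiagonal.mem_antidiagonal]
    ext x
    simp only [restrictExp, Finsupp.add_apply, Finsupp.filter_apply, mem_union]
    by_cases hA : x ∈ A
    · simp [hA, Finset.disjoint_left.1 hAB hA]
    · simp [hA]

theorem DependsOn.one : DependsOn ∅ (1 : MvPowerSeries σ R) := by
  intro e he
  rw [MvPowerSeries.coeff_one, if_neg]
  rintro rfl
  simp at he

theorem DependsOn.prod {ι : Type*} [DecidableEq ι] {T : Finset ι} {A : ι → Finset σ}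
    {f : ι → MvPowerSeries σ R} (hf : ∀ t ∈ T, DependsOn (A t) (f t)) :
    DependsOn (T.biUnion A) (∏ t ∈ T, f t) := by
  induction T using Finset.induction_on with
  | empty => simpa using DependsOn.one
  | insert t T ht ih =>
    rw [Finset.prod_insert ht, Finset.biUnion_insert]
    exact (hf t (mem_insert_self t T)).mul (ih fun u hu => hf u (mem_insert_of_mem hu))

theorem coeff_prod_of_dependsOn {ι : Type*} [DecidableEq ι] {T : Finset ι} {A : ι → Finset σ}
    (hA : (T : Set ι).PairwiseDisjoint A) {f : ι → MvPowerSeries σ R}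
    (hf : ∀ t ∈ T, DependsOn (A t) (f t)) (e : σ →₀ ℕ) :
    MvPowerSeries.coeff (restrictExp e (T.biUnion A)) (∏ t ∈ T, f t) =
      ∏ t ∈ T, MvPowerSeries.coeff (restrictExp e (A t)) (f t) := by
  induction T using Finset.induction_on with
  | empty =>
    have : restrictExp e ((∅ : Finset ι).biUnion A) = 0 := by
      ext x
      simp [restrictExp]
    rw [this]
    simp
  | insert t T ht ih =>
    rw [Finset.coe_insert, Set.pairwiseDisjoint_insert_of_notMem (by simpa using ht)] at hA
    rw [Finset.prod_insert ht, Finset.prod_insert ht, Finset.biUnion_insert,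
      DependsOn.coeff_mul ?_ (hf t (mem_insert_self t T))
        (DependsOn.prod fun u hu => hf u (mem_insert_of_mem hu)),
      ih hA.1 fun u hu => hf u (mem_insert_of_mem hu)]
    rw [Finset.disjoint_biUnion_right]
    exact fun u hu => hA.2 u hu

theorem dependsOn_subst_X (f : PowerSeries R) (x : σ) :
    DependsOn {x} (f.subst (MvPowerSeries.X x : MvPowerSeries σ R)) := by
  intro e he
  rw [PowerSeries.coeff_subst_single, if_neg]
  intro h
  apply he
  rw [h]
  exact Finsupp.support_single_subset

theorem coeff_subst_X_restrictExp (f : PowerSeries R) (x : σ) (e : σ →₀ ℕ) :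
    MvPowerSeries.coeff (restrictExp e {x}) (f.subst (MvPowerSeries.X x : MvPowerSeries σ R)) =
      PowerSeries.coeff (e x) f := by
  have h1 : restrictExp e {x} x = e x := by simp [restrictExp]
  rw [PowerSeries.coeff_subst_single, h1, if_pos]
  ext y
  by_cases hy : y = x
  · rw [hy, h1, Finsupp.single_eq_same]
  · rw [Finsupp.single_eq_of_ne hy]
    simp [restrictExp, hy]

/-- The coefficients of a product of series in single distinct variables. -/
theorem coeff_prod_subst_X {ι : Type*} [DecidableEq ι] {K : Finset ι} {x : ι → σ}
    (hx : Function.Injective x) (f : ι → PowerSeries R) (e : σ →₀ ℕ) :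
    MvPowerSeries.coeff (restrictExp e (K.image x))
      (∏ k ∈ K, (f k).subst (MvPowerSeries.X (x k) : MvPowerSeries σ R)) =
      ∏ k ∈ K, PowerSeries.coeff (e (x k)) (f k) := by
  have h1 : K.image x = K.biUnion fun k => {x k} := by
    ext y
    simp [eq_comm]
  rw [h1, coeff_prod_of_dependsOn ?_ fun k _ => dependsOn_subst_X (f k) (x k)]
  · exact Finset.prod_congr rfl fun k _ => coeff_subst_X_restrictExp _ _ _
  · intro k _ l _ hkl
    simpa [Function.onFun] using fun h => hkl (hx h)

theorem dependsOn_prod_subst_X {ι : Type*} [DecidableEq ι] (K : Finset ι) (x : ι → σ)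
    (f : ι → PowerSeries R) : DependsOn (K.image x)
      (∏ k ∈ K, (f k).subst (MvPowerSeries.X (x k) : MvPowerSeries σ R)) := by
  have h1 : K.image x = K.biUnion fun k => {x k} := by
    ext y
    simp [eq_comm]
  rw [h1]
  exact DependsOn.prod fun k _ => dependsOn_subst_X (f k) (x k)

end Disjoint

/-! ### The factors as power series -/

section Zeta

variable {s : ℕ}

theorem constantCoeff_zSum (K : Finset (Fin s)) : (zSum K).constantCoeff = 0 := by
  simp [zSum]

theorem zeta_eq (l : Series s) :
    zeta l = expSubst ((1 / 2 : ℚ) • l) - expSubst (-((1 / 2 : ℚ) • l)) := by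
  rw [zeta, expSubst, expSubst, ← neg_smul, neg_div]

theorem zeta_zero : zeta (0 : Series s) = 0 := by
  rw [zeta_eq, smul_zero, neg_zero, sub_self]

theorem expSubst_eq_one_of_zeta_eq_zero {l : Series s} (hl : l.constantCoeff = 0)
    (h : zeta l = 0) : expSubst l = 1 := by
  have hl' : ((1 / 2 : ℚ) • l).constantCoeff = 0 := by simp [hl]
  rw [zeta_eq, sub_eq_zero] at h
  calc expSubst l = expSubst ((1 / 2 : ℚ) • l + (1 / 2 : ℚ) • l) := by
        rw [← add_smul]
        norm_num
    _ = expSubst ((1 / 2 : ℚ) • l) * expSubst ((1 / 2 : ℚ) • l) := expSubst_add hl' hl'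
    _ = 1 := by
        nth_rewrite 2 [h]
        exact expSubst_mul_neg hl'

/-- The coefficient at a single variable is a product of coefficients of the exponential series,
hence nonzero, while that of `1` is zero. -/
theorem expSubst_sum_X_ne_one {σ ι : Type*} [DecidableEq σ] [DecidableEq ι] {K : Finset ι}
    (hK : K.Nonempty) {x : ι → σ} (hx : Function.Injective x) :
    expSubst (∑ k ∈ K, (MvPowerSeries.X (x k) : MvPowerSeries σ ℚ)) ≠ 1 := by
  intro h
  obtain ⟨k, hk⟩ := hK
  rw [expSubst_sum _ _ fun k _ => MvPowerSeries.constantCoeff_X _] at h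
  have h1 := coeff_prod_subst_X (K := K) hx (fun _ => PowerSeries.exp ℚ)
    (Finsupp.single (x k) 1)
  have h2 : ∏ k ∈ K, expSubst (MvPowerSeries.X (x k) : MvPowerSeries σ ℚ) = 1 := h
  unfold expSubst at h2
  rw [h2] at h1
  have h3 : restrictExp (Finsupp.single (x k) 1) (K.image x) = Finsupp.single (x k) 1 :=
    Finsupp.filter_single_of_pos _ (mem_image_of_mem x hk)
  rw [h3, MvPowerSeries.coeff_one, if_neg (by simp)] at h1
  refine (Finset.prod_ne_zero_iff.2 fun j _ => ?_) h1.symm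
  rw [PowerSeries.coeff_exp]
  simp only [eq_ratCast, Rat.cast_id]
  positivity

theorem zeta_zSum_ne_zero {K : Finset (Fin s)} (hK : K.Nonempty) : zeta (zSum K) ≠ 0 := fun h =>
  expSubst_sum_X_ne_one hK (Option.some_injective _)
    (expSubst_eq_one_of_zeta_eq_zero (constantCoeff_zSum K) h)

theorem zeta_tVar_ne_zero : zeta (tVar s) ≠ 0 := fun h => by
  have h1 := expSubst_eq_one_of_zeta_eq_zero (l := tVar s) (MvPowerSeries.constantCoeff_X _) h
  refine expSubst_sum_X_ne_one (singleton_nonempty none)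
    (Function.injective_id (α := Option (Fin s))) ?_
  rw [Finset.sum_singleton]
  exact h1

theorem zeta_finalArg_ne_zero (K : Finset (Fin s)) : zeta (finalArg K) ≠ 0 := by
  unfold finalArg
  split_ifs with h
  · exact zeta_tVar_ne_zero
  · exact zeta_zSum_ne_zero (nonempty_iff_ne_empty.2 h)

/-- The series `exp(z_k / 2)`. -/
noncomputable def cycleVar (k : Fin s) : Series s :=
  expSubst ((1 / 2 : ℚ) • MvPowerSeries.X (some k))

variable {𝔽 : Type*} [Field 𝔽] (f : Series s →+* 𝔽)

theorem map_zeta {l : Series s} (hl : l.constantCoeff = 0) : f (zeta l) =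
    f (expSubst ((1 / 2 : ℚ) • l)) - (f (expSubst ((1 / 2 : ℚ) • l)))⁻¹ := by
  have hl' : ((1 / 2 : ℚ) • l).constantCoeff = 0 := by simp [hl]
  rw [zeta_eq, map_sub]
  congr 1
  refine eq_inv_of_mul_eq_one_right ?_
  rw [← map_mul, expSubst_mul_neg hl', map_one]

theorem map_expSubst_zSum (e : ℤ) (K : Finset (Fin s)) :
    f (expSubst ((1 / 2 : ℚ) • (e : ℚ) • zSum K)) = (∏ k ∈ K, f (cycleVar k)) ^ e := by
  have h1 : (1 / 2 : ℚ) • (e : ℚ) • zSum K =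
      e • ∑ k ∈ K, (1 / 2 : ℚ) • (MvPowerSeries.X (some k) : Series s) := by
    rw [smul_comm, ← Finset.smul_sum, Int.cast_smul_eq_zsmul]
    rfl
  rw [h1, map_expSubst_zsmul f, expSubst_sum, map_prod]
  · rfl
  · intro k _
    simp
  · simp

theorem map_zetaFactor {m n : ℕ} (μ : Fin m → ℕ) (ν : Fin n → ℕ) {a b : Op m n s}
    (h : ¬ (a.K = ∅ ∧ b.K = ∅ ∧ a.energy μ ν + b.energy μ ν = 0)) :
    f (zetaFactor μ ν a b) = commFactor μ ν (fun k => f (cycleVar k)) a b := by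
  have hc : ∀ (e : ℤ) (K : Finset (Fin s)),
      ((1 / 2 : ℚ) • (e : ℚ) • zSum K).constantCoeff = 0 := fun e K => by
    simp [constantCoeff_zSum]
  rw [zetaFactor, if_neg h, commFactor, if_neg h, map_zeta]
  · have h1 : (1 / 2 : ℚ) • ((a.energy μ ν : ℚ) • zSum b.K - (b.energy μ ν : ℚ) • zSum a.K) =
        (1 / 2 : ℚ) • (a.energy μ ν : ℚ) • zSum b.K +
          (1 / 2 : ℚ) • ((-b.energy μ ν : ℤ) : ℚ) • zSum a.K := by
      rw [Int.cast_neg, neg_smul, smul_neg, smul_sub, sub_eq_add_neg]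
    rw [h1, expSubst_add (hc _ _) (hc _ _), map_mul, map_expSubst_zSum, map_expSubst_zSum, mul_inv,
      ← zpow_neg, ← zpow_neg, neg_neg]
  · simp [constantCoeff_zSum]

theorem map_cycleVar_ne_zero (k : Fin s) : f (cycleVar k) ≠ 0 := by
  have h := congrArg f (expSubst_mul_neg (l := (1 / 2 : ℚ) • (MvPowerSeries.X (some k) : Series s))
    (by simp))
  rw [map_mul, map_one] at h
  exact left_ne_zero_of_mul_eq_one h

theorem map_zeta_zSum (K : Finset (Fin s)) : f (zeta (zSum K)) =
    ∏ k ∈ K, f (cycleVar k) - (∏ k ∈ K, f (cycleVar k))⁻¹ := by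
  rw [map_zeta f (constantCoeff_zSum K)]
  have := map_expSubst_zSum f 1 K
  rw [Int.cast_one, one_smul, zpow_one] at this
  rw [this]

theorem prod_map_cycleVar_ne_inv (hf : Function.Injective f) {K : Finset (Fin s)} (hK : K ≠ ∅) :
    ∏ k ∈ K, f (cycleVar k) ≠ (∏ k ∈ K, f (cycleVar k))⁻¹ := by
  intro h
  have h1 := map_zeta_zSum f K
  rw [sub_eq_zero.2 h] at h1
  exact zeta_zSum_ne_zero (nonempty_iff_ne_empty.2 hK) ((map_eq_zero_iff f hf).1 h1)

end Zeta

/-! ### Products of factors along runs -/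

section RunProducts

variable {m n s : ℕ} {μ : Fin m → ℕ} {ν : Fin n → ℕ} {𝔽 : Type*} [Field 𝔽]

theorem zetaProd_cons (a b : Op m n s) (P : List (Op m n s × Op m n s)) :
    zetaProd μ ν ((a, b) :: P) = zetaFactor μ ν a b * zetaProd μ ν P := by
  simp [zetaProd]

theorem factorProd_cons (q : Fin s → 𝔽) (a b : Op m n s) (P : List (Op m n s × Op m n s)) :
    factorProd μ ν q ((a, b) :: P) = commFactor μ ν q a b * factorProd μ ν q P := by
  simp [factorProd]

theorem zetaFactor_eq_zero {a b : Op m n s} (hb : b.energy μ ν < 0) (hK : a.K = ∅)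
    (ha : a.energy μ ν = 0) : zetaFactor μ ν a b = 0 := by
  rw [zetaFactor, if_neg (by rintro ⟨-, -, h⟩; omega), ha, hK]
  simp [zSum, zeta_zero]

theorem commFactor_eq_zero (q : Fin s → 𝔽) {a b : Op m n s} (hb : b.energy μ ν < 0)
    (hK : a.K = ∅) (ha : a.energy μ ν = 0) : commFactor μ ν q a b = 0 := by
  rw [commFactor, if_neg (by rintro ⟨-, -, h⟩; omega), ha, hK]
  simp

/-- The unit operator does not contribute to connected patterns. -/
theorem prod_eq_zero_of_trivial (q : Fin s → 𝔽) {w w' : List (Op m n s)}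
    {P : List (Op m n s × Op m n s)} (h : Run μ ν w P w') (hl : w'.length = 1)
    (hw : 2 ≤ w.length) {c : Op m n s} (hc : c ∈ w) (hK : c.K = ∅) (he : c.energy μ ν = 0) :
    zetaProd μ ν P = 0 ∧ factorProd μ ν q P = 0 := by
  induction h with
  | done w _ => omega
  | pass u v a b P w' hu ha hb h ih =>
    refine ih hl (by simpa using hw) ?_
    exact (swap_perm u v a b).mem_iff.1 hc
  | commutator u v a b P w' hu ha hb h ih =>
    rw [zetaProd_cons, factorProd_cons]
    -- An operator of energy zero can only be the left member of a commutator. As the run ends with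
    -- a single operator, `c` is eventually used in this way, with factor `ζ(0) = 0`.
    by_cases hca : c = a
    · rw [← hca, zetaFactor_eq_zero hb hK he, commFactor_eq_zero q hb hK he, zero_mul, zero_mul]
      exact ⟨rfl, rfl⟩
    · have hcb : c ≠ b := by
        rintro rfl
        omega
      have hc' : c ∈ u ∨ c ∈ v := by simpa [hca, hcb] using hc
      have h2 := ih hl ?_ ?_
      · rw [h2.1, h2.2, mul_zero, mul_zero]
        exact ⟨rfl, rfl⟩
      · rcases hc' with hc' | hc'
        · have := List.length_pos_of_mem hc'
          rw [List.length_append, List.length_cons]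
          omega
        · have := List.length_pos_of_mem hc'
          rw [List.length_append, List.length_cons]
          omega
      · rw [List.mem_append, List.mem_cons]
        tauto

/-- The two kinds of factors correspond under `f` except for `ζ(e t)`. Such a factor leaves an
identity operator beside one that carries a cycle, so both products vanish by
`prod_eq_zero_of_trivial`. -/
theorem map_zetaProd (f : Series s →+* 𝔽) {w w' : List (Op m n s)}
    {P : List (Op m n s × Op m n s)} (h : Run μ ν w P w') (hl : w'.length = 1) (hg : Good w)
    (hK : ∃ c ∈ w, c.K ≠ ∅) :
    f (zetaProd μ ν P) = factorProd μ ν (fun k => f (cycleVar k)) P := by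
  induction h with
  | done w _ => simp [zetaProd, factorProd]
  | pass u v a b P w' hu ha hb h ih =>
    refine ih hl hg.swap ?_
    simpa only [(swap_perm u v a b).mem_iff] using hK
  | commutator u v a b P w' hu ha hb h ih =>
    rw [zetaProd_cons, factorProd_cons]
    have hK' : ∃ c ∈ u ++ a.merge b :: v, c.K ≠ ∅ := by
      obtain ⟨c, hc, hcK⟩ := hK
      simp only [List.mem_append, List.mem_cons] at hc
      rcases hc with hc | rfl | rfl | hc
      · exact ⟨c, by simp [hc], hcK⟩
      · exact ⟨c.merge b, by simp, fun h => hcK (Finset.union_eq_empty.1 h).1⟩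
      · exact ⟨a.merge c, by simp, fun h => hcK (Finset.union_eq_empty.1 h).2⟩
      · exact ⟨c, by simp [hc], hcK⟩
    by_cases ht : a.K = ∅ ∧ b.K = ∅ ∧ a.energy μ ν + b.energy μ ν = 0
    · have hmK : (a.merge b).K = ∅ := Finset.union_eq_empty.2 ⟨ht.1, ht.2.1⟩
      have h2 := prod_eq_zero_of_trivial (fun k => f (cycleVar k)) h hl ?_
        (c := a.merge b) (by simp) hmK (by rw [Op.energy_merge μ ν hg.disjoint, ht.2.2])
      · rw [h2.1, h2.2, mul_zero, mul_zero, map_zero]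
      · obtain ⟨c, hc, hcK⟩ := hK'
        have hcm : c ≠ a.merge b := fun h => hcK (h ▸ hmK)
        simp only [List.mem_append, List.mem_cons, hcm, false_or] at hc
        rw [List.length_append, List.length_cons]
        rcases hc with hc | hc
        · have := List.length_pos_of_mem hc
          omega
        · have := List.length_pos_of_mem hc
          omega
    · rw [map_mul, map_zetaFactor f μ ν ht, ih hl hg.merge hK']

/-- `ζ(e t)` is divisible by `ζ(t)`, and the quotient is `e` at `t = 0`. -/
theorem exists_zeta_natCast_smul (e : ℕ) : ∃ U : Series s,
    zeta ((e : ℚ) • tVar s) = zeta (tVar s) * U ∧ U.constantCoeff = e := by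
  have ht : ((1 / 2 : ℚ) • tVar s).constantCoeff = 0 := by simp [tVar]
  have ht' : (-((1 / 2 : ℚ) • tVar s)).constantCoeff = 0 := by simp [tVar]
  have h1 : (1 / 2 : ℚ) • (e : ℚ) • tVar s = e • ((1 / 2 : ℚ) • tVar s) := by
    rw [smul_comm, Nat.cast_smul_eq_nsmul]
  have hc : ∀ l : Series s, l.constantCoeff = 0 → (expSubst l).constantCoeff = 1 := by
    intro l hl
    have := MvPowerSeries.coeff_zero_eq_constantCoeff_apply (expSubst l)
    rw [← this, expSubst, PowerSeries.coeff_subst (.of_constantCoeff_zero hl),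
      finsum_eq_single _ 0]
    · simp
    · intro j hj
      simp [hl, hj]
  refine ⟨∑ i ∈ range e, expSubst ((1 / 2 : ℚ) • tVar s) ^ i *
    expSubst (-((1 / 2 : ℚ) • tVar s)) ^ (e - 1 - i), ?_, ?_⟩
  · rw [zeta_eq, zeta_eq, h1, ← smul_neg, expSubst_nsmul ht, expSubst_nsmul ht', mul_comm,
      geom_sum₂_mul]
  · simp only [map_sum, map_mul, map_pow, hc _ ht, hc _ ht', one_pow, mul_one, Finset.sum_const,
      card_range, nsmul_eq_mul]

/-- Without cycles, a commutator of nonzero total energy has factor `ζ(0) = 0`. One of total energy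
zero leaves an identity operator, so both products vanish unless that is the whole remaining word.
What survives is one factor `ζ(e t)`, which is divisible by `ζ(t)`. -/
theorem exists_zetaProd_eq {μ : Fin m → ℕ} {ν : Fin n → ℕ} {w w' : List (Op m n 0)}
    {P : List (Op m n 0 × Op m n 0)} (q : Fin 0 → ℚ) (h : Run μ ν w P w') (hl : w'.length = 1)
    (hg : Good w) (hw : 2 ≤ w.length) : ∃ U : Series 0,
      zetaProd μ ν P = zeta (tVar 0) * U ∧ U.constantCoeff = factorProd μ ν q P := by
  induction h with
  | done w _ => omega
  | pass u v a b P w' hu ha hb h ih => exact ih hl hg.swap (by simpa using hw)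
  | commutator u v a b P w' hu ha hb h ih =>
    rw [zetaProd_cons, factorProd_cons]
    have hK : ∀ K : Finset (Fin 0), K = ∅ := fun K => Subsingleton.elim _ _
    by_cases ht : a.energy μ ν + b.energy μ ν = 0
    · have hme : (a.merge b).energy μ ν = 0 := by rw [Op.energy_merge μ ν hg.disjoint, ht]
      by_cases hlen : 2 ≤ (u ++ a.merge b :: v).length
      · have h2 := prod_eq_zero_of_trivial q h hl hlen (c := a.merge b) (by simp) (hK _) hme
        rw [h2.1, h2.2]
        exact ⟨0, by simp, by simp⟩
      · rw [List.length_append, List.length_cons] at hlen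
        obtain rfl : u = [] := List.eq_nil_of_length_eq_zero (by omega)
        obtain rfl : v = [] := List.eq_nil_of_length_eq_zero (by omega)
        obtain ⟨-, rfl, -⟩ := run_of_nonneg (by simp [hme]) h
        obtain ⟨e, he⟩ := Int.eq_ofNat_of_zero_le ha
        obtain ⟨U, hU, hU'⟩ := exists_zeta_natCast_smul (s := 0) e
        refine ⟨U, ?_, ?_⟩
        · rw [zetaFactor, if_pos ⟨hK _, hK _, ht⟩, he, zetaProd, List.map_nil, List.prod_nil,
            mul_one, Int.cast_natCast, hU]
        · rw [commFactor, if_pos ⟨hK _, hK _, ht⟩, he, factorProd, List.map_nil, List.prod_nil,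
            mul_one, Int.cast_natCast, hU']
    · refine ⟨0, ?_, ?_⟩
      · rw [zetaFactor, if_neg (by tauto), hK a.K, hK b.K]
        simp [zSum, zeta_zero]
      · rw [commFactor, if_neg (by tauto), hK a.K, hK b.K]
        simp

end RunProducts

/-! ### Generating series of Hurwitz numbers -/

section Generating

variable {m n s : ℕ}

/-- The generating series of the shifted symmetric power sums of a Young diagram. -/
noncomputable def powerSumSeries (Y : YoungDiagram) : PowerSeries ℚ :=
  ∑ i ∈ range (Y.colLen 0),
    (PowerSeries.rescale ((Y.rowLen i : ℚ) - ((i : ℚ) + 1) + 1 / 2) (PowerSeries.exp ℚ) -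
      PowerSeries.rescale (-((i : ℚ) + 1) + 1 / 2) (PowerSeries.exp ℚ))

theorem coeff_powerSumSeries (Y : YoungDiagram) (k : ℕ) :
    PowerSeries.coeff k (powerSumSeries Y) = shiftedPowerSum k Y / (k.factorial : ℚ) := by
  rw [powerSumSeries, map_sum, shiftedPowerSum, Finset.sum_div]
  refine Finset.sum_congr rfl fun i _ => ?_
  rw [map_sub, PowerSeries.coeff_rescale, PowerSeries.coeff_rescale, PowerSeries.coeff_exp]
  simp only [eq_ratCast, Rat.cast_id]
  ring

variable {𝔽 : Type*} [Field 𝔽] (f : Series s →+* 𝔽)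

theorem map_rescale_exp_subst {c : ℚ} {j : ℤ} (h : c = j / 2) (k : Fin s) :
    f ((PowerSeries.rescale c (PowerSeries.exp ℚ)).subst
      (MvPowerSeries.X (some k) : Series s)) = f (cycleVar k) ^ j := by
  rw [← expSubst_smul_X, cycleVar, ← map_expSubst_zsmul f (by simp), ← Int.cast_smul_eq_zsmul ℚ,
    smul_smul, h]
  congr 3
  ring

theorem map_powerSumSeries_subst (Y : YoungDiagram) (k : Fin s) :
    f ((powerSumSeries Y).subst (MvPowerSeries.X (some k) : Series s)) =
      cycleEigenvalue Y (f (cycleVar k)) := by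
  have hX : PowerSeries.HasSubst (MvPowerSeries.X (some k) : Series s) := PowerSeries.HasSubst.X _
  have h1 : (powerSumSeries Y).subst (MvPowerSeries.X (some k) : Series s) =
      PowerSeries.substAlgHom (R := ℚ) hX (powerSumSeries Y) := by
    rw [PowerSeries.coe_substAlgHom]
  rw [h1, powerSumSeries, map_sum, map_sum, cycleEigenvalue]
  refine Finset.sum_congr rfl fun i _ => ?_
  rw [map_sub, map_sub, PowerSeries.coe_substAlgHom]
  congr 1
  · refine map_rescale_exp_subst f ?_ k
    push_cast
    ring
  · refine map_rescale_exp_subst f ?_ k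
    push_cast
    ring

theorem map_smul_series (c : ℚ) (x : Series s) : f (c • x) = (c : 𝔽) * f x := by
  rw [MvPowerSeries.smul_eq_C_mul, map_mul]
  congr 1
  exact eq_ratCast (f.comp MvPowerSeries.C) c

/-- The generating series of the disconnected Hurwitz numbers of a set of labels. -/
noncomputable def hurwitzSeries (μ : Fin m → ℕ) (ν : Fin n → ℕ)
    (B : Finset (Fin m ⊕ Fin n ⊕ Fin s)) : Series s :=
  if (leftParts μ B).sum = (rightParts ν B).sum then
    ∑ p : Nat.Partition (leftParts μ B).sum,
      (irrChar (diagram p) (leftParts μ B) * irrChar (diagram p) (rightParts ν B)) •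
        ∏ k ∈ cycles B, (powerSumSeries (diagram p)).subst (MvPowerSeries.X (some k) : Series s)
  else 0

theorem map_hurwitzSeries [CharZero 𝔽] {μ : Fin m → ℕ} {ν : Fin n → ℕ} (hμ : ∀ i, 0 < μ i)
    (hν : ∀ j, 0 < ν j) (B : Finset (Fin m ⊕ Fin n ⊕ Fin s)) :
    f (hurwitzSeries μ ν B) = vev μ ν (fun k => f (cycleVar k)) (startOn B) := by
  rw [vev_startOn_eq hμ hν, hurwitzSeries]
  split_ifs with h
  · rw [map_sum]
    refine Finset.sum_congr rfl fun p _ => ?_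
    rw [map_smul_series, map_prod]
    simp only [map_powerSumSeries_subst]
    push_cast
    ring
  · exact map_zero f

/-- The variables of the completed cycles with labels in `B`. -/
def cycleVars (B : Finset (Fin m ⊕ Fin n ⊕ Fin s)) : Finset (Option (Fin s)) :=
  (cycles B).image some

theorem dependsOn_hurwitzSeries (μ : Fin m → ℕ) (ν : Fin n → ℕ)
    (B : Finset (Fin m ⊕ Fin n ⊕ Fin s)) : DependsOn (cycleVars B) (hurwitzSeries μ ν B) := by
  intro e he
  unfold hurwitzSeries
  split_ifs
  · rw [map_sum]
    refine Finset.sum_eq_zero fun p _ => ?_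
    rw [MvPowerSeries.coeff_smul, dependsOn_prod_subst_X _ _ _ e he, mul_zero]
  · exact map_zero _

/-- The exponent of `z_1^{r+1} ⋯ z_s^{r+1}`. -/
noncomputable def cycleExp (s r : ℕ) : Option (Fin s) →₀ ℕ :=
  Finsupp.equivFunOnFinite.symm fun x : Option (Fin s) => x.elim 0 fun _ => r + 1

theorem coeff_hurwitzSeries (r : ℕ) {μ : Fin m → ℕ} {ν : Fin n → ℕ} (hμ : ∀ i, 0 < μ i)
    (hν : ∀ j, 0 < ν j) (B : Finset (Fin m ⊕ Fin n ⊕ Fin s)) :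
    MvPowerSeries.coeff (restrictExp (cycleExp s r) (cycleVars B)) (hurwitzSeries μ ν B) =
      (((leftParts μ B).prod : ℚ) * ((rightParts ν B).prod : ℚ)) * hurwitzOn r μ ν B := by
  change _ = _ * hurwitz r #(cycles B) (leftParts μ B) (rightParts ν B)
  unfold hurwitzSeries hurwitz
  have h1 : ((leftParts μ B).prod : ℚ) ≠ 0 := by
    rw [Nat.cast_ne_zero]
    refine Multiset.prod_ne_zero fun h => ?_
    obtain ⟨i, -, hi⟩ := Multiset.mem_map.1 h
    exact (hμ i).ne' hi
  have h2 : ((rightParts ν B).prod : ℚ) ≠ 0 := by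
    rw [Nat.cast_ne_zero]
    refine Multiset.prod_ne_zero fun h => ?_
    obtain ⟨j, -, hj⟩ := Multiset.mem_map.1 h
    exact (hν j).ne' hj
  split_ifs
  · rw [← mul_assoc, mul_one_div_cancel (mul_ne_zero h1 h2), one_mul, map_sum]
    refine Finset.sum_congr rfl fun p _ => ?_
    rw [MvPowerSeries.coeff_smul, cycleVars, coeff_prod_subst_X (Option.some_injective _)]
    simp only [coeff_powerSumSeries]
    have h3 : ∀ k : Fin s, cycleExp s r (some k) = r + 1 := fun _ => rfl
    simp only [h3, Finset.prod_const]
    ring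
  · rw [map_zero, mul_zero]

/-- The weight of a label. -/
def labelWeight (μ : Fin m → ℕ) (ν : Fin n → ℕ) : Fin m ⊕ Fin n ⊕ Fin s → ℚ :=
  Sum.elim (fun i => (μ i : ℚ)) (Sum.elim (fun j => (ν j : ℚ)) fun _ => 1)

theorem prod_labelWeight (μ : Fin m → ℕ) (ν : Fin n → ℕ) (B : Finset (Fin m ⊕ Fin n ⊕ Fin s)) :
    ∏ x ∈ B, labelWeight μ ν x = ((leftParts μ B).prod : ℚ) * ((rightParts ν B).prod : ℚ) := by
  have h1 : (leftParts μ B).prod = ∏ i ∈ univ.filter (fun i : Fin m => Sum.inl i ∈ B), μ i := rfl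
  have h2 : (rightParts ν B).prod =
      ∏ j ∈ univ.filter (fun j : Fin n => Sum.inr (Sum.inl j) ∈ B), ν j := rfl
  have h3 : B = univ.filter (· ∈ B) := by simp
  rw [h1, h2, Nat.cast_prod, Nat.cast_prod]
  conv_lhs => rw [h3]
  simp only [Finset.prod_filter, Fintype.prod_sum_type, labelWeight, Sum.elim_inl, Sum.elim_inr,
    ite_self, Finset.prod_const_one, mul_one]

theorem restrictExp_cycleExp (r : ℕ) :
    restrictExp (cycleExp s r) (cycleVars (univ : Finset (Fin m ⊕ Fin n ⊕ Fin s))) =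
      cycleExp s r := by
  ext x
  rcases x with _ | k
  · simp [restrictExp, Finsupp.filter_apply, cycleExp]
  · simp [restrictExp, cycleVars, cycles]

theorem map_moebiusCoeff {R S : Type*} [CommRing R] [CommRing S] (g : R →+* S) (k : ℕ) :
    g (moebiusCoeff R k) = moebiusCoeff S k := by
  simp [moebiusCoeff]

theorem map_cumulant {L R S : Type*} [Fintype L] [DecidableEq L] [CommRing R] [CommRing S]
    (g : R →+* S) (D : Finset L → R) (B : Finset L) :
    g (cumulant D B) = cumulant (fun A => g (D A)) B := by
  simp only [cumulant, map_sum, map_mul, map_moebiusCoeff, map_prod]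

theorem connectedHurwitz_eq_cumulant (r : ℕ) (μ : Fin m → ℕ) (ν : Fin n → ℕ) :
    connectedHurwitz r s μ ν = cumulant (hurwitzOn (s := s) r μ ν) univ :=
  sum_finpartition (R := ℚ) (univ : Finset (Fin m ⊕ Fin n ⊕ Fin s))
    fun T => moebiusCoeff ℚ #T * ∏ B ∈ T, hurwitzOn r μ ν B

/-- The coefficient of a product over the blocks of a set partition factors, because each completed
cycle belongs to exactly one block and the series of a block involves only its own variables. The
products of the parts multiply over the blocks in the same way. -/
theorem coeffAt_cumulant (r : ℕ) {μ : Fin m → ℕ} {ν : Fin n → ℕ} (hμ : ∀ i, 0 < μ i)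
    (hν : ∀ j, 0 < ν j) :
    coeffAt r (cumulant (hurwitzSeries (s := s) μ ν) univ) =
      ((∏ i, (μ i : ℚ)) * ∏ j, (ν j : ℚ)) * connectedHurwitz r s μ ν := by
  rw [connectedHurwitz_eq_cumulant, cumulant, cumulant, Finset.mul_sum]
  change MvPowerSeries.coeff (cycleExp s r) _ = _
  rw [map_sum]
  refine Finset.sum_congr rfl fun T hT => ?_
  rw [mem_setPartitions] at hT
  have hcover : T.biUnion cycleVars =
      cycleVars (univ : Finset (Fin m ⊕ Fin n ⊕ Fin s)) := by
    ext x
    simp only [mem_biUnion, cycleVars, cycles, mem_image, mem_filter, mem_univ, true_and]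
    constructor
    · rintro ⟨S, -, k, -, rfl⟩
      exact ⟨k, rfl⟩
    · rintro ⟨k, rfl⟩
      obtain ⟨S, hS, hk⟩ := hT.cover (Sum.inr (Sum.inr k)) (mem_univ _)
      exact ⟨S, hS, k, hk, rfl⟩
  have hw : (∏ i, (μ i : ℚ)) * ∏ j, (ν j : ℚ) =
      ∏ S ∈ T, (((leftParts μ S).prod : ℚ) * ((rightParts ν S).prod : ℚ)) := by
    simp only [← prod_labelWeight]
    rw [← Finset.prod_biUnion (f := labelWeight μ ν) (t := fun S => S)]
    · have : T.biUnion (fun S => S) = univ := by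
        ext x
        simp only [mem_biUnion, mem_univ, iff_true]
        exact hT.cover x (mem_univ x)
      rw [this]
      simp [Fintype.prod_sum_type, labelWeight]
    · intro S hS S' hS' hne
      rw [Function.onFun, Finset.disjoint_left]
      exact fun y hy hy' => hne (hT.unique S hS S' hS' y hy hy')
  rw [← map_moebiusCoeff (MvPowerSeries.C (σ := Option (Fin s)) (R := ℚ)),
    MvPowerSeries.coeff_C_mul]
  have h1 : MvPowerSeries.coeff (cycleExp s r) (∏ S ∈ T, hurwitzSeries μ ν S) =
      ∏ S ∈ T, ((((leftParts μ S).prod : ℚ) * ((rightParts ν S).prod : ℚ)) *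
        hurwitzOn r μ ν S) := by
    rw [← restrictExp_cycleExp (m := m) (n := n) r, ← hcover, coeff_prod_of_dependsOn ?_
      fun S _ => dependsOn_hurwitzSeries μ ν S]
    · exact Finset.prod_congr rfl fun S _ => coeff_hurwitzSeries r hμ hν S
    · intro S hS S' hS' hne
      rw [Function.onFun, Finset.disjoint_left]
      intro x hx hx'
      simp only [cycleVars, cycles, mem_image, mem_filter, mem_univ, true_and] at hx hx'
      obtain ⟨k, hk, rfl⟩ := hx
      obtain ⟨k', hk', he⟩ := hx'
      rw [Option.some_injective _ he] at hk'
      exact hne (hT.unique S hS S' hS' _ hk hk')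
  rw [h1, Finset.prod_mul_distrib, ← hw]
  ring

end Generating

/-! ### Connected patterns -/

section Connected

variable {m n s : ℕ} {μ : Fin m → ℕ} {ν : Fin n → ℕ}

theorem connectedPatterns_eq : connectedPatterns s μ ν =
    patterns μ ν (startOps m n s) ∩ Function.support (zetaProd μ ν) := by
  ext P
  simp only [connectedPatterns, IsCommutationPattern, patterns, Set.mem_ofPred_eq,
    Set.mem_inter_iff, Function.mem_support]
  constructor
  · rintro ⟨w, ⟨h1, h2, h3⟩, h4⟩
    exact ⟨⟨w, h1, h4, h3⟩, h2⟩
  · rintro ⟨⟨w, h1, h4, h3⟩, h2⟩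
    exact ⟨w, ⟨h1, h2, h3⟩, h4⟩

theorem finsum_connectedPatterns : ∑ᶠ P ∈ connectedPatterns s μ ν, zetaProd μ ν P =
    ∑ᶠ P ∈ patterns μ ν (startOps m n s), zetaProd μ ν P := by
  rw [connectedPatterns_eq, finsum_mem_inter_support]

/-- As the empty word has expectation `1`, the recursion `vev_startOn` determines the connected
values, and the cumulant of the expectations satisfies it as well. -/
theorem connectedVev_startOps {𝔽 : Type*} [Field 𝔽] [CharZero 𝔽] (f : Series s →+* 𝔽)
    (hμ : ∀ i, 0 < μ i) (hν : ∀ j, 0 < ν j) (hm : 0 < m)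
    (hq : ∀ K : Finset (Fin s), K ≠ ∅ → ∏ k ∈ K, f (cycleVar k) ≠ (∏ k ∈ K, f (cycleVar k))⁻¹) :
    connectedVev μ ν (fun k => f (cycleVar k)) (startOps m n s) =
      f (cumulant (hurwitzSeries μ ν) univ) := by
  rw [map_cumulant]
  simp only [map_hurwitzSeries f hμ hν]
  rw [← startOn_univ]
  refine eq_cumulant (D := fun B => vev μ ν (fun k => f (cycleVar k)) (startOn B))
    (C := fun B => connectedVev μ ν (fun k => f (cycleVar k)) (startOn B)) ?_ ?_ univ
    ⟨Sum.inl ⟨0, hm⟩, mem_univ _⟩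
  · rw [startOn_empty, vev_of_energy_eq_zero (by simp)]
    simp
  · intro B x hx
    exact vev_startOn (map_cycleVar_ne_zero f) hq hx

theorem two_le_length_startOps (hm : 0 < m) (hμ : ∀ i, 0 < μ i)
    (hd : ∑ i, μ i = ∑ j, ν j) : 2 ≤ (startOps m n s).length := by
  have hn : 0 < n := by
    by_contra h
    obtain rfl : n = 0 := by omega
    rw [Finset.univ_eq_empty (α := Fin 0), Finset.sum_empty] at hd
    have := Finset.single_le_sum (f := μ) (fun i _ => Nat.zero_le _) (mem_univ (⟨0, hm⟩ : Fin m))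
    have := hμ ⟨0, hm⟩
    omega
  simp [startOps]
  omega

theorem wordCycles_startOps : wordCycles (startOps m n s) = univ := by
  ext k
  simp only [wordCycles, mem_filter, mem_univ, true_and, iff_true]
  exact mem_wordLabels.2 (exists_startOps _)

/-- Divisibility holds because the quotient is known: it is the cumulant of the generating series.
The comparison takes place in the fraction field, where the inverses of the `ζ(z_K)` exist, and it
descends since the embedding is injective. -/
theorem sum_zetaProd_of_pos (hs : 0 < s) (hm : 0 < m) (hμ : ∀ i, 0 < μ i) (hν : ∀ j, 0 < ν j) :
    zeta (finalArg (univ : Finset (Fin s))) * cumulant (hurwitzSeries μ ν) univ =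
      ∑ᶠ P ∈ connectedPatterns s μ ν, zetaProd μ ν P := by
  let f : Series s →+* FractionRing (Series s) := algebraMap _ _
  have hf : Function.Injective f := IsFractionRing.injective _ _
  have hne : (univ : Finset (Fin s)) ≠ ∅ :=
    Finset.Nonempty.ne_empty ⟨⟨0, hs⟩, mem_univ _⟩
  have hq := fun K : Finset (Fin s) => prod_map_cycleVar_ne_inv f hf (K := K)
  have : CharZero (FractionRing (Series s)) :=
    charZero_of_injective_algebraMap (R := ℚ) (algebraMap ℚ (FractionRing (Series s))).injective
  apply hf
  rw [map_mul, ← connectedVev_startOps f hμ hν hm hq, finalArg, if_neg hne, map_zeta_zSum,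
    connectedVev, wordCycles_startOps, invZeta, if_neg hne, mul_comm, mul_assoc,
    inv_mul_cancel₀ (sub_ne_zero.2 (hq _ hne)), mul_one, finsum_connectedPatterns, patternSum]
  change _ = f.toAddMonoidHom (∑ᶠ P ∈ patterns μ ν (startOps m n s), zetaProd μ ν P)
  rw [AddMonoidHom.map_finsum_mem _ _ (patterns_finite _)]
  refine finsum_mem_congr rfl fun P hP => ?_
  obtain ⟨w', hr, hl, -⟩ := hP
  refine (map_zetaProd f hr hl startOps_good ?_).symm
  exact ⟨⟨∅, ∅, {⟨0, hs⟩}⟩, mem_startOps.2 (Or.inr (Or.inl ⟨_, rfl⟩)), singleton_ne_empty _⟩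

/-- Here `t` is the only variable and the required coefficient is the constant term. So the field is
`ℚ`, reached by the constant term, and `ζ(t)` is divided out of each pattern separately. -/
theorem exists_quotient_of_zero {μ : Fin m → ℕ} {ν : Fin n → ℕ} (r : ℕ) (hm : 0 < m)
    (hμ : ∀ i, 0 < μ i) (hν : ∀ j, 0 < ν j) (hd : ∑ i, μ i = ∑ j, ν j) : ∃ Q : Series 0,
    zeta (finalArg (univ : Finset (Fin 0))) * Q = ∑ᶠ P ∈ connectedPatterns 0 μ ν, zetaProd μ ν P ∧
    coeffAt r Q = coeffAt r (cumulant (hurwitzSeries μ ν) (univ : Finset (Fin m ⊕ Fin n ⊕ Fin 0))) := by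
  let f : Series 0 →+* ℚ := MvPowerSeries.constantCoeff
  have key : ∀ P, ∃ U : Series 0, P ∈ patterns μ ν (startOps m n 0) →
      zetaProd μ ν P = zeta (tVar 0) * U ∧
        U.constantCoeff = factorProd μ ν (fun k => f (cycleVar k)) P := by
    intro P
    by_cases hP : P ∈ patterns μ ν (startOps m n 0)
    · obtain ⟨w', hr, hl, -⟩ := id hP
      obtain ⟨U, hU⟩ := exists_zetaProd_eq (fun k => f (cycleVar k)) hr hl startOps_good
        (two_le_length_startOps hm hμ hd)
      exact ⟨U, fun _ => hU⟩
    · exact ⟨0, fun h => absurd h hP⟩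
  choose U hU using key
  have h0 : cycleExp 0 r = 0 := by
    refine Finsupp.ext fun x => ?_
    rcases x with _ | k
    · rfl
    · exact k.elim0
  have hcoeff : ∀ Q : Series 0, coeffAt r Q = f Q := fun Q => by
    change MvPowerSeries.coeff (cycleExp 0 r) Q = _
    rw [h0, MvPowerSeries.coeff_zero_eq_constantCoeff_apply]
  have huniv : (univ : Finset (Fin 0)) = ∅ := rfl
  refine ⟨∑ᶠ P ∈ patterns μ ν (startOps m n 0), U P, ?_, ?_⟩
  · rw [finsum_connectedPatterns, finalArg, if_pos huniv, mul_finsum_mem' _ _ (patterns_finite _)]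
    exact finsum_mem_congr rfl fun P hP => (hU P hP).1.symm
  · rw [hcoeff, hcoeff, ← connectedVev_startOps f hμ hν hm fun K hK =>
      absurd (Subsingleton.elim K ∅) hK, connectedVev, wordCycles_startOps, invZeta, if_pos huniv,
      mul_one, patternSum]
    change f.toAddMonoidHom _ = _
    rw [AddMonoidHom.map_finsum_mem _ _ (patterns_finite _)]
    exact finsum_mem_congr rfl fun P hP => (hU P hP).2

end Connected
end CompletedCycles

open CompletedCycles in
theorem theorem4p9 (r m n s : ℕ) (hr : 1 ≤ r) (μ : Fin m → ℕ) (ν : Fin n → ℕ) (hm : 0 < m)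
    (hμ : ∀ i, 0 < μ i) (hν : ∀ j, 0 < ν j) (hd : ∑ i, μ i = ∑ j, ν j) :
    (connectedPatterns s μ ν).Finite ∧
    zeta (finalArg (Finset.univ : Finset (Fin s))) ≠ 0 ∧
    ∃ Q : Series s,
      zeta (finalArg Finset.univ) * Q = ∑ᶠ P ∈ connectedPatterns s μ ν, zetaProd μ ν P ∧
      connectedHurwitz r s μ ν =
        1 / ((∏ i, (μ i : ℚ)) * ∏ j, (ν j : ℚ)) * coeffAt r Q := by
  have hfin : (connectedPatterns s μ ν).Finite := by
    rw [connectedPatterns_eq]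
    exact (patterns_finite _).inter_of_left _
  have hw : (∏ i, (μ i : ℚ)) * ∏ j, (ν j : ℚ) ≠ 0 :=
    mul_ne_zero (Finset.prod_ne_zero_iff.2 fun i _ => Nat.cast_ne_zero.2 (hμ i).ne')
      (Finset.prod_ne_zero_iff.2 fun j _ => Nat.cast_ne_zero.2 (hν j).ne')
  have hQ : ∃ Q : Series s,
      zeta (finalArg Finset.univ) * Q = ∑ᶠ P ∈ connectedPatterns s μ ν, zetaProd μ ν P ∧
      coeffAt r Q = coeffAt r (cumulant (hurwitzSeries (s := s) μ ν) Finset.univ) := by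
    rcases Nat.eq_zero_or_pos s with rfl | hs
    · exact exists_quotient_of_zero r hm hμ hν hd
    · exact ⟨_, sum_zetaProd_of_pos hs hm hμ hν, rfl⟩
  obtain ⟨Q, h1, h2⟩ := hQ
  refine ⟨hfin, zeta_finalArg_ne_zero _, Q, h1, ?_⟩
  rw [h2, coeffAt_cumulant r hμ hν, ← mul_assoc, one_div_mul_cancel hw, one_mul]
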